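/- Let $\mathcal H$ be a real or complex separable Hilbert space and let $\mathfrak L:\mathrm{Dom}(\mathfrak L)\subset\mathcal H\to\mathcal H$ be a densely defined positive linear operator with an orthonormal basis $\{e_\zeta\}_{\zeta\in I}$ of $\mathcal H$ ($I$ countable) consisting of eigenfunctions, $\mathfrak L e_\zeta=\gamma_\zeta e_\zeta$, $\gamma_\zeta\in\mathbb R$, and with spectrum $\sigma(\mathfrak L)=\{\gamma_\zeta:\zeta\in I\}$. Let $\mathcal H^\infty_{\mathfrak L}=\bigcap_{k\ge1}\mathrm{Dom}(\mathfrak L^k)$ with the seminorms $\max_{j\le k}\|\mathfrak L^j\varphi\|$, and let $\mathcal H^{-\infty}_{\mathfrak L}$ be the space of continuous conjugate-linear functionals $\varphi\mapsto(u,\varphi)$ on $\mathcal H^\infty_{\mathfrak L}$, which contains $\mathcal H$ through the scalar product. For $\delta\in\mathbb R$ let $\mathcal H^\delta_{\mathfrak L}$ be the space of all $u\in\mathcal H^{-\infty}_{\mathfrak L}$ with $$\|u\|_{\mathcal H^\delta_{\mathfrak L}}=\Big(\sum_{\zeta\in I}(1+\gamma_\zeta)^\delta|(u,e_\zeta)|^2\Big)^{1/2}<\infty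 .$$ For $1<\beta<2$ let ${}^C\partial^\beta f(t)=\frac1{\Gamma(2-\beta)}\int_0^t(t-s)^{1-\beta}f''(s)\,ds$ be the Dzhrbashyan–Caputo derivative, for scalar functions $f$ on $[0,\infty)$ such that $f'$ exists and is absolutely continuous on bounded intervals, and let $E_{\nu,\rho}(z)=\sum_{k\ge0}z^k/\Gamma(\nu k+\rho)$, $E_\nu=E_{\nu,1}$, be the Mittag-Leffler functions. For $w_0,w_1\in\mathcal H^{-\infty}_{\mathfrak L}$, a solution of $$ {}^C\partial^\beta w(t)+\mathfrak L w(t)=0\quad(t>0),\qquad w(0)=w_0,\quad w'(0)=w_1, \tag{$*$}$$ is a map $w:[0,\infty)\to\mathcal H^{-\infty}_{\mathfrak L}$ such that $w(0)=w_0$ and, for every $\varphi\in\mathcal H^\infty_{\mathfrak L}$, the function $f_\varphi(t)=(w(t),\varphi)$ has a derivative on $[0,\infty)$ that is absolutely continuous on bounded intervals, $f_\varphi'(0)=(w_1,\varphi)$, and for all $t>0$ the integral defining ${}^C\partial^\beta f_\varphi(t)$ converges absolutely and ${}^C\partial^\beta f_\varphi(t)+(w(t),\mathfrak L\varphi)=0$.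 **Theorem.** Let $1<\beta<2$ and $\delta\in\mathbb R$. In each of the cases (1)–(4) below, problem $(*)$ has a solution $w$; it is the only solution; $w(t)\in\mathcal H^\delta_{\mathfrak L}$ for all $t\ge0$; $w$ is continuous with values in $\mathcal H^\delta_{\mathfrak L}$, on $[0,\infty)$ in the cases (1)–(3) and on $(0,\infty)$ in the case (4); for every $t\ge0$ $$w(t)=\sum_{\zeta\in I}\Big[(w_0,e_\zeta)E_\beta(-\gamma_\zeta t^\beta)+t\,(w_1,e_\zeta)E_{\beta,2}(-\gamma_\zeta t^\beta)\Big]e_\zeta$$ with convergence in $\mathcal H^\delta_{\mathfrak L}$; and the stated estimate holds with a constant $C>0$ that does not depend on $w_0$, $w_1$ and $t$. 1. If $w_0,w_1\in\mathcal H^\delta_{\mathfrak L}$ (whether or not $0\in\sigma(\mathfrak L)$), then $\|w(t)\|_{\mathcal H^\delta_{\mathfrak L}}\le C\big(\|w_0\|_{\mathcal H^\delta_{\mathfrak L}}+t\|w_1\|_{\mathcal H^\delta_{\mathfrak L}}\big)$ for $t\ge0$. 2. If $0\notin\sigma(\mathfrak L)$ and $w_0,w_1\in\mathcal H^\delta_{\mathfrak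 L}$, then $\|w(t)\|_{\mathcal H^\delta_{\mathfrak L}}\le C\big((1+t^\beta)^{-1}\|w_0\|_{\mathcal H^\delta_{\mathfrak L}}+t(1+t^\beta)^{-1}\|w_1\|_{\mathcal H^\delta_{\mathfrak L}}\big)$ for $t\ge0$. 3. If $w_0\in\mathcal H^\delta_{\mathfrak L}$ and $w_1\in\mathcal H^{\delta-2/\beta}_{\mathfrak L}$, then $\|w(t)\|_{\mathcal H^\delta_{\mathfrak L}}\le C\big(\|w_0\|_{\mathcal H^\delta_{\mathfrak L}}+(1+t)\|w_1\|_{\mathcal H^{\delta-2/\beta}_{\mathfrak L}}\big)$ for $t\ge0$. 4. If $w_0\in\mathcal H^\delta_{\mathfrak L}$ and $w_1\in\mathcal H^{\delta-2}_{\mathfrak L}$, then $\|w(t)\|_{\mathcal H^\delta_{\mathfrak L}}\le C\big(\|w_0\|_{\mathcal H^\delta_{\mathfrak L}}+t(1+t^{-\beta})\|w_1\|_{\mathcal H^{\delta-2}_{\mathfrak L}}\big)$ for $t>0$. -/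

import Mathlib

open Set Filter Topology MeasureTheory
open scoped InnerProductSpace

namespace SpectralWave

/-! ## Mittag-Leffler functions and the Dzhrbashyan-Caputo derivative -/

/-- The two-parametric Mittag-Leffler function `E_{ν,ρ}(x) = ∑ x ^ k / Γ(ν k + ρ)` at a real
argument; `E_ν = E_{ν,1}`. -/
noncomputable def mittagLeffler (ν ρ x : ℝ) : ℝ :=
  ∑' k : ℕ, x ^ k / Real.Gamma (ν * k + ρ)

section Caputo

variable {𝕜 : Type*} [RCLike 𝕜]

/-- `f ∈ AC^n[0, T]` for every `T > 0` (for `n ≥ 1`): the derivative `f^(n-1)` exists on `[0, ∞)`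
(one-sided at `0`) and is absolutely continuous on bounded intervals. -/
def IsACn (n : ℕ) (f : ℝ → 𝕜) : Prop :=
  ContDiffOn ℝ ((n - 1 : ℕ) : WithTop ℕ∞) f (Ici 0) ∧
    ∀ T : ℝ, 0 < T →
      AbsolutelyContinuousOnInterval (iteratedDerivWithin (n - 1) f (Ici 0)) 0 T

/-- With `n = ⌊β⌋ + 1`: the Dzhrbashyan-Caputo derivative of order `β` with base point `0`,
`(1 / Γ(n - β)) ∫₀ᵗ (t - s)^(n - β - 1) f^(n)(s) ds`,
is given at `t` by a convergent integral and is equal to `c`. -/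
def HasCaputoDerivAt (β : ℝ) (f : ℝ → 𝕜) (c : 𝕜) (t : ℝ) : Prop :=
  let n : ℕ := ⌊β⌋₊ + 1
  IntervalIntegrable
      (fun s => (t - s) ^ ((n : ℝ) - β - 1) • iteratedDerivWithin n f (Ici 0) s) volume 0 t ∧
    (Real.Gamma ((n : ℝ) - β))⁻¹ •
      (∫ s in (0 : ℝ)..t, (t - s) ^ ((n : ℝ) - β - 1) • iteratedDerivWithin n f (Ici 0) s) = c

end Caputo

section Operator

variable {𝕜 H : Type*} [RCLike 𝕜] [NormedAddCommGroup H] [InnerProductSpace 𝕜 H]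

/-! ## Unbounded operators -/

/-- The operator is positive: `(L x, x)` is real and nonnegative for `x ∈ Dom L`. -/
def IsPositive (L : H →ₗ.[𝕜] H) : Prop :=
  ∀ x : L.domain, 0 ≤ RCLike.re ⟪L x, (x : H)⟫_𝕜 ∧ RCLike.im ⟪L x, (x : H)⟫_𝕜 = 0

/-- The resolvent set: all `z` such that `L - z : Dom L → H` has a bounded two-sided inverse. -/
def resolventSet (L : H →ₗ.[𝕜] H) : Set 𝕜 :=
  {z | ∃ R : H →L[𝕜] H,
    (∀ y : H, ∃ h : R y ∈ L.domain, L ⟨R y, h⟩ - z • R y = y) ∧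
      ∀ x : L.domain, R (L x - z • (x : H)) = x}

/-- The spectrum of an unbounded operator. -/
def spectrum (L : H →ₗ.[𝕜] H) : Set 𝕜 := (resolventSet L)ᶜ

/-- `Dom(L^k)`: the domain of the iterated operator. -/
def domPow (L : H →ₗ.[𝕜] H) : ℕ → Submodule 𝕜 H
  | 0 => ⊤
  | k + 1 => ((domPow L k).comap L.toFun).map L.domain.subtype

theorem mem_domPow_succ {L : H →ₗ.[𝕜] H} {k : ℕ} {x : H} :
    x ∈ domPow L (k + 1) ↔ ∃ h : x ∈ L.domain, L ⟨x, h⟩ ∈ domPow L k := by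
  simp only [domPow, Submodule.mem_map, Submodule.mem_comap, Submodule.subtype_apply]
  constructor
  · rintro ⟨y, hy, rfl⟩
    exact ⟨y.2, hy⟩
  · rintro ⟨h, hx⟩
    exact ⟨⟨x, h⟩, hx, rfl⟩

/-! ## Test functions and distributions of the operator -/

/-- The space of test functions `H^∞ = ⋂ₖ Dom(L^k)`. -/
def testSpace (L : H →ₗ.[𝕜] H) : Submodule 𝕜 H := ⨅ k : ℕ, domPow L k

theorem testSpace_le_domain (L : H →ₗ.[𝕜] H) : testSpace L ≤ L.domain := by
  intro x hx
  obtain ⟨h, -⟩ := mem_domPow_succ.1 ((Submodule.mem_iInf _).1 hx 1)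
  exact h

theorem apply_mem_testSpace {L : H →ₗ.[𝕜] H} {x : H} (hx : x ∈ testSpace L) :
    L ⟨x, testSpace_le_domain L hx⟩ ∈ testSpace L := by
  refine (Submodule.mem_iInf _).2 fun k => ?_
  obtain ⟨h, h'⟩ := mem_domPow_succ.1 ((Submodule.mem_iInf _).1 hx (k + 1))
  exact h'

/-- The operator acting on test functions. -/
def testOp (L : H →ₗ.[𝕜] H) : testSpace L →ₗ[𝕜] testSpace L :=
  (L.toFun.comp (Submodule.inclusion (testSpace_le_domain L))).codRestrict (testSpace L)
    fun x => apply_mem_testSpace x.2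

/-- The seminorms `max_{j ≤ k} ‖L^j φ‖` on test functions. -/
noncomputable def testSeminorm (L : H →ₗ.[𝕜] H) (k : ℕ) (φ : testSpace L) : ℝ :=
  (Finset.range (k + 1)).sup' Finset.nonempty_range_add_one
    fun j => ‖(((testOp L) ^ j) φ : H)‖

theorem testSeminorm_mono (L : H →ₗ.[𝕜] H) {k l : ℕ} (h : k ≤ l) (φ : testSpace L) :
    testSeminorm L k φ ≤ testSeminorm L l φ :=
  Finset.sup'_mono _ (Finset.range_mono (by omega)) _

theorem norm_le_testSeminorm (L : H →ₗ.[𝕜] H) (φ : testSpace L) :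
    ‖(φ : H)‖ ≤ testSeminorm L 0 φ := by
  simp [testSeminorm]

theorem testSeminorm_nonneg (L : H →ₗ.[𝕜] H) (k : ℕ) (φ : testSpace L) :
    0 ≤ testSeminorm L k φ :=
  (norm_nonneg _).trans ((norm_le_testSeminorm L φ).trans (testSeminorm_mono L k.zero_le φ))

/-- The space of distributions `H^{-∞}`: all continuous conjugate-linear functionals
`φ ↦ (u, φ)` on the test functions. -/
def distributions (L : H →ₗ.[𝕜] H) : Submodule 𝕜 (testSpace L →ₗ⋆[𝕜] 𝕜) where
  carrier := {u | ∃ (k : ℕ) (C : ℝ), ∀ φ, ‖u φ‖ ≤ C * testSeminorm L k φ}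
  zero_mem' := ⟨0, 0, fun φ => by simp⟩
  add_mem' := by
    rintro u v ⟨k, C, hu⟩ ⟨l, D, hv⟩
    refine ⟨max k l, |C| + |D|, fun φ => ?_⟩
    have h1 : C * testSeminorm L k φ ≤ |C| * testSeminorm L (max k l) φ :=
      mul_le_mul (le_abs_self C) (testSeminorm_mono L (le_max_left k l) φ)
        (testSeminorm_nonneg L k φ) (abs_nonneg C)
    have h2 : D * testSeminorm L l φ ≤ |D| * testSeminorm L (max k l) φ :=
      mul_le_mul (le_abs_self D) (testSeminorm_mono L (le_max_right k l) φ)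
        (testSeminorm_nonneg L l φ) (abs_nonneg D)
    calc ‖(u + v) φ‖ ≤ ‖u φ‖ + ‖v φ‖ := by
          rw [LinearMap.add_apply]
          exact norm_add_le _ _
      _ ≤ (|C| + |D|) * testSeminorm L (max k l) φ := by
          have := hu φ
          have := hv φ
          linarith
  smul_mem' := by
    rintro c u ⟨k, C, hu⟩
    refine ⟨k, ‖c‖ * C, fun φ => ?_⟩
    rw [LinearMap.smul_apply, norm_smul, mul_assoc]
    exact mul_le_mul_of_nonneg_left (hu φ) (norm_nonneg c)

/-- The pairing `(u, φ)` of a distribution with a test function. -/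
def pairing {L : H →ₗ.[𝕜] H} (u : distributions L) (φ : testSpace L) : 𝕜 :=
  (u : testSpace L →ₗ⋆[𝕜] 𝕜) φ

/-- The embedding of `H` into the distributions, `(f, φ)` being the scalar product of `H`. -/
noncomputable def ofHilbert (L : H →ₗ.[𝕜] H) (f : H) : distributions L :=
  ⟨{  toFun := fun φ => ⟪(φ : H), f⟫_𝕜
      map_add' := fun φ ψ => by simp [inner_add_left]
      map_smul' := fun c φ => by simp [inner_smul_left] },
    0, ‖f‖, fun φ => by
      refine (norm_inner_le_norm (φ : H) f).trans ?_
      rw [mul_comm]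
      exact mul_le_mul_of_nonneg_left (norm_le_testSeminorm L φ) (norm_nonneg f)⟩

/-! ## The wave type equation -/

/-- `w : [0, ∞) → H^{-∞}` solves `∂^β w + L w = 0` for `t > 0`, with `w(0) = w₀` and `w'(0) = w₁`,
in the sense of distributions of `L`: for each test function `φ` the scalar function
`t ↦ (w(t), φ)` has the regularity that the Caputo derivative of order `β` requires, and
`∂^β (w(t), φ) + (w(t), L φ) = 0`. Values of `w` at negative times play no role. -/
structure IsWaveSolution (L : H →ₗ.[𝕜] H) (β : ℝ) (w₀ w₁ : distributions L)
    (w : ℝ → distributions L) : Prop where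
  regular : ∀ φ : testSpace L, IsACn (⌊β⌋₊ + 1) fun t => pairing (w t) φ
  initial : w 0 = w₀
  initial_deriv : ∀ φ : testSpace L,
    derivWithin (fun t => pairing (w t) φ) (Ici 0) 0 = pairing w₁ φ
  equation : ∀ t : ℝ, 0 < t → ∀ φ : testSpace L,
    HasCaputoDerivAt β (fun s => pairing (w s) φ) (-pairing (w t) (testOp L φ)) t

/-! ## Eigenfunction expansions and Sobolev spaces -/

/-- An orthonormal basis of `H` that consists of eigenfunctions `e_ζ` of `L`, with eigenvalues
`γ_ζ`. -/
structure EigenBasis (L : H →ₗ.[𝕜] H) (I : Type*) where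
  basis : HilbertBasis I 𝕜 H
  eigenvalue : I → ℝ
  mem_domain : ∀ ζ, basis ζ ∈ L.domain
  apply_eq : ∀ ζ, L ⟨basis ζ, mem_domain ζ⟩ = (eigenvalue ζ : 𝕜) • basis ζ

namespace EigenBasis

variable {L : H →ₗ.[𝕜] H} {I : Type*} (E : EigenBasis L I)

theorem mem_testSpace (ζ : I) : E.basis ζ ∈ testSpace L := by
  refine (Submodule.mem_iInf _).2 fun k => ?_
  induction k with
  | zero => exact Submodule.mem_top
  | succ k ih =>
    refine mem_domPow_succ.2 ⟨E.mem_domain ζ, ?_⟩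
    rw [E.apply_eq]
    exact Submodule.smul_mem _ _ ih

/-- The Fourier coefficient `(u, e_ζ)`. -/
noncomputable def coeff (u : distributions L) (ζ : I) : 𝕜 := pairing u ⟨E.basis ζ, E.mem_testSpace ζ⟩

/-- `u` belongs to the Sobolev space of order `δ`, i.e. `(1 + L)^(δ/2) u ∈ H`. -/
def MemSobolev (δ : ℝ) (u : distributions L) : Prop :=
  Summable fun ζ => (1 + E.eigenvalue ζ) ^ δ * ‖E.coeff u ζ‖ ^ 2

/-- The Sobolev norm of order `δ`, i.e. the norm of `(1 + L)^(δ/2) u` in `H`. -/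
noncomputable def sobolevNorm (δ : ℝ) (u : distributions L) : ℝ :=
  √(∑' ζ, (1 + E.eigenvalue ζ) ^ δ * ‖E.coeff u ζ‖ ^ 2)

/-- `w` maps `S` into the Sobolev space of order `δ`, continuously for the Sobolev norm. -/
def SobolevContinuousOn (δ : ℝ) (w : ℝ → distributions L) (S : Set ℝ) : Prop :=
  (∀ t ∈ S, E.MemSobolev δ (w t)) ∧
    ∀ t ∈ S, Tendsto (fun s => E.sobolevNorm δ (w s - w t)) (𝓝[S] t) (𝓝 0)

/-- The coefficient `(w₀, e_ζ) E_β(-γ_ζ t^β) + t (w₁, e_ζ) E_{β,2}(-γ_ζ t^β)`. -/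
noncomputable def waveCoeff (β : ℝ) (w₀ w₁ : distributions L) (t : ℝ) (ζ : I) : 𝕜 :=
  E.coeff w₀ ζ * (mittagLeffler β 1 (-(E.eigenvalue ζ) * t ^ β) : 𝕜) +
    (t : 𝕜) * E.coeff w₁ ζ * (mittagLeffler β 2 (-(E.eigenvalue ζ) * t ^ β) : 𝕜)

/-- At every time `t ≥ 0`, `w(t) = ∑_ζ [(w₀, e_ζ) E_β(-γ_ζ t^β) + t (w₁, e_ζ) E_{β,2}(-γ_ζ t^β)] e_ζ`
with (unconditional) convergence in the Sobolev space of order `δ`. -/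
def IsWaveSeries (β δ : ℝ) (w₀ w₁ : distributions L) (w : ℝ → distributions L) : Prop :=
  ∀ t : ℝ, 0 ≤ t → E.MemSobolev δ (w t) ∧
    Tendsto (fun s : Finset I =>
      E.sobolevNorm δ (w t - ∑ ζ ∈ s, E.waveCoeff β w₀ w₁ t ζ • ofHilbert L (E.basis ζ)))
      atTop (𝓝 0)

end EigenBasis

end Operator

end SpectralWave

/-! The problem is diagonal in the basis `e_ζ`, and everything reduces to scalar functions of `γ_ζ`
and `t`.

Diagonality itself needs an argument, since `L` is not assumed self-adjoint or closed. The spectrum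
is a countable set, so some `z` lies in the resolvent set. The bounded operator `(L - z)⁻¹` is
diagonal on the basis, hence by density in every coordinate functional, and this gives `(L x, e_ζ) =
γ_ζ (x, e_ζ)` on all of `Dom L` (`EigenBasis.isDiagonal`). Then distributions correspond exactly to
coefficient families that are square summable against some weight `(1 + γ_ζ)^(-2k)`, and the pairing
with a test function is an absolutely convergent sum (`hasSum_pairing`, `exists_summable_weight`,
`exists_distribution`).

The equation is handled in integrated form. With `I^a` the Riemann-Liouville integral, the problem
for `f = (w, φ)` is equivalent to the Volterra equation `f = f(0) + t f'(0) - I^β (w, Lφ)`. On the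
power series of the Mittag-Leffler functions `I^β` is a shift of the index, so each coefficient
solves its scalar Volterra equation (`mlWave_volterra`); the bounded multipliers allow summation
against test functions (`pairing_wave_volterra`). Returning to the Caputo derivative uses the
Volterra equations for both `φ` and `Lφ` (`caputo_of_volterra`): `f''` behaves like `t^(β-2)` at the
origin, which is singular but integrable. For uniqueness one tests with `e_ζ`, integrates the Caputo
equation (`volterra_of_caputo`), and applies Gronwall's inequality (`volterra_unique`).

The estimates rest on one analytic fact, `|E_{β,ρ}(-x)| ≤ M / (1 + x)` for `x ≥ 0` and `ρ = 1, 2`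
(`exists_mittagLeffler_le`). Hankel's formula for `1/Γ`, summed as a geometric series, represents
`2πi E_{β,ρ}(-x)` as the contour integral of `e^s s^(β-ρ) / (s^β + x)`. In the coordinate `s = e^ζ`
there is no branch cut, and the contour consists of two horizontal half-lines at heights `±θ` and a
vertical segment. Because `β < 2` one can take `π/2 < θ < π/β`: then `e^s` decays on both rays while
`s^β + x` has no zero between them. Pushing the segment to `-∞` leaves the two rays, where `|s^β +
x| ≥ x sin(βθ)`. The four cases differ only in the elementary inequality that bounds the multipliers
`(1 + γ)^((δ-δ')/2) t / (1 + γ t^β)`; dominated convergence in the coefficients gives continuity and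
convergence of the series. -/

namespace SpectralWave

/-! ## Riemann-Liouville fractional integrals -/

section FracInt

variable {F : Type*} [NormedAddCommGroup F] [NormedSpace ℝ F]

/-- The Riemann-Liouville fractional integral of order `a` with base point `0`. -/
noncomputable def fracInt (a : ℝ) (k : ℝ → F) (t : ℝ) : F :=
  (Real.Gamma a)⁻¹ • ∫ s in (0 : ℝ)..t, (t - s) ^ (a - 1) • k s

theorem integral_beta_kernel {p q r t : ℝ} (hp : 0 < p) (hq : 0 < q) (hrt : r < t) :
    ∫ s in r..t, (t - s) ^ (p - 1) * (s - r) ^ (q - 1) =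
      (t - r) ^ (p + q - 1) * (Real.Gamma p * Real.Gamma q / Real.Gamma (p + q)) := by
  have h0 : 0 < t - r := sub_pos.2 hrt
  have h1 := Complex.betaIntegral_scaled (q : ℂ) (p : ℂ) h0
  have h2 := Complex.betaIntegral_eq_Gamma_mul_div (q : ℂ) (p : ℂ) (by simpa) (by simpa)
  have h3 : ∫ s in r..t, (t - s) ^ (p - 1) * (s - r) ^ (q - 1) =
      ∫ x in (0 : ℝ)..(t - r), x ^ (q - 1) * (t - r - x) ^ (p - 1) := by
    have := intervalIntegral.integral_comp_sub_right
      (fun x => x ^ (q - 1) * (t - r - x) ^ (p - 1)) (a := r) (b := t) r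
    rw [sub_self] at this
    rw [← this]
    refine intervalIntegral.integral_congr fun s _ => ?_
    simp only [sub_sub_sub_cancel_right]
    ring
  have h4 : ((∫ x in (0 : ℝ)..(t - r), x ^ (q - 1) * (t - r - x) ^ (p - 1) : ℝ) : ℂ) =
      ∫ x in (0 : ℝ)..(t - r), (x : ℂ) ^ ((q : ℂ) - 1) * (((t - r : ℝ) : ℂ) - x) ^ ((p : ℂ) - 1) := by
    rw [← intervalIntegral.integral_ofReal]
    refine intervalIntegral.integral_congr fun s hs => ?_
    rw [uIcc_of_le h0.le] at hs
    simp only [Complex.ofReal_mul]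
    rw [Complex.ofReal_cpow hs.1, Complex.ofReal_cpow (by linarith [hs.2])]
    push_cast
    rfl
  rw [h3]
  apply Complex.ofReal_injective
  rw [h4, h1, h2]
  push_cast
  rw [Complex.ofReal_cpow h0.le, ← Complex.Gamma_ofReal, ← Complex.Gamma_ofReal,
    ← Complex.Gamma_ofReal]
  push_cast
  rw [add_comm (q : ℂ) p, mul_comm (Complex.Gamma q)]

theorem intervalIntegrable_beta_kernel {p q r t : ℝ} (hp : 0 < p) (hq : 0 < q) (hrt : r ≤ t) :
    IntervalIntegrable (fun s => (t - s) ^ (p - 1) * (s - r) ^ (q - 1)) volume r t := by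
  rcases hrt.eq_or_lt with rfl | h
  · simp
  -- The integral of a non-integrable function is `0` by convention, so the nonzero Beta value
  -- already proves integrability.
  refine intervalIntegral.intervalIntegrable_of_integral_ne_zero ?_
  rw [integral_beta_kernel hp hq h]
  have := Real.Gamma_pos_of_pos hp
  have := Real.Gamma_pos_of_pos hq
  have := Real.Gamma_pos_of_pos (add_pos hp hq)
  have := Real.rpow_pos_of_pos (sub_pos.2 h) (p + q - 1)
  positivity

theorem intervalIntegrable_rpow_sub {p t : ℝ} (hp : 0 < p) (ht : 0 ≤ t) :
    IntervalIntegrable (fun s => (t - s) ^ (p - 1)) volume 0 t := by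
  simpa using intervalIntegrable_beta_kernel hp one_pos ht

/-- The side condition excludes only `t = 0` with `p + q = 1`, where the integral vanishes but `0 ^
0 = 1`. -/
theorem fracInt_rpow {p q t : ℝ} (hp : 0 < p) (hq : 0 < q) (ht : 0 ≤ t) (h : 0 < t ∨ p + q ≠ 1) :
    fracInt p (fun s => s ^ (q - 1) / Real.Gamma q) t =
      t ^ (p + q - 1) / Real.Gamma (p + q) := by
  have hp' := (Real.Gamma_pos_of_pos hp).ne'
  have hq' := (Real.Gamma_pos_of_pos hq).ne'
  rcases ht.eq_or_lt with rfl | h0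
  · have : p + q - 1 ≠ 0 := sub_ne_zero.2 (h.resolve_left (lt_irrefl _))
    simp [fracInt, Real.zero_rpow this]
  have := integral_beta_kernel hp hq h0
  simp only [sub_zero] at this
  simp only [fracInt, smul_eq_mul, ← mul_div_assoc, intervalIntegral.integral_div, this]
  field_simp

theorem fracInt_one (k : ℝ → F) (t : ℝ) : fracInt 1 k t = ∫ s in (0 : ℝ)..t, k s := by
  simp [fracInt]

theorem fracInt_congr {a t : ℝ} {k l : ℝ → F} (ht : 0 ≤ t) (h : ∀ s ∈ Ioc 0 t, k s = l s) :
    fracInt a k t = fracInt a l t := by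
  unfold fracInt
  congr 1
  refine intervalIntegral.integral_congr_ae (Eventually.of_forall fun s hs => ?_)
  rw [uIoc_of_le ht] at hs
  simp only [h s hs]

/-- Semigroup law: Fubini on the triangle `r ≤ s ≤ t`, the inner integral being a Beta integral. The
condition `1 ≤ p + q` makes the resulting kernel `(t - r)^(p+q-1)` continuous, so mere integrability
of `k` suffices. -/
theorem fracInt_fracInt [CompleteSpace F] {p q t : ℝ} (hp : 0 < p) (hq : 0 < q)
    (hpq : 1 ≤ p + q) (ht : 0 ≤ t) {k : ℝ → F} (hk : IntervalIntegrable k volume 0 t) :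
    fracInt p (fracInt q k) t = fracInt (p + q) k t := by
  have hp' := (Real.Gamma_pos_of_pos hp).ne'
  have hq' := (Real.Gamma_pos_of_pos hq).ne'
  set B : ℝ := Real.Gamma p * Real.Gamma q / Real.Gamma (p + q) with hB
  set μ : Measure ℝ := volume.restrict (Ioc 0 t) with hμ
  -- The product of the two kernels, extended by zero from the triangle to the square `(0, t]²`.
  set ψ : ℝ → ℝ → ℝ := fun s r =>
    (Iic s).indicator (fun _ => (t - s) ^ (p - 1) * (s - r) ^ (q - 1)) r with hψ
  have hψm : Measurable (Function.uncurry ψ) := by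
    have : Function.uncurry ψ = {x : ℝ × ℝ | x.2 ≤ x.1}.indicator
        (fun x => (t - x.1) ^ (p - 1) * (x.1 - x.2) ^ (q - 1)) := by
      ext ⟨s, r⟩
      simp [hψ, Set.indicator, Function.uncurry]
    rw [this]
    refine Measurable.indicator ?_ (measurableSet_le measurable_snd measurable_fst)
    fun_prop
  have hk' : Integrable k μ := (intervalIntegrable_iff_integrableOn_Ioc_of_le ht).1 hk
  have key : ∀ r ∈ Ioc 0 t, ∀ f : ℝ → ℝ → ℝ, (∀ s, s < r → f s r = 0) →
      ∫ s, f s r ∂μ = ∫ s in r..t, f s r := by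
    intro r hr f hf
    rw [hμ, intervalIntegral.integral_of_le hr.2, ← integral_Icc_eq_integral_Ioc (x := r)]
    refine setIntegral_eq_of_subset_of_forall_sdiff_eq_zero (f := fun s => f s r)
      measurableSet_Ioc (s := Icc r t) (fun s hs => ⟨hr.1.trans_le hs.1, hs.2⟩) fun s hs => hf s ?_
    by_contra h
    exact hs.2 ⟨not_lt.1 h, hs.1.2⟩
  have hψint : ∀ r ∈ Ioc 0 t, Integrable (fun s => ψ s r) μ := by
    intro r hr
    have h1 : IntegrableOn (fun s => (t - s) ^ (p - 1) * (s - r) ^ (q - 1)) (Icc r t) := by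
      rw [integrableOn_Icc_iff_integrableOn_Ioc]
      exact (intervalIntegrable_iff_integrableOn_Ioc_of_le hr.2).1
        (intervalIntegrable_beta_kernel hp hq hr.2)
    have h2 := (integrable_indicator_iff measurableSet_Icc).2 h1
    refine (h2.mono_measure Measure.restrict_le_self).congr ?_
    filter_upwards [ae_restrict_mem measurableSet_Ioc] with s hs
    simp [hψ, Set.indicator, hs.2]
  have hψval : ∀ r ∈ Ioc 0 t, r < t → ∫ s, ψ s r ∂μ = (t - r) ^ (p + q - 1) * B := by
    intro r hr hrt
    rw [key r hr ψ (fun s hs => by simp [hψ, hs]), hB, ← integral_beta_kernel hp hq hrt]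
    refine intervalIntegral.integral_congr fun s hs => ?_
    rw [uIcc_of_le hrt.le] at hs
    simp [hψ, hs.1]
  have hψ0 : ∀ r, ∀ s ∈ Ioc 0 t, 0 ≤ ψ s r := by
    intro r s hs
    by_cases hr : r ≤ s
    · simp only [hψ, indicator_of_mem (mem_Iic.2 hr)]
      exact mul_nonneg (Real.rpow_nonneg (by linarith [hs.2]) _)
        (Real.rpow_nonneg (by linarith) _)
    · simp [hψ, hr]
  -- At `r = t` the Beta formula can fail (again `0 ^ 0` when `p + q = 1`); the point is negligible.
  have hne : ∀ᵐ r ∂μ, r ≠ t := by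
    refine ae_restrict_of_ae ?_
    simp [ae_iff]
  have hΦ : Integrable (Function.uncurry fun s r => ψ s r • k r) (μ.prod μ) := by
    have hm : AEStronglyMeasurable (Function.uncurry fun s r => ψ s r • k r) (μ.prod μ) :=
      hψm.aestronglyMeasurable.smul (hk'.aestronglyMeasurable.comp_snd)
    rw [integrable_prod_iff' hm]
    constructor
    · filter_upwards [ae_restrict_mem measurableSet_Ioc] with r hr
      exact (hψint r hr).smul_const (k r)
    · have hc : Continuous fun r : ℝ => (t - r) ^ (p + q - 1) :=
        (continuous_const.sub continuous_id).rpow_const fun _ => Or.inr (by linarith)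
      have h3 : IntervalIntegrable (fun r => (t - r) ^ (p + q - 1) * B * ‖k r‖) volume 0 t :=
        hk.norm.continuousOn_mul (hc.mul continuous_const).continuousOn
      refine ((intervalIntegrable_iff_integrableOn_Ioc_of_le ht).1 h3).congr ?_
      filter_upwards [ae_restrict_mem measurableSet_Ioc, hne] with r hr hrt
      rw [← hψval r hr (lt_of_le_of_ne hr.2 hrt), ← integral_mul_const]
      refine integral_congr_ae ?_
      filter_upwards [ae_restrict_mem measurableSet_Ioc] with s hs
      simp only [Function.uncurry]
      rw [norm_smul, Real.norm_of_nonneg (hψ0 r s hs)]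
  have hswap := integral_integral_swap hΦ
  have hL : ∫ s, ∫ r, ψ s r • k r ∂μ ∂μ =
      ∫ s in (0 : ℝ)..t, (t - s) ^ (p - 1) • ∫ r in (0 : ℝ)..s, (s - r) ^ (q - 1) • k r := by
    rw [intervalIntegral.integral_of_le ht]
    refine setIntegral_congr_fun measurableSet_Ioc fun s hs => ?_
    rw [intervalIntegral.integral_of_le hs.1.le, ← integral_smul]
    have : Ioc 0 s = Ioc 0 t ∩ Iic s := by
      ext r
      simp only [mem_Ioc, mem_inter_iff, mem_Iic]
      constructor
      · exact fun h => ⟨⟨h.1, h.2.trans hs.2⟩, h.2⟩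
      · exact fun h => ⟨h.1.1, h.2⟩
    rw [this, ← setIntegral_indicator measurableSet_Iic]
    refine setIntegral_congr_fun measurableSet_Ioc fun r _ => ?_
    by_cases hrs : r ≤ s
    · simp [hψ, hrs, mul_smul]
    · simp [hψ, hrs]
  have hR : ∫ r, ∫ s, ψ s r • k r ∂μ ∂μ =
      B • ∫ r in (0 : ℝ)..t, (t - r) ^ (p + q - 1) • k r := by
    rw [intervalIntegral.integral_of_le ht, ← integral_smul]
    refine integral_congr_ae ?_
    filter_upwards [ae_restrict_mem measurableSet_Ioc, hne] with r hr hrt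
    rw [integral_smul_const, hψval r hr (lt_of_le_of_ne hr.2 hrt), ← mul_smul, mul_comm]
  rw [hL, hR] at hswap
  simp only [fracInt]
  simp only [smul_comm _ (Real.Gamma q)⁻¹, intervalIntegral.integral_smul]
  rw [hswap, ← mul_smul, ← mul_smul, hB]
  congr 1
  field_simp

/-- Rescaling to a fixed interval of integration. -/
theorem fracInt_eq_scaled {a t : ℝ} (ht : 0 ≤ t) (ha : a ≠ 0) (k : ℝ → F) :
    fracInt a k t =
      (Real.Gamma a)⁻¹ • t ^ a • ∫ x in (0 : ℝ)..1, (1 - x) ^ (a - 1) • k (t * x) := by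
  rcases ht.eq_or_lt with rfl | h0
  · simp [fracInt, Real.zero_rpow ha]
  unfold fracInt
  congr 1
  have := intervalIntegral.smul_integral_comp_mul_left
    (fun s => (t - s) ^ (a - 1) • k s) t (a := 0) (b := 1)
  rw [mul_zero, mul_one] at this
  rw [← this, ← intervalIntegral.integral_smul, ← intervalIntegral.integral_smul]
  refine intervalIntegral.integral_congr fun x hx => ?_
  rw [uIcc_of_le zero_le_one] at hx
  rw [show t - t * x = t * (1 - x) by ring, Real.mul_rpow ht (by linarith [hx.2]), ← mul_smul,
    ← mul_smul, ← mul_assoc, ← Real.rpow_one_add' ht (by simpa using ha)]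
  simp

/-- After rescaling to `[0, 1]` the singular kernel no longer depends on `t`, and dominated
convergence applies with the bound of `k` on `[0, t + 1]`. -/
theorem continuousOn_fracInt {a : ℝ} (ha : 0 < a) {k : ℝ → F} (hk : ContinuousOn k (Ici 0)) :
    ContinuousOn (fracInt a k) (Ici 0) := by
  have h1 : ContinuousOn (fun t => ∫ x in (0 : ℝ)..1, (1 - x) ^ (a - 1) • k (t * x)) (Ici 0) := by
    intro t ht
    have ht' : (0 : ℝ) ≤ t := ht
    obtain ⟨M, hM⟩ := (isCompact_Icc (a := (0 : ℝ)) (b := t + 1)).exists_bound_of_continuousOn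
      (hk.mono Icc_subset_Ici_self)
    have hev : ∀ᶠ s in 𝓝[Ici 0] t, s ∈ Icc 0 (t + 1) := by
      filter_upwards [self_mem_nhdsWithin, mem_nhdsWithin_of_mem_nhds (Iio_mem_nhds (lt_add_one t))]
        with s hs hs'
      exact ⟨hs, (mem_Iio.1 hs').le⟩
    have hmem : ∀ {s x : ℝ}, 0 ≤ s → x ∈ Ioc (0 : ℝ) 1 → s * x ∈ Ici (0 : ℝ) := fun hs hx =>
      mul_nonneg hs hx.1.le
    refine intervalIntegral.tendsto_integral_filter_of_dominated_convergence
      (fun x => (1 - x) ^ (a - 1) * M) ?_ ?_ ?_ ?_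
    · filter_upwards [self_mem_nhdsWithin] with s hs
      rw [uIoc_of_le zero_le_one]
      refine AEStronglyMeasurable.smul (Measurable.aestronglyMeasurable (by fun_prop)) ?_
      refine ContinuousOn.aestronglyMeasurable ?_ measurableSet_Ioc
      exact hk.comp (by fun_prop) fun x hx => hmem hs hx
    · filter_upwards [hev] with s hs
      refine Eventually.of_forall fun x hx => ?_
      rw [uIoc_of_le zero_le_one] at hx
      rw [norm_smul, Real.norm_of_nonneg (Real.rpow_nonneg (by linarith [hx.2]) _)]
      refine mul_le_mul_of_nonneg_left (hM _ ⟨hmem hs.1 hx, ?_⟩)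
        (Real.rpow_nonneg (by linarith [hx.2]) _)
      nlinarith [hs.1, hs.2, hx.1, hx.2]
    · exact (intervalIntegrable_rpow_sub ha zero_le_one).mul_const M
    · refine Eventually.of_forall fun x hx => ?_
      rw [uIoc_of_le zero_le_one] at hx
      refine Tendsto.const_smul ?_ _
      have h2 : ContinuousWithinAt k (Ici 0) (t * x) := hk _ (hmem ht' hx)
      refine h2.tendsto.comp (tendsto_nhdsWithin_iff.2 ⟨?_, ?_⟩)
      · exact ((continuous_mul_const x).tendsto t).mono_left nhdsWithin_le_nhds
      · filter_upwards [self_mem_nhdsWithin] with s hs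
        exact hmem hs hx
  have h2 : ContinuousOn (fun t : ℝ => t ^ a) (Ici 0) :=
    (Real.continuous_rpow_const ha.le).continuousOn
  exact ((h2.smul h1).const_smul (Real.Gamma a)⁻¹).congr fun t ht =>
    fracInt_eq_scaled ht ha.ne' k

end FracInt

end SpectralWave

namespace SpectralWave

/-! ## Absolute continuity -/

theorem AbsolutelyContinuousOnInterval.congr_eqOn {X : Type*} [PseudoMetricSpace X] {f g : ℝ → X}
    {a b : ℝ} (hf : AbsolutelyContinuousOnInterval f a b) (h : EqOn f g (uIcc a b)) :
    AbsolutelyContinuousOnInterval g a b := by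
  rw [absolutelyContinuousOnInterval_iff] at hf ⊢
  intro ε hε
  obtain ⟨δ, hδ, H⟩ := hf ε hε
  refine ⟨δ, hδ, fun E hE hlt => ?_⟩
  refine (Finset.sum_congr rfl fun i hi => ?_).trans_lt (H E hE hlt)
  rw [h (hE.1 i hi).1, h (hE.1 i hi).2]

theorem AbsolutelyContinuousOnInterval.lipschitz_comp {X Y : Type*} [PseudoMetricSpace X]
    [PseudoMetricSpace Y] {f : ℝ → X} {L : X → Y} {a b : ℝ} (hL : LipschitzWith 1 L)
    (hf : AbsolutelyContinuousOnInterval f a b) :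
    AbsolutelyContinuousOnInterval (fun t => L (f t)) a b := by
  rw [absolutelyContinuousOnInterval_iff] at hf ⊢
  intro ε hε
  obtain ⟨δ, hδ, H⟩ := hf ε hε
  refine ⟨δ, hδ, fun E hE hlt => ?_⟩
  refine (Finset.sum_le_sum fun i _ => ?_).trans_lt (H E hE hlt)
  simpa using hL.dist_le_mul (f (E.2 i).1) (f (E.2 i).2)

/-- Real and imaginary parts are 1-Lipschitz images of `h`, so the real fundamental theorem applies
to each; the two derivatives recombine to that of `h` almost everywhere. -/
theorem AbsolutelyContinuousOnInterval.integral_deriv_eq_sub_rclike {𝕜 : Type*} [RCLike 𝕜]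
    {h : ℝ → 𝕜} {a b : ℝ} (hh : AbsolutelyContinuousOnInterval h a b) :
    IntervalIntegrable (deriv h) volume a b ∧ ∫ x in a..b, deriv h x = h b - h a := by
  have hre : AbsolutelyContinuousOnInterval (fun t => RCLike.re (h t)) a b :=
    lipschitz_comp (L := fun z : 𝕜 => RCLike.re z) (LipschitzWith.of_dist_le_mul fun x y => by
      simpa [dist_eq_norm] using RCLike.abs_re_le_norm (x - y)) hh
  have him : AbsolutelyContinuousOnInterval (fun t => RCLike.im (h t)) a b :=
    lipschitz_comp (L := fun z : 𝕜 => RCLike.im z) (LipschitzWith.of_dist_le_mul fun x y => by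
      simpa [dist_eq_norm] using RCLike.abs_im_le_norm (x - y)) hh
  have hae : ∀ᵐ x : ℝ, x ∈ uIoc a b → ((deriv (fun t => RCLike.re (h t)) x : ℝ) : 𝕜) +
      ((deriv (fun t => RCLike.im (h t)) x : ℝ) : 𝕜) * RCLike.I = deriv h x := by
    filter_upwards [hre.ae_differentiableAt, him.ae_differentiableAt] with x h1 h2 hx
    have hx' := uIoc_subset_uIcc hx
    have d1 := (RCLike.ofRealCLM (K := 𝕜)).hasFDerivAt.comp_hasDerivAt x (h1 hx').hasDerivAt
    have d2 := (RCLike.ofRealCLM (K := 𝕜)).hasFDerivAt.comp_hasDerivAt x (h2 hx').hasDerivAt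
    have d3 := d1.add (d2.mul_const (RCLike.I : 𝕜))
    have : h = (⇑(RCLike.ofRealCLM (K := 𝕜)) ∘ fun t => RCLike.re (h t)) + fun y =>
        (⇑(RCLike.ofRealCLM (K := 𝕜)) ∘ fun t => RCLike.im (h t)) y * (RCLike.I : 𝕜) := by
      ext y
      simp [RCLike.re_add_im]
    rw [← this] at d3
    rw [d3.deriv]
    simp
  have i1 : IntervalIntegrable (fun x => ((deriv (fun t => RCLike.re (h t)) x : ℝ) : 𝕜))
      volume a b :=
    ⟨hre.intervalIntegrable_deriv.1.ofReal, hre.intervalIntegrable_deriv.2.ofReal⟩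
  have i2 : IntervalIntegrable
      (fun x => ((deriv (fun t => RCLike.im (h t)) x : ℝ) : 𝕜) * RCLike.I) volume a b :=
    IntervalIntegrable.mul_const
      ⟨him.intervalIntegrable_deriv.1.ofReal, him.intervalIntegrable_deriv.2.ofReal⟩ _
  refine ⟨(i1.add i2).congr_ae ?_, ?_⟩
  · exact (ae_restrict_iff' measurableSet_uIoc).2 hae
  rw [← intervalIntegral.integral_congr_ae hae, intervalIntegral.integral_add i1 i2,
    intervalIntegral.integral_mul_const, RCLike.intervalIntegral_ofReal,
    RCLike.intervalIntegral_ofReal, hre.integral_deriv_eq_sub, him.integral_deriv_eq_sub]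
  conv_rhs => rw [← RCLike.re_add_im (h b), ← RCLike.re_add_im (h a)]
  push_cast
  ring

theorem hasDerivWithinAt_integral_Ici {F : Type*} [NormedAddCommGroup F] [NormedSpace ℝ F]
    [CompleteSpace F] {k : ℝ → F} (hk : ContinuousOn k (Ici 0)) {t : ℝ} (ht : 0 ≤ t) :
    HasDerivWithinAt (fun t => ∫ s in (0 : ℝ)..t, k s) (k t) (Ici 0) t := by
  -- Extending `k` by its value at `0` to negative arguments turns the one-sided statement into the
  -- two-sided one.
  have hc : Continuous fun s => k (max 0 s) :=
    hk.comp_continuous (by fun_prop) fun s => mem_Ici.2 (le_max_left _ _)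
  have h1 := (intervalIntegral.integral_hasDerivAt_right (hc.intervalIntegrable 0 t)
    hc.stronglyMeasurable.stronglyMeasurableAtFilter hc.continuousAt).hasDerivWithinAt (s := Ici 0)
  rw [max_eq_right ht] at h1
  have h2 : ∀ u ∈ Ici (0 : ℝ), ∫ s in (0 : ℝ)..u, k s = ∫ s in (0 : ℝ)..u, k (max 0 s) := by
    intro u hu
    refine intervalIntegral.integral_congr fun s hs => ?_
    rw [uIcc_of_le hu] at hs
    simp only [max_eq_right hs.1]
  exact h1.congr h2 (h2 t ht)

theorem _root_.ContinuousOn.intervalIntegrable_Ici {F : Type*} [NormedAddCommGroup F]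
    {k : ℝ → F} (hk : ContinuousOn k (Ici 0)) {t : ℝ} (ht : 0 ≤ t) :
    IntervalIntegrable k volume 0 t :=
  (hk.mono (by rw [uIcc_of_le ht]; exact Icc_subset_Ici_self)).intervalIntegrable

theorem eq_add_integral_of_hasDerivWithinAt {F : Type*} [NormedAddCommGroup F] [NormedSpace ℝ F]
    [CompleteSpace F] {f k : ℝ → F} (hk : ContinuousOn k (Ici 0))
    (hf : ∀ t, 0 ≤ t → HasDerivWithinAt f (k t) (Ici 0) t) {t : ℝ} (ht : 0 ≤ t) :
    f t = f 0 + ∫ s in (0 : ℝ)..t, k s := by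
  rw [intervalIntegral.integral_eq_sub_of_hasDeriv_right_of_le ht
    (fun s hs => ((hf s hs.1).mono Icc_subset_Ici_self).continuousWithinAt)
    (fun s hs => (hf s hs.1.le).mono (Ioi_subset_Ici hs.1.le)) (hk.intervalIntegrable_Ici ht)]
  abel

/-! ## The Caputo derivative of order between one and two -/

section Caputo

variable {𝕜 : Type*} [RCLike 𝕜] {β : ℝ} {f g h : ℝ → 𝕜} {f₀ f₁ g₀ g₁ : 𝕜}

theorem natFloor_eq_one (hβ₁ : 1 < β) (hβ₂ : β < 2) : ⌊β⌋₊ = 1 :=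
  (Nat.floor_eq_iff (by linarith)).2 ⟨by simpa using hβ₁.le, by norm_num; linarith⟩

theorem hasCaputoDerivAt_iff (hβ₁ : 1 < β) (hβ₂ : β < 2) {c : 𝕜} {t : ℝ} :
    HasCaputoDerivAt β f c t ↔
      IntervalIntegrable
        (fun s => (t - s) ^ (2 - β - 1) • iteratedDerivWithin 2 f (Ici 0) s) volume 0 t ∧
      fracInt (2 - β) (iteratedDerivWithin 2 f (Ici 0)) t = c := by
  simp only [HasCaputoDerivAt, natFloor_eq_one hβ₁ hβ₂, fracInt]
  norm_num

theorem iteratedDerivWithin_two_Ici {t : ℝ} :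
    iteratedDerivWithin 2 f (Ici 0) t = derivWithin (derivWithin f (Ici 0)) (Ici 0) t := by
  rw [iteratedDerivWithin_succ, iteratedDerivWithin_one]

/-- Passing from the Volterra equation to the Caputo derivative. -/
theorem caputo_of_volterra (hβ₁ : 1 < β) (hβ₂ : β < 2)
    (hg : ContinuousOn g (Ici 0)) (hh : ContinuousOn h (Ici 0))
    (hfg : ∀ t, 0 ≤ t → f t = f₀ + t • f₁ - fracInt β g t)
    (hgh : ∀ t, 0 ≤ t → g t = g₀ + t • g₁ - fracInt β h t) :
    IsACn 2 f ∧ derivWithin f (Ici 0) 0 = f₁ ∧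
      ∀ t, 0 < t → HasCaputoDerivAt β f (-g t) t := by
  set a := β - 1 with ha
  have ha0 : 0 < a := by linarith
  have hβa : β = 1 + a := by ring
  -- Since `I^β = I^1 I^a` with `a = β - 1`, one differentiation turns the term `I^β g` into `I^a
  -- g`.
  have deriv1 : ∀ {f g : ℝ → 𝕜} {f₀ f₁ : 𝕜}, ContinuousOn g (Ici 0) →
      (∀ t, 0 ≤ t → f t = f₀ + t • f₁ - fracInt β g t) → ∀ t, 0 ≤ t →
      HasDerivWithinAt f (f₁ - fracInt a g t) (Ici 0) t := by
    intro f g f₀ f₁ hg hfg t ht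
    have h1 := hasDerivWithinAt_integral_Ici (continuousOn_fracInt ha0 hg) ht
    have h2 := (((hasDerivWithinAt_id t (Ici 0)).smul_const f₁).const_add f₀).sub h1
    rw [one_smul] at h2
    have h3 : ∀ u ∈ Ici (0 : ℝ), f u = f₀ + u • f₁ - ∫ s in (0 : ℝ)..u, fracInt a g s := by
      intro u hu
      rw [hfg u hu, hβa, ← fracInt_fracInt one_pos ha0 (by linarith) hu
        (hg.intervalIntegrable_Ici hu), fracInt_one]
    exact h2.congr h3 (h3 t ht)
  have df := deriv1 hg hfg
  have dg := deriv1 hh hgh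
  set k : ℝ → 𝕜 := fun t => g₁ - fracInt a h t with hk
  have hkc : ContinuousOn k (Ici 0) := continuousOn_const.sub (continuousOn_fracInt ha0 hh)
  have hg0 : g 0 = g₀ := by
    have := hgh 0 le_rfl
    simpa [fracInt] using this
  have hgk : ∀ t, 0 ≤ t → g t = g₀ + ∫ s in (0 : ℝ)..t, k s := by
    intro t ht
    rw [← hg0]
    exact eq_add_integral_of_hasDerivWithinAt hkc dg ht
  have hΓ : Real.Gamma (a + 1) = a * Real.Gamma a := Real.Gamma_add_one ha0.ne'
  have hΓa := (Real.Gamma_pos_of_pos ha0).ne'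
  have hIk : ContinuousOn (fracInt a k) (Ici 0) := continuousOn_fracInt ha0 hkc
  -- The second equation is used here: with `g = g₀ + I^1 k` and `I^a I^1 = I^1 I^a`, the function
  -- `I^a g` is an explicit power plus a primitive of a continuous function. It can thus be
  -- differentiated again for `t > 0`, and all singular behaviour sits in `t^a`.
  have hIg : ∀ t, 0 ≤ t → fracInt a g t =
      (t ^ a / Real.Gamma (a + 1)) • g₀ + ∫ s in (0 : ℝ)..t, fracInt a k s := by
    intro t ht
    have e1 : fracInt a g t = fracInt a (fun s => (1 : ℝ) • g₀ + fracInt 1 k s) t :=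
      fracInt_congr ht fun s hs => by rw [hgk s hs.1.le, fracInt_one, one_smul]
    have hkI := hkc.intervalIntegrable_Ici ht
    have e2 : fracInt a (fracInt 1 k) t = ∫ s in (0 : ℝ)..t, fracInt a k s := by
      rw [fracInt_fracInt ha0 one_pos (by linarith) ht hkI, add_comm,
        ← fracInt_fracInt one_pos ha0 (by linarith) ht hkI, fracInt_one]
    have e3 := fracInt_rpow ha0 one_pos ht (Or.inr (by linarith))
    rw [add_sub_cancel_right] at e3
    rw [e1, ← e2, ← e3]
    simp only [fracInt, smul_add, sub_self, Real.rpow_zero, Real.Gamma_one, div_one]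
    rw [intervalIntegral.integral_add, smul_add]
    · congr 1
      simp only [← smul_assoc, intervalIntegral.integral_smul_const]
    · simpa using (intervalIntegrable_rpow_sub ha0 ht).smul_continuousOn
        (g := fun _ => g₀) continuousOn_const
    · refine (intervalIntegrable_rpow_sub ha0 ht).smul_continuousOn ?_
      rw [uIcc_of_le ht]
      have : ContinuousOn (fracInt 1 k) (Ici 0) := continuousOn_fracInt one_pos hkc
      unfold fracInt at this
      simp only [sub_self, Real.rpow_zero, Real.Gamma_one] at this
      exact this.mono Icc_subset_Ici_self
  set f' : ℝ → 𝕜 := fun t =>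
    f₁ - ((t ^ a / Real.Gamma (a + 1)) • g₀ + ∫ s in (0 : ℝ)..t, fracInt a k s) with hf'
  have df' : ∀ t, 0 ≤ t → HasDerivWithinAt f (f' t) (Ici 0) t := fun t ht => by
    have := df t ht
    rwa [hIg t ht] at this
  have hderiv : EqOn (derivWithin f (Ici 0)) f' (Ici 0) := fun t ht =>
    (df' t ht).derivWithin (uniqueDiffOn_Ici 0 t ht)
  have hsec : ∀ t, 0 < t → iteratedDerivWithin 2 f (Ici 0) t =
      -((t ^ (a - 1) / Real.Gamma a) • g₀ + fracInt a k t) := by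
    intro t ht
    rw [iteratedDerivWithin_two_Ici, derivWithin_congr hderiv (hderiv ht.le)]
    have h1 := hasDerivWithinAt_integral_Ici hIk ht.le
    have h2 : HasDerivWithinAt (fun t : ℝ => t ^ a / Real.Gamma (a + 1))
        (t ^ (a - 1) / Real.Gamma a) (Ici 0) t := by
      have := ((Real.hasDerivAt_rpow_const (p := a) (Or.inl ht.ne')).div_const
        (Real.Gamma (a + 1))).hasDerivWithinAt (s := Ici 0)
      convert! this using 1
      rw [hΓ]
      field_simp
    exact (((h2.smul_const g₀).add h1).const_sub f₁).derivWithin (uniqueDiffOn_Ici 0 t ht.le)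
  have hc' : ContinuousOn f' (Ici 0) := by
    refine continuousOn_const.sub (ContinuousOn.add ?_ fun t ht =>
      (hasDerivWithinAt_integral_Ici hIk ht).continuousWithinAt)
    exact (((Real.continuous_rpow_const ha0.le).div_const _).smul continuous_const).continuousOn
  refine ⟨⟨?_, fun T hT => ?_⟩, ?_, fun t ht => ?_⟩
  · have : ContDiffOn ℝ ((1 : ℕ) : WithTop ℕ∞) f (Ici 0) := by
      rw [contDiffOn_nat_iff_continuousOn_differentiableOn_deriv (uniqueDiffOn_Ici 0)]
      refine ⟨fun m hm => ?_, fun m hm => ?_⟩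
      · interval_cases m
        · rw [iteratedDerivWithin_zero]
          exact fun t ht => (df' t ht).continuousWithinAt
        · rw [iteratedDerivWithin_one]
          exact hc'.congr hderiv
      · interval_cases m
        rw [iteratedDerivWithin_zero]
        exact fun t ht => (df' t ht).differentiableWithinAt
    exact this
  · simp only [Nat.add_one_sub_one]
    have hsub : uIcc 0 T ⊆ Ici 0 := by
      rw [uIcc_of_le hT.le]
      exact Icc_subset_Ici_self
    have c1 : ∀ c : 𝕜, AbsolutelyContinuousOnInterval (fun _ => c) 0 T := fun c =>
      ((LipschitzWith.const c).lipschitzOnWith (s := uIcc 0 T)).absolutelyContinuousOnInterval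
    -- As `0 < a < 1`, this power is not Lipschitz at `0`; it is absolutely continuous as the
    -- primitive of the integrable function `s^(a-1) / Γ(a)`.
    have c2 : AbsolutelyContinuousOnInterval (fun t : ℝ => t ^ a / Real.Gamma (a + 1)) 0 T := by
      have i1 : IntervalIntegrable (fun s : ℝ => s ^ (a - 1) / Real.Gamma a) volume 0 T :=
        (intervalIntegral.intervalIntegrable_rpow' (by linarith)).div_const _
      refine AbsolutelyContinuousOnInterval.congr_eqOn
        (i1.absolutelyContinuousOnInterval_intervalIntegral left_mem_uIcc) fun t ht => ?_
      have := fracInt_rpow one_pos ha0 (hsub ht) (Or.inr (by linarith))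
      rw [fracInt_one] at this
      simp only [this]
      rw [add_comm a 1, add_sub_cancel_left]
    have c3 : AbsolutelyContinuousOnInterval (fun t => ∫ s in (0 : ℝ)..t, fracInt a k s) 0 T := by
      obtain ⟨M, hM⟩ := (isCompact_uIcc (a := (0 : ℝ)) (b := T)).exists_bound_of_continuousOn
        (hIk.mono hsub)
      have hM0 : 0 ≤ M := (norm_nonneg _).trans (hM 0 left_mem_uIcc)
      refine LipschitzOnWith.absolutelyContinuousOnInterval (K := ⟨M, hM0⟩) ?_
      exact (convex_uIcc 0 T).lipschitzOnWith_of_nnnorm_hasDerivWithin_le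
        (fun t ht => (hasDerivWithinAt_integral_Ici hIk (hsub ht)).mono hsub)
        (fun t ht => hM t ht)
    have c4 : AbsolutelyContinuousOnInterval f' 0 T :=
      (c1 f₁).sub ((c2.smul (c1 g₀)).add c3)
    refine AbsolutelyContinuousOnInterval.congr_eqOn c4 fun t ht => ?_
    rw [iteratedDerivWithin_one, hderiv (hsub ht)]
  · rw [hderiv self_mem_Ici, hf']
    simp [Real.zero_rpow ha0.ne']
  · rw [hasCaputoDerivAt_iff hβ₁ hβ₂]
    have h2β : 0 < 2 - β := by linarith
    have hsum : 2 - β + a = 1 := by rw [ha]; ring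
    have i1 : IntervalIntegrable
        (fun s => (t - s) ^ (2 - β - 1) • (s ^ (a - 1) / Real.Gamma a) • g₀) volume 0 t := by
      have := intervalIntegrable_beta_kernel h2β ha0 ht.le
      have := IntervalIntegrable.smul_continuousOn this
        (g := fun _ => (Real.Gamma a)⁻¹ • g₀) continuousOn_const
      refine this.congr fun s _ => ?_
      simp only [sub_zero, div_eq_mul_inv, ← mul_smul, mul_assoc]
    have i2 : IntervalIntegrable (fun s => (t - s) ^ (2 - β - 1) • fracInt a k s) volume 0 t := by
      refine (intervalIntegrable_rpow_sub h2β ht.le).smul_continuousOn ?_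
      rw [uIcc_of_le ht.le]
      exact hIk.mono Icc_subset_Ici_self
    have e1 : ∀ s ∈ Ioc 0 t, (t - s) ^ (2 - β - 1) • iteratedDerivWithin 2 f (Ici 0) s =
        -((t - s) ^ (2 - β - 1) • (s ^ (a - 1) / Real.Gamma a) • g₀ +
          (t - s) ^ (2 - β - 1) • fracInt a k s) := by
      intro s hs
      rw [hsec s hs.1, smul_neg, smul_add]
    refine ⟨(i1.add i2).neg.congr fun s hs => ?_, ?_⟩
    · rw [uIoc_of_le ht.le] at hs
      exact (e1 s hs).symm
    · have e2 : fracInt (2 - β) (iteratedDerivWithin 2 f (Ici 0)) t =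
          -(fracInt (2 - β) (fun s => s ^ (a - 1) / Real.Gamma a) t • g₀ +
            fracInt (2 - β) (fracInt a k) t) := by
        rw [fracInt, fracInt, fracInt.eq_1 (2 - β) (fracInt a k)]
        rw [intervalIntegral.integral_congr_ae (g := fun s =>
          -((t - s) ^ (2 - β - 1) • (s ^ (a - 1) / Real.Gamma a) • g₀ +
          (t - s) ^ (2 - β - 1) • fracInt a k s)) (Eventually.of_forall fun s hs =>
            e1 s (by rwa [uIoc_of_le ht.le] at hs)),
          intervalIntegral.integral_neg, intervalIntegral.integral_add i1 i2, smul_neg, smul_add]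
        congr 2
        simp only [← smul_assoc, intervalIntegral.integral_smul_const]
      -- The orders add up to `(2 - β) + a = 1`, so the power becomes the constant `1` and the rest
      -- becomes `∫ k`; together they restore `g = g₀ + ∫ k`.
      rw [e2, fracInt_rpow h2β ha0 ht.le (Or.inl ht), fracInt_fracInt h2β ha0 hsum.ge ht.le
        (hkc.intervalIntegrable_Ici ht.le), hsum, fracInt_one, hgk t ht.le]
      simp

/-- Passing from the Caputo derivative to the Volterra equation. -/
theorem volterra_of_caputo (hβ₁ : 1 < β) (hβ₂ : β < 2) (hf : IsACn 2 f)
    (hg : ContinuousOn g (Ici 0)) (hc : ∀ t, 0 < t → HasCaputoDerivAt β f (-g t) t) {t : ℝ}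
    (ht : 0 ≤ t) :
    f t = f 0 + t • derivWithin f (Ici 0) 0 - fracInt β g t := by
  set a := β - 1 with ha
  have ha0 : 0 < a := by linarith
  have h2β : 0 < 2 - β := by linarith
  have hβa : β = 1 + a := by ring
  obtain ⟨hf1, hf2⟩ := hf
  simp only [Nat.add_one_sub_one, iteratedDerivWithin_one] at hf2
  have hf1' : ContDiffOn ℝ ((1 : ℕ) : WithTop ℕ∞) f (Ici 0) := hf1
  have hcd : ContinuousOn (derivWithin f (Ici 0)) (Ici 0) :=
    hf1'.continuousOn_derivWithin (uniqueDiffOn_Ici 0) (by simp)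
  have hd : ∀ t, 0 ≤ t → HasDerivWithinAt f (derivWithin f (Ici 0) t) (Ici 0) t := fun t ht =>
    (hf1'.differentiableOn (by simp) t ht).hasDerivWithinAt
  have hmain : ∀ t, 0 ≤ t →
      derivWithin f (Ici 0) t = derivWithin f (Ici 0) 0 - fracInt a g t := by
    intro t ht
    rcases ht.eq_or_lt with rfl | h0
    · simp [fracInt]
    obtain ⟨j1, j2⟩ := AbsolutelyContinuousOnInterval.integral_deriv_eq_sub_rclike (hf2 t h0)
    -- Away from the endpoint `0`, which the half-open interval omits, the one-sided derivative is
    -- the ordinary one.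
    have e0 : ∀ s ∈ uIoc 0 t, deriv (derivWithin f (Ici 0)) s =
        iteratedDerivWithin 2 f (Ici 0) s := by
      intro s hs
      rw [uIoc_of_le ht] at hs
      rw [iteratedDerivWithin_two_Ici, derivWithin_of_mem_nhds (Ici_mem_nhds hs.1)]
    have j1' := j1.congr e0
    have e1 : fracInt 1 (iteratedDerivWithin 2 f (Ici 0)) t =
        derivWithin f (Ici 0) t - derivWithin f (Ici 0) 0 := by
      rw [fracInt_one, ← j2]
      exact intervalIntegral.integral_congr_ae (Eventually.of_forall fun s hs => (e0 s hs).symm)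
    have hs1 : a + (2 - β) = 1 := by rw [ha]; ring
    -- Applying `I^a` to `I^(2-β) f'' = -g` and using `I^a I^(2-β) = I^1` gives `f' - f'(0) = -I^a
    -- g`. Absolute continuity of `f'` supplies the integrability of `f''`.
    rw [← hs1, ← fracInt_fracInt ha0 h2β hs1.ge ht j1', fracInt_congr (l := fun s => -g s) ht
      fun s hs => ((hasCaputoDerivAt_iff hβ₁ hβ₂).1 (hc s hs.1)).2] at e1
    have e2 : fracInt a (fun s => -g s) t = -fracInt a g t := by
      simp [fracInt]
    rw [e2] at e1
    rw [sub_eq_add_neg, e1]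
    ring
  have h1 := eq_add_integral_of_hasDerivWithinAt hcd hd ht
  rw [h1, hβa, ← fracInt_fracInt one_pos ha0 (by linarith) ht (hg.intervalIntegrable_Ici ht),
    fracInt_one]
  have h2 : ∫ s in (0 : ℝ)..t, derivWithin f (Ici 0) s =
      ∫ s in (0 : ℝ)..t, (derivWithin f (Ici 0) 0 - fracInt a g s) := by
    refine intervalIntegral.integral_congr fun s hs => ?_
    rw [uIcc_of_le ht] at hs
    exact hmain s hs.1
  rw [h2, intervalIntegral.integral_sub (by simp)
    ((continuousOn_fracInt ha0 hg).intervalIntegrable_Ici ht)]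
  simp [add_sub_assoc]

/-- Uniqueness for the linear Volterra equation. -/
theorem volterra_unique (hβ₁ : 1 < β) {γ : 𝕜} (hf : ContinuousOn f (Ici 0))
    (hg : ContinuousOn g (Ici 0))
    (hf' : ∀ t, 0 ≤ t → f t = f₀ + t • f₁ - fracInt β (fun s => γ * f s) t)
    (hg' : ∀ t, 0 ≤ t → g t = f₀ + t • f₁ - fracInt β (fun s => γ * g s) t) {t : ℝ}
    (ht : 0 ≤ t) : f t = g t := by
  set u : ℝ → 𝕜 := fun s => f s - g s with hu
  have huc : ContinuousOn u (Ici 0) := hf.sub hg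
  have hΓ := Real.Gamma_pos_of_pos (show 0 < β by linarith)
  -- For `β > 1` the kernel is bounded on `[0, t]` by `t^(β-1)`, so the difference `u` satisfies
  -- `‖u(s)‖ ≤ K ∫₀ˢ ‖u‖`.
  set K : ℝ := (Real.Gamma β)⁻¹ * (t ^ (β - 1) * ‖γ‖) with hK
  have hK0 : 0 ≤ K := by positivity
  have hker : ∀ s, 0 ≤ s → ContinuousOn (fun r : ℝ => (s - r) ^ (β - 1)) (uIcc 0 s) := fun s _ =>
    ((continuous_const.sub continuous_id).rpow_const fun _ => Or.inr (by linarith)).continuousOn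
  have hbd : ∀ s ∈ Icc 0 t, ‖u s‖ ≤ K * ∫ r in (0 : ℝ)..s, ‖u r‖ := by
    intro s hs
    have hsub : uIcc 0 s ⊆ Ici 0 := by
      rw [uIcc_of_le hs.1]
      exact Icc_subset_Ici_self
    have e1 : u s = -((Real.Gamma β)⁻¹ • ∫ r in (0 : ℝ)..s, (s - r) ^ (β - 1) • (γ * u r)) := by
      simp only [hu]
      rw [hf' s hs.1, hg' s hs.1]
      simp only [fracInt, mul_sub, smul_sub]
      rw [intervalIntegral.integral_sub, smul_sub]
      · ring
      · exact ((hker s hs.1).smul (continuousOn_const.mul (hf.mono hsub))).intervalIntegrable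
      · exact ((hker s hs.1).smul (continuousOn_const.mul (hg.mono hsub))).intervalIntegrable
    rw [e1, norm_neg, norm_smul, Real.norm_of_nonneg (inv_nonneg.2 hΓ.le), hK, mul_assoc]
    refine mul_le_mul_of_nonneg_left ?_ (inv_nonneg.2 hΓ.le)
    rw [← intervalIntegral.integral_const_mul]
    refine intervalIntegral.norm_integral_le_of_norm_le hs.1 (ae_of_all _ fun r hr => ?_)
      ((huc.norm.intervalIntegrable_Ici hs.1).const_mul _)
    rw [norm_smul, norm_mul, ← mul_assoc]
    refine mul_le_mul_of_nonneg_right (mul_le_mul_of_nonneg_right ?_ (norm_nonneg _))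
      (norm_nonneg _)
    rw [Real.norm_of_nonneg (Real.rpow_nonneg (by linarith [hr.2]) _)]
    exact Real.rpow_le_rpow (by linarith [hr.2]) (by linarith [hr.1, hs.2]) (by linarith)
  have hd : ∀ s, 0 ≤ s → HasDerivWithinAt (fun s => ∫ r in (0 : ℝ)..s, ‖u r‖) ‖u s‖ (Ici 0) s :=
    fun s hs => hasDerivWithinAt_integral_Ici huc.norm hs
  have hint : ∀ s, 0 ≤ s → 0 ≤ ∫ r in (0 : ℝ)..s, ‖u r‖ := fun s hs =>
    intervalIntegral.integral_nonneg hs fun r _ => norm_nonneg _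
  -- Gronwall is applied to the primitive of `‖u‖`, which is differentiable and vanishes at `0`.
  have hG := norm_le_gronwallBound_of_norm_deriv_right_le (K := K) (δ := 0) (ε := 0)
    (a := 0) (b := t) (f := fun s => ∫ r in (0 : ℝ)..s, ‖u r‖) (f' := fun s => ‖u s‖)
    (fun s hs => ((hd s hs.1).mono Icc_subset_Ici_self).continuousWithinAt)
    (fun s hs => (hd s hs.1).mono (Ici_subset_Ici.2 hs.1)) (by simp) (fun s hs => by
      rw [norm_norm, Real.norm_of_nonneg (hint s hs.1), add_zero]
      exact hbd s ⟨hs.1, hs.2.le⟩) t ⟨ht, le_rfl⟩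
  rw [gronwallBound_ε0_δ0, Real.norm_of_nonneg (hint t ht)] at hG
  have := hbd t ⟨ht, le_rfl⟩
  have h0 : ‖u t‖ ≤ 0 := this.trans (by nlinarith [hint t ht])
  exact sub_eq_zero.1 (norm_le_zero_iff.1 h0)

end Caputo

end SpectralWave

namespace SpectralWave

/-- For `β ≥ 1` the kernel is continuous up to `s = t`, so a summable family of uniform bounds
justifies termwise integration. -/
theorem hasSum_fracInt {F ι : Type*} [NormedAddCommGroup F] [NormedSpace ℝ F] [Countable ι]
    {β t : ℝ} (hβ : 1 ≤ β) (ht : 0 ≤ t) {G : ι → ℝ → F} {f : ℝ → F} {b : ι → ℝ}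
    (hG : ∀ i, ContinuousOn (G i) (Ici 0)) (hb : Summable b)
    (hGb : ∀ i, ∀ s ∈ Icc 0 t, ‖G i s‖ ≤ b i)
    (hf : ∀ s ∈ Icc 0 t, HasSum (fun i => G i s) (f s)) :
    HasSum (fun i => fracInt β (G i) t) (fracInt β f t) := by
  have hker : Continuous fun s : ℝ => (t - s) ^ (β - 1) :=
    (continuous_const.sub continuous_id).rpow_const fun _ => Or.inr (by linarith)
  refine HasSum.const_smul _ (intervalIntegral.hasSum_integral_of_dominated_convergence
    (fun i s => (t - s) ^ (β - 1) * b i) (fun i => ?_) (fun i => ae_of_all _ fun s hs => ?_)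
    (ae_of_all _ fun s _ => hb.mul_left _) ?_ (ae_of_all _ fun s hs => ?_))
  · rw [uIoc_of_le ht]
    refine ContinuousOn.aestronglyMeasurable ?_ measurableSet_Ioc
    exact hker.continuousOn.smul ((hG i).mono fun s hs => hs.1.le)
  · rw [uIoc_of_le ht] at hs
    rw [norm_smul, Real.norm_of_nonneg (Real.rpow_nonneg (by linarith [hs.2]) _)]
    exact mul_le_mul_of_nonneg_left (hGb i s ⟨hs.1.le, hs.2⟩)
      (Real.rpow_nonneg (by linarith [hs.2]) _)
  · simp only [tsum_mul_left]
    exact (hker.mul continuous_const).intervalIntegrable _ _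
  · rw [uIoc_of_le ht] at hs
    exact (hf s ⟨hs.1.le, hs.2⟩).const_smul _

/-! ## Mittag-Leffler functions -/

section MittagLeffler

variable {β ρ : ℝ}

/-- `Γ` is monotone on `[2, ∞)`, which is why `k ≥ 1` is required. The exponential series then
majorises the Mittag-Leffler series. -/
theorem factorial_le_Gamma (hβ : 1 ≤ β) (hρ : 1 ≤ ρ) {k : ℕ} (hk : 1 ≤ k) :
    (k.factorial : ℝ) ≤ Real.Gamma (β * k + ρ) := by
  have hk' : (1 : ℝ) ≤ k := by exact_mod_cast hk
  rw [← Real.Gamma_nat_eq_factorial]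
  refine Real.Gamma_strictMonoOn_Ici.monotoneOn ?_ ?_ ?_
  · rw [mem_Ici]; linarith
  · rw [mem_Ici]; nlinarith
  · nlinarith

theorem mittagLeffler_Gamma_pos (hβ : 1 ≤ β) (hρ : 1 ≤ ρ) (k : ℕ) :
    0 < Real.Gamma (β * k + ρ) :=
  Real.Gamma_pos_of_pos (by positivity)

theorem summable_mittagLeffler_abs (hβ : 1 ≤ β) (hρ : 1 ≤ ρ) (x : ℝ) :
    Summable fun k : ℕ => |x| ^ k / Real.Gamma (β * k + ρ) := by
  refine Summable.of_norm_bounded_eventually_nat (Real.summable_pow_div_factorial |x|) ?_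
  filter_upwards [eventually_ge_atTop 1] with k hk
  rw [Real.norm_of_nonneg (div_nonneg (by positivity) (mittagLeffler_Gamma_pos hβ hρ k).le)]
  exact div_le_div_of_nonneg_left (by positivity) (by positivity) (factorial_le_Gamma hβ hρ hk)

theorem norm_mittagLeffler_term (hβ : 1 ≤ β) (hρ : 1 ≤ ρ) (x : ℝ) (k : ℕ) :
    ‖x ^ k / Real.Gamma (β * k + ρ)‖ = |x| ^ k / Real.Gamma (β * k + ρ) := by
  rw [norm_div, norm_pow, Real.norm_eq_abs,
    Real.norm_of_nonneg (mittagLeffler_Gamma_pos hβ hρ k).le]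

theorem hasSum_mittagLeffler (hβ : 1 ≤ β) (hρ : 1 ≤ ρ) (x : ℝ) :
    HasSum (fun k : ℕ => x ^ k / Real.Gamma (β * k + ρ)) (mittagLeffler β ρ x) := by
  refine (Summable.of_norm ?_).hasSum
  simp_rw [norm_mittagLeffler_term hβ hρ]
  exact summable_mittagLeffler_abs hβ hρ x

theorem continuous_mittagLeffler (hβ : 1 ≤ β) (hρ : 1 ≤ ρ) :
    Continuous (mittagLeffler β ρ) := by
  rw [continuous_iff_continuousAt]
  intro x
  have hc : ContinuousOn (mittagLeffler β ρ) (Ioo (-(|x| + 1)) (|x| + 1)) := by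
    refine continuousOn_tsum (fun k => by fun_prop)
      (summable_mittagLeffler_abs hβ hρ (|x| + 1)) fun k y hy => ?_
    rw [norm_mittagLeffler_term hβ hρ, abs_of_nonneg (by positivity : 0 ≤ |x| + 1)]
    have := mittagLeffler_Gamma_pos hβ hρ k
    have := (abs_lt.2 hy).le
    gcongr
  refine hc.continuousAt (Ioo_mem_nhds ?_ ?_)
  · linarith [neg_abs_le x]
  · linarith [le_abs_self x]

theorem mittagLeffler_zero (hρ : ρ = 1 ∨ ρ = 2) : mittagLeffler β ρ 0 = 1 := by
  unfold mittagLeffler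
  rw [tsum_eq_single 0 fun k hk => by simp [hk]]
  rcases hρ with rfl | rfl <;> simp

/-- `t ^ (ρ - 1) E_{β,ρ}(-γ t ^ β)`. -/
noncomputable def mlWave (β ρ γ t : ℝ) : ℝ := t ^ (ρ - 1) * mittagLeffler β ρ (-γ * t ^ β)

theorem mlWave_one (β γ t : ℝ) : mlWave β 1 γ t = mittagLeffler β 1 (-γ * t ^ β) := by
  simp [mlWave]

theorem mlWave_two (β γ t : ℝ) : mlWave β 2 γ t = t * mittagLeffler β 2 (-γ * t ^ β) := by
  norm_num [mlWave]

theorem continuous_mlWave (hβ : 1 ≤ β) (hρ : 1 ≤ ρ) (γ : ℝ) : Continuous (mlWave β ρ γ) :=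
  (Real.continuous_rpow_const (by linarith)).mul ((continuous_mittagLeffler hβ hρ).comp
    (continuous_const.mul (Real.continuous_rpow_const (by linarith))))

/-- In this normalisation each power `t^(q-1) / Γ(q)` is mapped by `I^β` to the same expression with
`q + β`. -/
theorem hasSum_mlWave (hβ : 1 ≤ β) (hρ : 1 ≤ ρ) (γ : ℝ) {t : ℝ} (ht : 0 ≤ t) :
    HasSum (fun k : ℕ => (-γ) ^ k * (t ^ (β * k + ρ - 1) / Real.Gamma (β * k + ρ)))
      (mlWave β ρ γ t) := by
  have h := (hasSum_mittagLeffler hβ hρ (-γ * t ^ β)).mul_left (t ^ (ρ - 1))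
  refine (funext fun k => ?_ : _ = fun k : ℕ => _) ▸ h
  have hk : 0 ≤ β * (k : ℝ) := by positivity
  rw [mul_pow, ← Real.rpow_mul_natCast ht, add_sub_assoc,
    Real.rpow_add_of_nonneg ht hk (by linarith)]
  ring

/-- `γ I^β` sends the term of index `k` to minus the term of index `k + 1`, so subtracting it from
the leading term rebuilds the whole series. -/
theorem mlWave_volterra (hβ : 1 ≤ β) (hρ : 1 ≤ ρ) (γ : ℝ) {t : ℝ} (ht : 0 ≤ t) :
    mlWave β ρ γ t =
      t ^ (ρ - 1) / Real.Gamma ρ - fracInt β (fun s => γ * mlWave β ρ γ s) t := by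
  set A : ℕ → ℝ → ℝ := fun k s =>
    (-γ) ^ k * (s ^ (β * k + ρ - 1) / Real.Gamma (β * k + ρ)) with hA
  have hexp : ∀ k : ℕ, 0 ≤ β * k + ρ - 1 := fun k => by
    have : 0 ≤ β * (k : ℝ) := by positivity
    linarith
  -- All exponents are nonnegative, so the terms at the endpoint `t` dominate those on `[0, t]`.
  have hsum : Summable fun k : ℕ => |γ| * ‖A k t‖ := by
    have := (hasSum_mlWave hβ hρ γ ht).summable.norm
    exact this.mul_left |γ|
  have h1 : HasSum (fun k => fracInt β (fun s => γ * A k s) t)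
      (fracInt β (fun s => γ * mlWave β ρ γ s) t) := by
    refine hasSum_fracInt hβ ht (fun k => ?_) hsum (fun k s hs => ?_) fun s hs =>
      (hasSum_mlWave hβ hρ γ hs.1).mul_left γ
    · exact (continuous_const.mul (continuous_const.mul
        ((Real.continuous_rpow_const (hexp k)).div_const _))).continuousOn
    · have hG := mittagLeffler_Gamma_pos hβ hρ k
      rw [norm_mul, Real.norm_eq_abs]
      simp only [hA, norm_mul, norm_div]
      have h2 : ‖s ^ (β * k + ρ - 1)‖ ≤ ‖t ^ (β * k + ρ - 1)‖ := by
        rw [Real.norm_of_nonneg (Real.rpow_nonneg hs.1 _),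
          Real.norm_of_nonneg (Real.rpow_nonneg ht _)]
        exact Real.rpow_le_rpow hs.1 hs.2 (hexp k)
      gcongr
  have h2 : ∀ k, fracInt β (fun s => γ * A k s) t = -A (k + 1) t := by
    intro k
    have h3 := fracInt_rpow (p := β) (q := β * k + ρ) (by linarith)
      (by linarith [hexp k]) ht (Or.inr (by linarith [hexp k]))
    have h4 : fracInt β (fun s => γ * A k s) t = (γ * (-γ) ^ k) *
        fracInt β (fun s => s ^ (β * k + ρ - 1) / Real.Gamma (β * k + ρ)) t := by
      have e : (fun s => γ * A k s) = fun s =>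
          (γ * (-γ) ^ k) * (s ^ (β * k + ρ - 1) / Real.Gamma (β * k + ρ)) := by
        funext s
        simp only [hA]
        ring
      rw [e]
      simp only [fracInt, smul_eq_mul, mul_left_comm _ (γ * (-γ) ^ k),
        intervalIntegral.integral_const_mul]
    rw [h4, h3, hA]
    push_cast
    rw [show β + (β * k + ρ) = β * (k + 1) + ρ by ring]
    ring
  simp only [h2] at h1
  have h5 := (hasSum_nat_add_iff' 1).2 (hasSum_mlWave hβ hρ γ ht)
  have h6 := h1.neg.unique (by simpa [hA] using h5)
  rw [neg_eq_iff_eq_neg] at h6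
  rw [h6]
  ring

end MittagLeffler

end SpectralWave

namespace SpectralWave

/-! ## Hankel integrals in logarithmic coordinates -/

section Hankel

open Complex (I)

/-- The integral over the contour that runs along `ℝ + iθ` and `ℝ - iθ` to the right of `R`, joined
by a vertical segment. -/
noncomputable def hankelInt (θ R : ℝ) (f : ℂ → ℂ) : ℂ :=
  (∫ u in Ioi R, f (u + (θ : ℝ) * I)) - (∫ u in Ioi R, f (u + (-θ : ℝ) * I)) +
    I * ∫ v in (-θ)..θ, f (R + v * I)

variable {θ R : ℝ} {f : ℂ → ℂ}

/-- Cauchy's theorem on the rectangle between the two vertical segments. -/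
theorem hankelInt_eq_of_le {R' : ℝ} (hθ : 0 ≤ θ) (hR : R' ≤ R)
    (hf : ∀ ζ : ℂ, |ζ.im| ≤ θ → DifferentiableAt ℂ f ζ)
    (h1 : IntegrableOn (fun u : ℝ => f (u + (θ : ℝ) * I)) (Ioi R'))
    (h2 : IntegrableOn (fun u : ℝ => f (u + (-θ : ℝ) * I)) (Ioi R')) :
    hankelInt θ R f = hankelInt θ R' f := by
  have h := Complex.integral_boundary_rect_eq_zero_of_differentiableOn f
    ⟨R', -θ⟩ ⟨R, θ⟩ fun ζ hζ => by
      refine (hf ζ ?_).differentiableWithinAt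
      have := hζ.2
      simp only [mem_preimage] at this
      rw [uIcc_of_le (by linarith)] at this
      exact abs_le.2 this
  simp only [smul_eq_mul] at h
  have e1 := intervalIntegral.integral_Ioi_sub_Ioi h1 hR
  have e2 := intervalIntegral.integral_Ioi_sub_Ioi h2 hR
  rw [← e1, ← e2] at h
  unfold hankelInt
  linear_combination h

/-- The vertical segment moves to `-∞`, where the exponential bound with `m > 0` makes its
contribution vanish. In the variable `s = e^ζ` this shrinks the arc around the origin to a point. -/
theorem hankelInt_eq_integral {C m u₀ : ℝ} (hθ : 0 ≤ θ) (hm : 0 < m)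
    (hf : ∀ ζ : ℂ, |ζ.im| ≤ θ → DifferentiableAt ℂ f ζ)
    (h1 : Integrable (fun u : ℝ => f (u + (θ : ℝ) * I)))
    (h2 : Integrable (fun u : ℝ => f (u + (-θ : ℝ) * I)))
    (hb : ∀ u v : ℝ, u ≤ u₀ → |v| ≤ θ → ‖f (u + v * I)‖ ≤ C * Real.exp (m * u)) :
    hankelInt θ R f = (∫ u : ℝ, f (u + (θ : ℝ) * I)) - ∫ u : ℝ, f (u + (-θ : ℝ) * I) := by
  have hid : Tendsto (fun a : ℝ => a) atBot atBot := tendsto_id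
  have t1 := (aecover_Ioi (μ := (volume : Measure ℝ)) hid).integral_tendsto_of_countably_generated h1
  have t2 := (aecover_Ioi (μ := (volume : Measure ℝ)) hid).integral_tendsto_of_countably_generated h2
  have t3 : Tendsto (fun a : ℝ => ∫ v in (-θ)..θ, f (a + v * I)) atBot (𝓝 0) := by
    have hlim : Tendsto (fun a : ℝ => C * Real.exp (m * a) * |θ - -θ|) atBot (𝓝 0) := by
      have : Tendsto (fun a : ℝ => Real.exp (m * a)) atBot (𝓝 0) :=
        Real.tendsto_exp_atBot.comp (tendsto_id.const_mul_atBot hm)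
      simpa using (this.const_mul C).mul_const |θ - -θ|
    refine squeeze_zero_norm' ?_ hlim
    filter_upwards [eventually_le_atBot u₀] with a ha
    refine intervalIntegral.norm_integral_le_of_norm_le_const fun v hv => hb a v ha ?_
    rw [uIoc_of_le (by linarith)] at hv
    exact abs_le.2 ⟨hv.1.le, hv.2⟩
  have t4 : Tendsto (fun a => hankelInt θ a f) atBot
      (𝓝 ((∫ u : ℝ, f (u + (θ : ℝ) * I)) - (∫ u : ℝ, f (u + (-θ : ℝ) * I)) + I * 0)) :=
    (t1.sub t2).add (t3.const_mul I)
  rw [mul_zero, add_zero] at t4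
  refine tendsto_nhds_unique (tendsto_const_nhds.congr' ?_) t4
  filter_upwards [eventually_le_atBot R] with a ha
  exact hankelInt_eq_of_le hθ ha hf h1.integrableOn h2.integrableOn

theorem hasSum_hankelInt {F : ℕ → ℂ → ℂ} {b : ℂ → ℝ} (hF : ∀ k, Continuous (F k))
    (hb : ∀ k, ∀ ζ : ℂ, R ≤ ζ.re → ‖F k ζ‖ ≤ b ζ * (1 / 2) ^ k)
    (hf : ∀ ζ : ℂ, R ≤ ζ.re → HasSum (fun k => F k ζ) (f ζ))
    (hbc : Continuous b)
    (hb1 : IntegrableOn (fun u : ℝ => b (u + (θ : ℝ) * I)) (Ioi R))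
    (hb2 : IntegrableOn (fun u : ℝ => b (u + (-θ : ℝ) * I)) (Ioi R)) :
    HasSum (fun k => hankelInt θ R (F k)) (hankelInt θ R f) := by
  have hline : ∀ v : ℝ, IntegrableOn (fun u : ℝ => b (u + v * I)) (Ioi R) →
      HasSum (fun k => ∫ u in Ioi R, F k (u + v * I)) (∫ u in Ioi R, f (u + v * I)) := by
    intro v hv
    refine hasSum_integral_of_dominated_convergence
      (fun k u => b (u + v * I) * (1 / 2) ^ k) (fun k => ?_) (fun k => ?_)
      (ae_of_all _ fun u => summable_geometric_two.mul_left _) ?_ ?_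
    · exact ((hF k).comp (by fun_prop)).aestronglyMeasurable
    · filter_upwards [ae_restrict_mem measurableSet_Ioi] with u hu
      exact hb k _ (by simpa using (mem_Ioi.1 hu).le)
    · simp only [tsum_mul_left]
      exact hv.mul_const _
    · filter_upwards [ae_restrict_mem measurableSet_Ioi] with u hu
      exact hf _ (by simpa using (mem_Ioi.1 hu).le)
  have harc : HasSum (fun k => ∫ v in (-θ)..θ, F k (R + v * I))
      (∫ v in (-θ)..θ, f (R + v * I)) := by
    refine intervalIntegral.hasSum_integral_of_dominated_convergence
      (fun k v => b (R + v * I) * (1 / 2) ^ k) (fun k => ?_) (fun k => ?_)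
      (ae_of_all _ fun v _ => summable_geometric_two.mul_left _) ?_ ?_
    · exact ((hF k).comp (by fun_prop)).aestronglyMeasurable
    · exact ae_of_all _ fun v _ => hb k _ (by simp)
    · simp only [tsum_mul_left]
      exact ((hbc.comp (by fun_prop)).mul continuous_const).intervalIntegrable _ _
    · exact ae_of_all _ fun v _ => hf _ (by simp)
  exact ((hline _ hb1).sub (hline _ hb2)).add (harc.mul_left I)

theorem integral_comp_exp {F : Type*} [NormedAddCommGroup F] [NormedSpace ℝ F] (φ : ℝ → F) :
    ∫ t in Ioi (0 : ℝ), φ t = ∫ u : ℝ, Real.exp u • φ (Real.exp u) := by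
  have := integral_image_eq_integral_abs_deriv_smul (s := univ) MeasurableSet.univ
    (fun x _ => (Real.hasDerivAt_exp x).hasDerivWithinAt) Real.exp_injective.injOn φ
  rw [image_univ, Real.range_exp] at this
  simpa [abs_of_pos (Real.exp_pos _)] using this

theorem integrable_comp_exp {F : Type*} [NormedAddCommGroup F] [NormedSpace ℝ F] (φ : ℝ → F) :
    IntegrableOn φ (Ioi 0) ↔ Integrable fun u : ℝ => Real.exp u • φ (Real.exp u) := by
  have := integrableOn_image_iff_integrableOn_abs_deriv_smul (s := univ) MeasurableSet.univ
    (fun x _ => (Real.hasDerivAt_exp x).hasDerivWithinAt) Real.exp_injective.injOn φ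
  rw [image_univ, Real.range_exp] at this
  simpa [abs_of_pos (Real.exp_pos _)] using this

theorem integrable_exp_neg_exp {c m : ℝ} (hc : 0 < c) (hm : 0 < m) :
    Integrable fun u : ℝ => Real.exp (-c * Real.exp u + m * u) := by
  have h := integrableOn_rpow_mul_exp_neg_mul_rpow (p := 1) (s := m - 1) (by linarith) one_pos hc
  rw [integrable_comp_exp] at h
  refine h.congr (ae_of_all _ fun u => ?_)
  simp only [smul_eq_mul, Real.rpow_one, ← Real.exp_mul, ← Real.exp_add]
  ring_nf

theorem integrableOn_exp_neg_exp {c : ℝ} (hc : 0 < c) (m : ℝ) (hR : 0 ≤ R) :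
    IntegrableOn (fun u : ℝ => Real.exp (-c * Real.exp u + m * u)) (Ioi R) := by
  -- Integrability on the whole line needs a positive exponent; replacing `m` by `|m| + 1` only
  -- enlarges the integrand on `u ≥ 0`.
  have h := (integrable_exp_neg_exp hc (m := |m| + 1) (by positivity)).integrableOn (s := Ioi R)
  refine h.mono' (by fun_prop) ?_
  filter_upwards [ae_restrict_mem measurableSet_Ioi] with u hu
  rw [Real.norm_of_nonneg (Real.exp_pos _).le]
  have hu' : 0 ≤ u := hR.trans (mem_Ioi.1 hu).le
  refine Real.exp_le_exp.2 ?_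
  nlinarith [le_abs_self m]

/-- The integrand `e^s s^{-z} ds` of the Hankel integral at `s = e^ζ`. -/
noncomputable def hankelKernel (z : ℝ) (ζ : ℂ) : ℂ := Complex.exp (Complex.exp ζ + (1 - z) * ζ)

theorem norm_hankelKernel (z u v : ℝ) :
    ‖hankelKernel z (u + v * I)‖ = Real.exp (Real.cos v * Real.exp u + (1 - z) * u) := by
  rw [hankelKernel, Complex.norm_exp]
  congr 1
  have h1 : (Complex.exp (u + v * I)).re = Real.cos v * Real.exp u := by
    rw [Complex.exp_re]
    simp [mul_comm]
  rw [Complex.add_re, h1]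
  simp

theorem differentiable_hankelKernel (z : ℝ) : Differentiable ℂ (hankelKernel z) := by
  unfold hankelKernel
  fun_prop

theorem integrableOn_hankelKernel (z : ℝ) {v : ℝ} (hv : Real.cos v < 0) (hR : 0 ≤ R) :
    IntegrableOn (fun u : ℝ => hankelKernel z (u + v * I)) (Ioi R) := by
  have h := integrableOn_exp_neg_exp (neg_pos.2 hv) (1 - z) hR
  refine Integrable.mono' h ?_ (ae_of_all _ fun u => ?_)
  · exact ((differentiable_hankelKernel z).continuous.comp (by fun_prop)).aestronglyMeasurable
  · rw [norm_hankelKernel, neg_neg]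

theorem integrable_hankelKernel {z v : ℝ} (hz : z < 1) (hv : Real.cos v < 0) :
    Integrable (fun u : ℝ => hankelKernel z (u + v * I)) := by
  have h := integrable_exp_neg_exp (neg_pos.2 hv) (m := 1 - z) (by linarith)
  refine Integrable.mono' h ?_ (ae_of_all _ fun u => ?_)
  · exact ((differentiable_hankelKernel z).continuous.comp (by fun_prop)).aestronglyMeasurable
  · rw [norm_hankelKernel, neg_neg]

/-- Once integrated along the contour, this identity becomes the functional equation of `1/Γ`. -/
theorem hasDerivAt_hankelKernel (z : ℝ) (ζ : ℂ) :
    HasDerivAt (hankelKernel (z + 1)) (hankelKernel z ζ - z * hankelKernel (z + 1) ζ) ζ := by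
  have h : HasDerivAt (hankelKernel (z + 1))
      (Complex.exp (Complex.exp ζ + (1 - (z + 1 : ℝ)) * ζ) *
        (Complex.exp ζ + (1 - (z + 1 : ℝ)) * 1)) ζ :=
    ((Complex.hasDerivAt_exp ζ).add ((hasDerivAt_id ζ).const_mul _)).cexp
  convert! h using 1
  have : hankelKernel z ζ = hankelKernel (z + 1) ζ * Complex.exp ζ := by
    rw [hankelKernel, hankelKernel, ← Complex.exp_add]
    congr 1
    push_cast
    ring
  rw [this, hankelKernel]
  push_cast
  ring

theorem cos_neg_of_mem (h1 : Real.pi / 2 < θ) (h2 : θ < Real.pi) : Real.cos θ < 0 :=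
  Real.cos_neg_of_pi_div_two_lt_of_lt h1 (by linarith [Real.pi_pos])

/-- The difference of the two sides is the integral of a derivative over the contour: the values at
the corners `R ± iθ` cancel, and those at infinity vanish because `cos θ < 0`. -/
theorem hankelInt_recurrence (h1 : Real.pi / 2 < θ) (h2 : θ < Real.pi) (hR : 0 ≤ R) (z : ℝ) :
    hankelInt θ R (hankelKernel z) = z * hankelInt θ R (hankelKernel (z + 1)) := by
  have hc := cos_neg_of_mem h1 h2
  have hc' : Real.cos (-θ) < 0 := by rwa [Real.cos_neg]
  have hline : ∀ v : ℝ, Real.cos v < 0 →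
      (∫ u in Ioi R, hankelKernel z (u + v * I)) -
        z * ∫ u in Ioi R, hankelKernel (z + 1) (u + v * I) = -hankelKernel (z + 1) (R + v * I) := by
    intro v hv
    have d : ∀ u : ℝ, HasDerivAt (fun u : ℝ => hankelKernel (z + 1) (u + v * I))
        (hankelKernel z (u + v * I) - z * hankelKernel (z + 1) (u + v * I)) u := by
      intro u
      have h3 : HasDerivAt (fun u : ℂ => u + v * I) 1 (u : ℂ) :=
        (hasDerivAt_id (u : ℂ)).add_const (v * I)
      simpa using ((hasDerivAt_hankelKernel z (u + v * I)).comp (u : ℂ) h3).comp_ofReal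
    have i1 := integrableOn_hankelKernel z hv hR
    have i2 := integrableOn_hankelKernel (z + 1) hv hR
    have i3 := i1.sub (i2.const_mul (z : ℂ))
    have lim := tendsto_zero_of_hasDerivAt_of_integrableOn_Ioi (fun u _ => d u) i3 i2
    have := integral_Ioi_of_hasDerivAt_of_tendsto (d R).continuousAt.continuousWithinAt
      (fun u _ => d u) i3 lim
    rw [integral_sub i1 (i2.const_mul (z : ℂ)), integral_const_mul] at this
    rw [this, zero_sub]
  have harc : I * (∫ v in (-θ)..θ, hankelKernel z (R + v * I)) -
      z * (I * ∫ v in (-θ)..θ, hankelKernel (z + 1) (R + v * I)) =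
      hankelKernel (z + 1) (R + (θ : ℝ) * I) - hankelKernel (z + 1) (R + (-θ : ℝ) * I) := by
    have d : ∀ v : ℝ, HasDerivAt (fun v : ℝ => hankelKernel (z + 1) (R + v * I))
        ((hankelKernel z (R + v * I) - z * hankelKernel (z + 1) (R + v * I)) * I) v := by
      intro v
      have h3 : HasDerivAt (fun v : ℂ => (R : ℂ) + v * I) I v := by
        simpa using ((hasDerivAt_id (v : ℂ)).mul_const I).const_add (R : ℂ)
      exact ((hasDerivAt_hankelKernel z (R + v * I)).comp (v : ℂ) h3).comp_ofReal
    have c : ∀ z : ℝ, Continuous fun v : ℝ => hankelKernel z (R + v * I) := fun z =>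
      (differentiable_hankelKernel z).continuous.comp (by fun_prop)
    have := intervalIntegral.integral_eq_sub_of_hasDerivAt (a := -θ) (b := θ) (fun v _ => d v)
      ((((c z).sub (continuous_const.mul (c (z + 1)))).mul continuous_const).intervalIntegrable _ _)
    have i1 := (c z).intervalIntegrable (μ := volume) (-θ) θ
    have i2 := ((c (z + 1)).intervalIntegrable (μ := volume) (-θ) θ).const_mul (z : ℂ)
    rw [← this, intervalIntegral.integral_mul_const, intervalIntegral.integral_sub i1 i2,
      intervalIntegral.integral_const_mul]
    ring
  have e1 := hline θ hc
  have e2 := hline (-θ) hc'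
  unfold hankelInt
  linear_combination e1 - e2 + harc

theorem integral_line_eq {a b : ℝ} (hf : Differentiable ℂ f)
    (h1 : Integrable (fun u : ℝ => f (u + a * I))) (h2 : Integrable (fun u : ℝ => f (u + b * I)))
    (ht : Tendsto (fun u : ℝ => ∫ v in a..b, f (u + v * I)) atTop (𝓝 0))
    (hb : Tendsto (fun u : ℝ => ∫ v in a..b, f (u + v * I)) atBot (𝓝 0)) :
    ∫ u : ℝ, f (u + a * I) = ∫ u : ℝ, f (u + b * I) := by
  have t1 := intervalIntegral_tendsto_integral h1 tendsto_neg_atTop_atBot tendsto_id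
  have t2 := intervalIntegral_tendsto_integral h2 tendsto_neg_atTop_atBot tendsto_id
  have t3 := ((t1.sub t2).add (ht.const_mul I)).sub ((hb.comp tendsto_neg_atTop_atBot).const_mul I)
  rw [mul_zero, add_zero, sub_zero] at t3
  refine sub_eq_zero.1 (tendsto_nhds_unique (t3.congr fun T => ?_) tendsto_const_nhds)
  have h := Complex.integral_boundary_rect_eq_zero_of_differentiableOn f
    ⟨-T, a⟩ ⟨T, b⟩ hf.differentiableOn
  simpa using h

theorem tendsto_exp_neg_exp_atTop {c : ℝ} (hc : 0 < c) (m : ℝ) :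
    Tendsto (fun u : ℝ => Real.exp (-c * Real.exp u + m * u)) atTop (𝓝 0) := by
  have := (tendsto_rpow_mul_exp_neg_mul_atTop_nhds_zero m c hc).comp Real.tendsto_exp_atTop
  refine this.congr fun u => ?_
  simp only [Function.comp, ← Real.exp_mul, ← Real.exp_add]
  ring_nf

theorem tendsto_exp_neg_exp_atBot {c m : ℝ} (hc : 0 < c) (hm : 0 < m) :
    Tendsto (fun u : ℝ => Real.exp (-c * Real.exp u + m * u)) atBot (𝓝 0) := by
  have : Tendsto (fun u : ℝ => Real.exp (m * u)) atBot (𝓝 0) :=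
    Real.tendsto_exp_atBot.comp (tendsto_id.const_mul_atBot hm)
  refine squeeze_zero (fun u => (Real.exp_pos _).le) (fun u => Real.exp_le_exp.2 ?_) this
  nlinarith [Real.exp_pos u]

/-- Shifting the line to height `±π` turns `e^ζ` into `-e^u` and leaves Euler's integral for `Γ(1 -
z)`, up to the phase of `e^((1-z)ζ)`. The cosine is at most `cos v < 0` on the strip crossed, so the
closing segments vanish at both ends. The sign `σ` treats both rays at once. -/
theorem integral_hankelKernel_line {z v σ : ℝ} (hz : z < 1) (hσ : σ = 1 ∨ σ = -1)
    (hv1 : Real.pi / 2 < σ * v) (hv2 : σ * v < Real.pi) :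
    ∫ u : ℝ, hankelKernel z (u + v * I) =
      Complex.exp (σ * Real.pi * (1 - z) * I) * (Real.Gamma (1 - z) : ℝ) := by
  have hπ := Real.pi_pos
  have hcσ : ∀ w : ℝ, Real.cos w = Real.cos (σ * w) := by
    rcases hσ with rfl | rfl <;> simp
  have hσσ : σ * σ = 1 := by rcases hσ with rfl | rfl <;> norm_num
  have hv : Real.cos v < 0 := by
    rw [hcσ]
    exact cos_neg_of_mem hv1 hv2
  have hπσ : Real.cos (σ * Real.pi) = -1 := by
    rw [hcσ, ← mul_assoc, hσσ, one_mul, Real.cos_pi]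
  have hbd : ∀ u w : ℝ, w ∈ uIoc v (σ * Real.pi) →
      ‖hankelKernel z (u + w * I)‖ ≤ Real.exp (-(-Real.cos v) * Real.exp u + (1 - z) * u) := by
    intro u w hw
    rw [norm_hankelKernel, neg_neg]
    refine Real.exp_le_exp.2 (add_le_add_left (mul_le_mul_of_nonneg_right ?_ (Real.exp_pos u).le) _)
    rw [hcσ w, hcσ v]
    have hw' := uIoc_subset_uIcc hw
    rw [mem_uIcc] at hw'
    refine Real.cos_le_cos_of_nonneg_of_le_pi (by linarith) ?_ ?_ <;>
    rcases hσ with rfl | rfl <;> rcases hw' with h | h <;> linarith [h.1, h.2]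
  have hlim : ∀ l : Filter ℝ, Tendsto (fun u : ℝ =>
      Real.exp (-(-Real.cos v) * Real.exp u + (1 - z) * u)) l (𝓝 0) →
      Tendsto (fun u : ℝ => ∫ w in v..(σ * Real.pi), hankelKernel z (u + w * I)) l (𝓝 0) := by
    intro l hl
    have := hl.mul_const |σ * Real.pi - v|
    rw [zero_mul] at this
    exact squeeze_zero_norm (fun u =>
      intervalIntegral.norm_integral_le_of_norm_le_const fun w hw => hbd u w hw) this
  have hc := neg_pos.2 hv
  rw [integral_line_eq (b := σ * Real.pi) (differentiable_hankelKernel z)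
    (integrable_hankelKernel hz hv) (integrable_hankelKernel hz (by rw [hπσ]; norm_num))
    (hlim _ (tendsto_exp_neg_exp_atTop hc _))
    (hlim _ (tendsto_exp_neg_exp_atBot hc (by linarith)))]
  have hG : Real.Gamma (1 - z) = ∫ u : ℝ, Real.exp (-Real.exp u + (1 - z) * u) := by
    rw [Real.Gamma_eq_integral (by linarith), integral_comp_exp]
    refine integral_congr_ae (ae_of_all _ fun u => ?_)
    simp only [smul_eq_mul, ← Real.exp_mul, ← Real.exp_add]
    ring_nf
  rw [hG, ← integral_complex_ofReal, ← integral_const_mul]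
  refine integral_congr_ae (ae_of_all _ fun u => ?_)
  have h1 : Complex.exp (u + (σ * Real.pi : ℝ) * I) = -Complex.exp u := by
    rw [Complex.exp_add]
    rcases hσ with rfl | rfl
    · simp [Complex.exp_pi_mul_I]
    · have : Complex.exp (-(Real.pi * I)) = -1 := by rw [Complex.exp_neg, Complex.exp_pi_mul_I]; norm_num
      simp [this]
  simp only [hankelKernel]
  rw [h1, Complex.ofReal_exp, ← Complex.exp_add]
  congr 1
  push_cast
  ring

/-- For `z < 1` the contour collapses onto its two rays; the phases subtract to `2i sin(πz)`, and
the reflection formula turns `sin(πz) Γ(1 - z)` into `π / Γ(z)`. -/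
theorem hankelInt_kernel_of_lt_one (h1 : Real.pi / 2 < θ) (h2 : θ < Real.pi) {z : ℝ}
    (hz0 : 0 < z) (hz1 : z < 1) :
    hankelInt θ R (hankelKernel z) = 2 * Real.pi * I * ((Real.Gamma z : ℝ) : ℂ)⁻¹ := by
  have hπ := Real.pi_pos
  have hc := cos_neg_of_mem h1 h2
  have hc' : Real.cos (-θ) < 0 := by rwa [Real.cos_neg]
  rw [hankelInt_eq_integral (C := Real.exp 1) (m := 1 - z) (u₀ := 0) (by linarith) (by linarith)
    (fun ζ _ => differentiable_hankelKernel z ζ) (integrable_hankelKernel hz1 hc)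
    (integrable_hankelKernel hz1 hc') fun u v hu _ => ?_,
    integral_hankelKernel_line hz1 (Or.inl rfl) (by linarith) (by linarith),
    integral_hankelKernel_line hz1 (Or.inr rfl) (by linarith) (by linarith), ← sub_mul]
  · have e1 : Complex.exp ((1 : ℝ) * Real.pi * (1 - z) * I) -
        Complex.exp ((-1 : ℝ) * Real.pi * (1 - z) * I) = 2 * I * Real.sin (Real.pi * z) := by
      have : Real.sin (Real.pi * z) = Real.sin (Real.pi * (1 - z)) := by
        rw [mul_sub, mul_one, Real.sin_pi_sub]
      rw [this, Complex.ofReal_sin, Complex.sin]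
      push_cast
      rw [show (1 : ℂ) * Real.pi * (1 - z) * I = Real.pi * (1 - z) * I by ring,
        show (-1 : ℂ) * Real.pi * (1 - z) * I = -(Real.pi * (1 - z)) * I by ring]
      linear_combination (Complex.exp (Real.pi * (1 - z) * I) -
        Complex.exp (-(Real.pi * (1 - z)) * I)) * Complex.I_mul_I
    have e2 := Real.Gamma_mul_Gamma_one_sub z
    rw [eq_div_iff (show Real.sin (Real.pi * z) ≠ 0 from
      (Real.sin_pos_of_pos_of_lt_pi (by positivity) (by nlinarith)).ne')] at e2
    have hΓ := (Real.Gamma_pos_of_pos hz0).ne'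
    have e3 : Real.sin (Real.pi * z) * Real.Gamma (1 - z) = Real.pi * (Real.Gamma z)⁻¹ := by
      rw [eq_mul_inv_iff_mul_eq₀ hΓ]
      linear_combination e2
    rw [e1, mul_assoc, ← Complex.ofReal_mul, e3]
    push_cast
    ring
  · rw [norm_hankelKernel, ← Real.exp_add]
    refine Real.exp_le_exp.2 (add_le_add_left ?_ _)
    calc Real.cos v * Real.exp u ≤ 1 * Real.exp u :=
          mul_le_mul_of_nonneg_right (Real.cos_le_one v) (Real.exp_pos u).le
      _ ≤ 1 := by simpa using hu

/-- This serves to reach `z = 1`, where the contour can no longer be collapsed. For `z ≥ 0` and `u ≥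
0` the factor `e^((1-z)u)` is at most `e^u`, which gives a common dominating function. -/
theorem continuousOn_hankelInt_kernel (h1 : Real.pi / 2 < θ) (h2 : θ < Real.pi) (hR : 0 ≤ R) :
    ContinuousOn (fun z => hankelInt θ R (hankelKernel z)) (Ici 0) := by
  have hc := cos_neg_of_mem h1 h2
  have hc' : Real.cos (-θ) < 0 := by rwa [Real.cos_neg]
  have hcont : Continuous fun p : ℝ × ℝ × ℝ => hankelKernel p.1 (p.2.1 + p.2.2 * I) := by
    unfold hankelKernel
    fun_prop
  have hline : ∀ v : ℝ, Real.cos v < 0 →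
      ContinuousOn (fun z => ∫ u in Ioi R, hankelKernel z (u + v * I)) (Ici 0) := by
    intro v hv z hz
    refine continuousWithinAt_of_dominated
      (bound := fun u => Real.exp (-(-Real.cos v) * Real.exp u + 1 * u)) ?_ ?_
      (integrableOn_exp_neg_exp (neg_pos.2 hv) 1 hR) ?_
    · refine Eventually.of_forall fun w => ?_
      exact ((differentiable_hankelKernel w).continuous.comp (by fun_prop)).aestronglyMeasurable
    · filter_upwards [self_mem_nhdsWithin] with w hw
      filter_upwards [ae_restrict_mem measurableSet_Ioi] with u hu
      rw [norm_hankelKernel, neg_neg]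
      have hw' : (0 : ℝ) ≤ w := hw
      have hu' : 0 ≤ u := hR.trans (mem_Ioi.1 hu).le
      exact Real.exp_le_exp.2 (by nlinarith)
    · refine ae_of_all _ fun u => Continuous.continuousWithinAt ?_
      exact hcont.comp (by fun_prop : Continuous fun z : ℝ => (z, u, v))
  have harc : Continuous fun z : ℝ => ∫ v in (-θ)..θ, hankelKernel z (R + v * I) :=
    intervalIntegral.continuous_parametric_intervalIntegral_of_continuous
      (f := fun z v => hankelKernel z (R + v * I))
      (hcont.comp (by fun_prop : Continuous fun p : ℝ × ℝ => (p.1, R, p.2))) continuous_const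
  exact ((hline θ hc).sub (hline (-θ) hc')).add (continuous_const.mul harc).continuousOn

/-- Hankel's formula for the reciprocal Gamma function. -/
theorem hankelInt_kernel (h1 : Real.pi / 2 < θ) (h2 : θ < Real.pi) (hR : 0 ≤ R) {z : ℝ}
    (hz : 0 < z) :
    hankelInt θ R (hankelKernel z) = 2 * Real.pi * I * ((Real.Gamma z : ℝ) : ℂ)⁻¹ := by
  have hone : hankelInt θ R (hankelKernel 1) = 2 * Real.pi * I * ((Real.Gamma 1 : ℝ) : ℂ)⁻¹ := by
    have hc := (continuousOn_hankelInt_kernel h1 h2 hR).continuousAt (Ici_mem_nhds one_pos)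
    have t1 : Tendsto (fun z => hankelInt θ R (hankelKernel z)) (𝓝[<] 1)
        (𝓝 (hankelInt θ R (hankelKernel 1))) := hc.tendsto.mono_left nhdsWithin_le_nhds
    have hΓ : ContinuousAt Real.Gamma 1 :=
      (Real.differentiableAt_Gamma fun m h => by
        have : (0 : ℝ) ≤ m := m.cast_nonneg
        linarith).continuousAt
    have t2 : Tendsto (fun z : ℝ => 2 * Real.pi * I * ((Real.Gamma z : ℝ) : ℂ)⁻¹) (𝓝[<] 1)
        (𝓝 (2 * Real.pi * I * ((Real.Gamma 1 : ℝ) : ℂ)⁻¹)) := by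
      refine (Tendsto.const_mul _ ?_).mono_left nhdsWithin_le_nhds
      refine Tendsto.inv₀ ((Complex.continuous_ofReal.tendsto _).comp hΓ) ?_
      simp
    refine tendsto_nhds_unique t1 (t2.congr' ?_)
    filter_upwards [Ioo_mem_nhdsLT (zero_lt_one' ℝ)] with z hz
    rw [hankelInt_kernel_of_lt_one h1 h2 hz.1 hz.2]
  -- Induction over the intervals `(n, n + 1]`, carried by the recurrence; the base interval
  -- includes the limit value `z = 1`.
  have step : ∀ n : ℕ, ∀ z : ℝ, (n : ℝ) < z → z ≤ n + 1 →
      hankelInt θ R (hankelKernel z) = 2 * Real.pi * I * ((Real.Gamma z : ℝ) : ℂ)⁻¹ := by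
    intro n
    induction n with
    | zero =>
      intro z hz0 hz1
      simp only [Nat.cast_zero, zero_add] at hz0 hz1
      rcases hz1.eq_or_lt with rfl | hz1
      · exact hone
      · exact hankelInt_kernel_of_lt_one h1 h2 hz0 hz1
    | succ n ih =>
      intro z hz0 hz1
      push_cast at hz0 hz1
      have hn : (0 : ℝ) ≤ n := n.cast_nonneg
      have hw : 0 < z - 1 := by linarith
      have h3 := ih (z - 1) (by linarith) (by linarith)
      have h4 := hankelInt_recurrence h1 h2 hR (z - 1)
      rw [h3] at h4
      have h5 := Real.Gamma_add_one hw.ne'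
      rw [sub_add_cancel] at h4 h5
      rw [h5]
      have hΓ : ((Real.Gamma (z - 1) : ℝ) : ℂ) ≠ 0 :=
        Complex.ofReal_ne_zero.2 (Real.Gamma_pos_of_pos hw).ne'
      have hw' : ((z - 1 : ℝ) : ℂ) ≠ 0 := Complex.ofReal_ne_zero.2 hw.ne'
      have h6 : hankelInt θ R (hankelKernel z) =
          (2 * Real.pi * I * ((Real.Gamma (z - 1) : ℝ) : ℂ)⁻¹) / ((z - 1 : ℝ) : ℂ) := by
        rw [h4]
        field_simp
      rw [h6, Complex.ofReal_mul]
      field_simp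
  obtain ⟨n, hn⟩ : ∃ n : ℕ, ⌈z⌉₊ = n + 1 :=
    Nat.exists_eq_succ_of_ne_zero (Nat.ceil_pos.2 hz).ne'
  refine step n z ?_ ?_
  · exact Nat.lt_ceil.1 (by omega)
  · have := Nat.le_ceil z
    rw [hn] at this
    exact_mod_cast this

end Hankel

end SpectralWave

namespace SpectralWave

/-! ### Decay of the Mittag-Leffler functions on the negative half-line -/

section MittagLefflerBound

open Complex (I)

variable {β ρ x θ : ℝ}

/-- The integrand `e^s s^(β-ρ) / (s^β + x) ds` at `s = e^ζ`. -/
noncomputable def mlKernel (β ρ x : ℝ) (ζ : ℂ) : ℂ :=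
  Complex.exp (Complex.exp ζ + (β + 1 - ρ) * ζ) / (Complex.exp (β * ζ) + x)

/-- A zero would force `e^(βζ) = -x < 0`, but its argument `β Im ζ` lies strictly between `-π` and
`π`. -/
theorem exp_mul_add_ne_zero (hβ : 0 < β) (hx : 0 < x) (hθ : β * θ < Real.pi) {ζ : ℂ}
    (hζ : |ζ.im| ≤ θ) : Complex.exp (β * ζ) + x ≠ 0 := by
  intro h
  have him := congrArg Complex.im h
  have hre := congrArg Complex.re h
  simp only [Complex.add_im, Complex.ofReal_im, add_zero, Complex.zero_im, Complex.exp_im,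
    Complex.re_ofReal_mul, Complex.im_ofReal_mul, Complex.add_re, Complex.ofReal_re,
    Complex.zero_re, Complex.exp_re] at him hre
  have h1 : Real.sin (β * ζ.im) = 0 :=
    (mul_eq_zero.1 him).resolve_left (Real.exp_pos _).ne'
  have h2 := abs_le.1 hζ
  have h3 : β * ζ.im = 0 :=
    (Real.sin_eq_zero_iff_of_lt_of_lt (by nlinarith) (by nlinarith)).1 h1
  rw [h3, Real.cos_zero] at hre
  linarith [Real.exp_pos (β * ζ.re)]

theorem differentiableAt_mlKernel (hβ : 0 < β) (hx : 0 < x) (hθ : β * θ < Real.pi) {ζ : ℂ}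
    (hζ : |ζ.im| ≤ θ) : DifferentiableAt ℂ (mlKernel β ρ x) ζ := by
  unfold mlKernel
  exact DifferentiableAt.div (by fun_prop) (by fun_prop) (exp_mul_add_ne_zero hβ hx hθ hζ)

theorem norm_mlKernel (u v : ℝ) :
    ‖mlKernel β ρ x (u + v * I)‖ = Real.exp (Real.cos v * Real.exp u + (β + 1 - ρ) * u) /
      ‖Complex.exp (β * (u + v * I)) + x‖ := by
  have := norm_hankelKernel (ρ - β) u v
  rw [hankelKernel] at this
  rw [mlKernel, norm_div]
  push_cast at this
  rw [show (1 : ℂ) - (ρ - β) = β + 1 - ρ by ring] at this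
  rw [this]
  ring_nf

/-- Rotation by `e^(-iβv)` makes the exponential real and positive, so only the term with `x`
contributes to the imaginary part. Geometrically, this is the distance from `-x` to the line through
the origin in direction `e^(iβv)`. -/
theorem le_norm_exp_mul_add (hx : 0 < x) (u v : ℝ) :
    x * |Real.sin (β * v)| ≤ ‖Complex.exp (β * (u + v * I)) + x‖ := by
  have h1 : ‖Complex.exp (-(β * v : ℝ) * I)‖ = 1 := by
    have := Complex.norm_exp_ofReal_mul_I (-(β * v))
    push_cast at this ⊢
    exact this
  rw [← mul_one ‖Complex.exp (β * (u + v * I)) + x‖, ← h1, ← norm_mul]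
  refine le_trans (le_of_eq ?_) (Complex.abs_im_le_norm _)
  have h2 : (Complex.exp (β * (u + v * I)) + x) * Complex.exp (-(β * v : ℝ) * I) =
      Complex.exp ((β * u : ℝ)) + x * Complex.exp ((-(β * v) : ℝ) * I) := by
    rw [add_mul, ← Complex.exp_add]
    congr 2
    · push_cast
      ring
    · push_cast
      ring
  rw [h2, ← Complex.ofReal_exp, Complex.add_im, Complex.ofReal_im, zero_add,
    Complex.im_ofReal_mul, Complex.exp_ofReal_mul_I_im, Real.sin_neg, abs_mul, abs_neg,
    abs_of_pos hx]

/-- Far enough to the right the factor `1 / (1 + x s^(-β))` is a geometric series; integrating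
termwise with Hankel's formula produces the coefficients `1 / Γ(βk + ρ)`. -/
theorem hankelInt_mlKernel (h1 : Real.pi / 2 < θ) (h2 : θ < Real.pi) (hβ : 1 ≤ β) (hρ : 1 ≤ ρ)
    (hx : 0 < x) :
    ∃ R, 0 ≤ R ∧ hankelInt θ R (mlKernel β ρ x) = 2 * Real.pi * I * mittagLeffler β ρ (-x) := by
  have hc := cos_neg_of_mem h1 h2
  have hc' : Real.cos (-θ) < 0 := by rwa [Real.cos_neg]
  -- With `e^R ≥ 2x` and `β ≥ 1`, the ratio of the geometric series has modulus at most `1/2` on the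
  -- whole contour.
  obtain ⟨R, hR0, hRx⟩ : ∃ R, 0 ≤ R ∧ 2 * x ≤ Real.exp R :=
    ⟨max 0 (Real.log (2 * x)), le_max_left _ _, by
      rw [← Real.log_le_iff_le_exp (by positivity)]
      exact le_max_right _ _⟩
  have hxexp : ∀ ζ : ℂ, R ≤ ζ.re → x * Real.exp (-(β * ζ.re)) ≤ 1 / 2 := by
    intro ζ hζ
    have h3 : Real.exp R ≤ Real.exp (β * ζ.re) := Real.exp_le_exp.2 (by nlinarith)
    rw [Real.exp_neg, ← div_eq_mul_inv, div_le_iff₀ (Real.exp_pos _)]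
    linarith
  set F : ℕ → ℂ → ℂ := fun k ζ => (-(x : ℂ)) ^ k * hankelKernel (β * k + ρ) ζ with hF
  have hFeq : ∀ k ζ, F k ζ = hankelKernel ρ ζ * (-x * Complex.exp (-(β * ζ))) ^ k := by
    intro k ζ
    simp only [hF, hankelKernel, mul_pow, ← Complex.exp_nat_mul]
    rw [mul_left_comm, ← Complex.exp_add]
    congr 2
    push_cast
    ring
  have hratio : ∀ ζ : ℂ, R ≤ ζ.re → ‖-x * Complex.exp (-(β * ζ))‖ ≤ 1 / 2 := by
    intro ζ hζ
    rw [norm_mul, norm_neg, Complex.norm_real, Real.norm_of_nonneg hx.le, Complex.norm_exp]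
    simpa using hxexp ζ hζ
  have hsum := hasSum_hankelInt (θ := θ) (R := R) (F := F) (f := mlKernel β ρ x)
    (b := fun ζ => ‖hankelKernel ρ ζ‖)
    (fun k => continuous_const.mul (differentiable_hankelKernel _).continuous)
    (fun k ζ hζ => by
      rw [hFeq, norm_mul, norm_pow]
      exact mul_le_mul_of_nonneg_left (pow_le_pow_left₀ (norm_nonneg _) (hratio ζ hζ) k)
        (norm_nonneg _))
    (fun ζ hζ => by
      have h3 : ‖-x * Complex.exp (-(β * ζ))‖ < 1 := (hratio ζ hζ).trans_lt (by norm_num)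
      have h4 := (hasSum_geometric_of_norm_lt_one h3).mul_left (hankelKernel ρ ζ)
      have h5 : mlKernel β ρ x ζ = hankelKernel ρ ζ * (1 - -x * Complex.exp (-(β * ζ)))⁻¹ := by
        have h6 : (1 - -x * Complex.exp (-(β * ζ))) =
            (Complex.exp (β * ζ) + x) * Complex.exp (-(β * ζ)) := by
          rw [add_mul, ← Complex.exp_add, add_neg_cancel, Complex.exp_zero]
          ring
        rw [h6, mul_inv, ← Complex.exp_neg, neg_neg, mlKernel, hankelKernel, div_eq_mul_inv,
          mul_comm _ (Complex.exp (β * ζ)), ← mul_assoc, ← Complex.exp_add]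
        congr 2
        ring
      simp only [hFeq, h5]
      exact h4)
    (differentiable_hankelKernel ρ).continuous.norm
    (integrableOn_hankelKernel ρ hc hR0).norm (integrableOn_hankelKernel ρ hc' hR0).norm
  refine ⟨R, hR0, ?_⟩
  have h3 : ∀ k, hankelInt θ R (F k) =
      2 * Real.pi * I * (((-x) ^ k / Real.Gamma (β * k + ρ) : ℝ) : ℂ) := by
    intro k
    have hz : 0 < β * k + ρ := by positivity
    have h4 := hankelInt_kernel h1 h2 hR0 hz
    have h5 : hankelInt θ R (F k) = (-(x : ℂ)) ^ k * hankelInt θ R (hankelKernel (β * k + ρ)) := by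
      simp only [hankelInt, hF, integral_const_mul, intervalIntegral.integral_const_mul]
      ring
    rw [h5, h4]
    push_cast
    ring
  simp only [h3] at hsum
  have h4 := (((hasSum_mittagLeffler hβ hρ (-x)).mapL Complex.ofRealCLM)).mul_left
    (2 * Real.pi * I)
  exact hsum.unique h4

/-- On the two full lines at heights `±θ` the denominator is at least `x sin(βθ)`, and what remains
is an integral independent of `x`. -/
theorem exists_mittagLeffler_le_div (hβ₁ : 1 < β) (hβ₂ : β < 2) (hρ : ρ = 1 ∨ ρ = 2) :
    ∃ M : ℝ, 0 ≤ M ∧ ∀ x : ℝ, 0 < x → |mittagLeffler β ρ (-x)| ≤ M / x := by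
  have hπ := Real.pi_pos
  have hβ0 : 0 < β := by linarith
  have hρ1 : 1 ≤ ρ := by rcases hρ with rfl | rfl <;> norm_num
  set m := β + 1 - ρ with hm
  -- Positivity of `m` is what permits the collapse of the contour; for `ρ = 2` it uses `β > 1`.
  have hm0 : 0 < m := by rcases hρ with rfl | rfl <;> linarith
  -- The lower bound on `θ` gives decay of `e^s` on the rays, the upper bound keeps the zeros of
  -- `s^β + x` outside; `β < 2` leaves room between them.
  obtain ⟨θ, h1, h2⟩ : ∃ θ, Real.pi / 2 < θ ∧ θ < Real.pi / β :=
    exists_between (div_lt_div_of_pos_left hπ hβ0 hβ₂)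
  have hθβ : β * θ < Real.pi := by
    rw [lt_div_iff₀ hβ0] at h2
    linarith
  have hθπ : θ < Real.pi := by nlinarith
  have hθ0 : 0 < θ := by linarith
  have hc := cos_neg_of_mem h1 hθπ
  have hs : 0 < Real.sin (β * θ) := Real.sin_pos_of_pos_of_lt_pi (by positivity) hθβ
  set J : ℝ := ∫ u : ℝ, Real.exp (-(-Real.cos θ) * Real.exp u + m * u) with hJ
  have hJi := integrable_exp_neg_exp (neg_pos.2 hc) hm0
  have hJ0 : 0 ≤ J := integral_nonneg fun u => (Real.exp_pos _).le
  refine ⟨J / (Real.pi * Real.sin (β * θ)), by positivity, fun x hx => ?_⟩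
  have hbd : ∀ v : ℝ, v = θ ∨ v = -θ → ∀ u : ℝ, ‖mlKernel β ρ x (u + v * I)‖ ≤
      Real.exp (-(-Real.cos θ) * Real.exp u + m * u) * (x * Real.sin (β * θ))⁻¹ := by
    intro v hv u
    have h3 := le_norm_exp_mul_add (β := β) hx u v
    have h4 : |Real.sin (β * v)| = Real.sin (β * θ) := by
      rcases hv with rfl | rfl
      · exact abs_of_pos hs
      · rw [mul_neg, Real.sin_neg, abs_neg, abs_of_pos hs]
    have h5 : Real.cos v = Real.cos θ := by rcases hv with rfl | rfl <;> simp
    rw [h4] at h3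
    rw [norm_mlKernel, h5, neg_neg, ← div_eq_mul_inv]
    exact div_le_div_of_nonneg_left (Real.exp_pos _).le (by positivity) h3
  have hint : ∀ v : ℝ, v = θ ∨ v = -θ →
      Integrable (fun u : ℝ => mlKernel β ρ x (u + v * I)) := by
    intro v hv
    refine Integrable.mono' (hJi.mul_const _) ?_ (ae_of_all _ (hbd v hv))
    refine Continuous.aestronglyMeasurable (continuous_iff_continuousAt.2 fun u => ?_)
    have h6 : |((u : ℂ) + v * I).im| ≤ θ := by
      rcases hv with rfl | rfl <;> simp [abs_of_pos hθ0]
    exact (differentiableAt_mlKernel (ρ := ρ) hβ0 hx hθβ h6).continuousAt.comp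
      (f := fun u : ℝ => (u : ℂ) + v * I) (by fun_prop)
  have hnorm : ∀ v : ℝ, v = θ ∨ v = -θ →
      ‖∫ u : ℝ, mlKernel β ρ x (u + v * I)‖ ≤ J * (x * Real.sin (β * θ))⁻¹ := by
    intro v hv
    rw [hJ, ← integral_mul_const]
    exact norm_integral_le_of_norm_le (hJi.mul_const _) (ae_of_all _ (hbd v hv))
  obtain ⟨R, -, hRE⟩ := hankelInt_mlKernel h1 hθπ hβ₁.le hρ1 hx
  -- To the left of this `u₀` one has `e^(βu) ≤ x / 2`, so the denominator is at least `x / 2`, and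
  -- `e^u ≤ 1`, so the factor from `e^s` is at most `e`.
  rw [hankelInt_eq_integral (C := Real.exp 1 * (2 / x)) (m := m)
    (u₀ := min 0 (Real.log (x / 2) / β)) hθ0.le hm0
    (fun ζ hζ => differentiableAt_mlKernel hβ0 hx hθβ hζ)
    (hint θ (Or.inl rfl)) (hint (-θ) (Or.inr rfl)) ?_] at hRE
  · have h7 := norm_sub_le (∫ u : ℝ, mlKernel β ρ x (u + (θ : ℝ) * I))
      (∫ u : ℝ, mlKernel β ρ x (u + (-θ : ℝ) * I))
    rw [hRE] at h7
    have h8 := h7.trans (add_le_add (hnorm θ (Or.inl rfl)) (hnorm (-θ) (Or.inr rfl)))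
    rw [norm_mul, norm_mul, norm_mul, Complex.norm_real, Complex.norm_real, Complex.norm_I,
      Real.norm_of_nonneg hπ.le, Real.norm_eq_abs] at h8
    simp only [Complex.norm_ofNat, mul_one] at h8
    rw [div_div, le_div_iff₀ (by positivity)]
    rw [← two_mul, mul_assoc] at h8
    have h9 := le_of_mul_le_mul_left h8 two_pos
    rw [← div_eq_mul_inv, le_div_iff₀ (by positivity)] at h9
    linarith
  · intro u v hu _
    have hu0 : u ≤ 0 := hu.trans (min_le_left _ _)
    have hux : Real.exp (β * u) ≤ x / 2 := by
      rw [← Real.le_log_iff_exp_le (by positivity), mul_comm, ← le_div_iff₀ hβ0]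
      exact hu.trans (min_le_right _ _)
    have hD : x / 2 ≤ ‖Complex.exp (β * (u + v * I)) + x‖ := by
      have h3 := norm_sub_norm_le (x : ℂ) (-Complex.exp (β * (u + v * I)))
      rw [norm_neg, Complex.norm_exp, Complex.norm_real, Real.norm_of_nonneg hx.le,
        sub_neg_eq_add, add_comm (x : ℂ)] at h3
      simp only [Complex.re_ofReal_mul, Complex.add_re, Complex.ofReal_re, Complex.I_re, mul_zero,
        add_zero] at h3
      linarith
    rw [norm_mlKernel]
    refine (div_le_div_of_nonneg_left (Real.exp_pos _).le (by positivity) hD).trans ?_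
    rw [Real.exp_add, ← hm, div_eq_mul_inv, inv_div, mul_right_comm]
    have h3 : Real.cos v * Real.exp u ≤ 1 := by
      calc Real.cos v * Real.exp u ≤ 1 * Real.exp u :=
            mul_le_mul_of_nonneg_right (Real.cos_le_one v) (Real.exp_pos u).le
        _ ≤ 1 := by simpa using hu0
    gcongr

/-- The decay of the Mittag-Leffler functions on the negative half-line. -/
theorem exists_mittagLeffler_le (hβ₁ : 1 < β) (hβ₂ : β < 2) (hρ : ρ = 1 ∨ ρ = 2) :
    ∃ M : ℝ, 0 < M ∧ ∀ x : ℝ, 0 ≤ x → |mittagLeffler β ρ (-x)| ≤ M * (1 + x)⁻¹ := by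
  have hρ1 : 1 ≤ ρ := by rcases hρ with rfl | rfl <;> norm_num
  obtain ⟨M, hM0, hM⟩ := exists_mittagLeffler_le_div hβ₁ hβ₂ hρ
  obtain ⟨N, hN⟩ := (isCompact_Icc (a := (-1 : ℝ)) (b := 0)).exists_bound_of_continuousOn
    (continuous_mittagLeffler (ρ := ρ) hβ₁.le hρ1).continuousOn
  have hN0 : 0 ≤ N := (norm_nonneg _).trans (hN 0 (by simp))
  -- For `x ≤ 1` the compactness bound `N` is used with `1 + x ≤ 2`; for `x ≥ 1` the bound `M / x`
  -- with `1 + x ≤ 2x`. The final `1` only secures positivity.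
  refine ⟨2 * (M + N) + 1, by positivity, fun x hx => ?_⟩
  rw [← div_eq_mul_inv, le_div_iff₀ (by positivity)]
  rcases le_total x 1 with h | h
  · have := hN (-x) ⟨by linarith, by linarith⟩
    rw [Real.norm_eq_abs] at this
    nlinarith [abs_nonneg (mittagLeffler β ρ (-x))]
  · have := hM x (by linarith)
    rw [le_div_iff₀ (by linarith)] at this
    nlinarith [abs_nonneg (mittagLeffler β ρ (-x))]

end MittagLefflerBound

end SpectralWave

namespace SpectralWave

/-! ## Operators that are diagonal in an orthonormal basis -/

section Diagonal

variable {𝕜 H I : Type*} [RCLike 𝕜] [NormedAddCommGroup H] [InnerProductSpace 𝕜 H]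
  {L : H →ₗ.[𝕜] H}

namespace EigenBasis

variable (E : EigenBasis L I)

/-- The eigenvalues are nonnegative and `L` acts on the expansion of each element of its domain
by multiplication with the eigenvalues. -/
structure IsDiagonal : Prop where
  eigenvalue_nonneg : ∀ ζ, 0 ≤ E.eigenvalue ζ
  inner_apply : ∀ ζ (x : L.domain),
    ⟪E.basis ζ, L x⟫_𝕜 = (E.eigenvalue ζ : 𝕜) * ⟪E.basis ζ, (x : H)⟫_𝕜

theorem norm_basis (ζ : I) : ‖E.basis ζ‖ = 1 := E.basis.orthonormal.1 ζ

theorem resolvent_basis {z : 𝕜} {R : H →L[𝕜] H}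
    (hR : ∀ x : L.domain, R (L x - z • (x : H)) = x) (ζ : I) :
    ((E.eigenvalue ζ : 𝕜) - z) • R (E.basis ζ) = E.basis ζ := by
  have h := hR ⟨E.basis ζ, E.mem_domain ζ⟩
  rw [E.apply_eq, ← sub_smul, map_smul] at h
  exact h

/-- The spectrum is countable and the scalar field is not, so a resolvent `R` exists. It multiplies
`e_ξ` by `(γ_ξ - z)⁻¹`; hence `(γ_ζ - z)(R y, e_ζ) = (y, e_ζ)` on a dense span, by continuity for
all `y`, and in particular for `y = (L - z) x`. Positivity enters only through the sign of the
eigenvalues. -/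
theorem isDiagonal [Countable I] (hpos : IsPositive L)
    (hspec : spectrum L = range fun ζ => (E.eigenvalue ζ : 𝕜)) : E.IsDiagonal := by
  have hres : ∃ z, z ∈ resolventSet L := by
    by_contra! h
    have h1 : spectrum L = univ := eq_univ_of_forall fun z => h z
    rw [hspec] at h1
    have h2 : (univ : Set 𝕜).Countable := h1 ▸ countable_range _
    exact Cardinal.not_countable_real (by
      simpa using h2.preimage (RCLike.ofReal_injective (K := 𝕜)))
  obtain ⟨z, R, -, hR⟩ := hres
  have hRe := E.resolvent_basis hR
  have hne : ∀ ζ, (E.eigenvalue ζ : 𝕜) - z ≠ 0 := by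
    intro ζ h
    have h1 := hRe ζ
    rw [h, zero_smul] at h1
    have h2 := E.norm_basis ζ
    rw [← h1] at h2
    simp at h2
  refine ⟨fun ζ => ?_, fun ζ x => ?_⟩
  · have h := (hpos ⟨E.basis ζ, E.mem_domain ζ⟩).1
    rw [E.apply_eq, inner_smul_left, RCLike.conj_ofReal, RCLike.re_ofReal_mul,
      inner_self_eq_norm_sq, E.norm_basis] at h
    simpa using h
  · have hT : ((E.eigenvalue ζ : 𝕜) - z) • (innerSL 𝕜 (E.basis ζ)).comp R =
        innerSL 𝕜 (E.basis ζ) := by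
      refine ContinuousLinearMap.ext_on (s := range E.basis) ?_ ?_
      · have := E.basis.dense_span
        exact Submodule.dense_iff_topologicalClosure_eq_top.2 this
      · rintro - ⟨ξ, rfl⟩
        have h1 : R (E.basis ξ) = ((E.eigenvalue ξ : 𝕜) - z)⁻¹ • E.basis ξ := by
          rw [eq_inv_smul_iff₀ (hne ξ), hRe ξ]
        simp only [_root_.smul_apply, ContinuousLinearMap.comp_apply,
          innerSL_apply_apply, smul_eq_mul, h1, inner_smul_right]
        by_cases h2 : ζ = ξ
        · subst h2
          rw [mul_inv_cancel_left₀ (hne ζ)]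
        · rw [E.basis.orthonormal.2 h2]
          simp
    have h3 := congrArg (fun T : H →L[𝕜] 𝕜 => T (L x - z • (x : H))) hT
    simp only [_root_.smul_apply, ContinuousLinearMap.comp_apply,
      innerSL_apply_apply, smul_eq_mul, hR x, inner_sub_right, inner_smul_right] at h3
    linear_combination -h3

/-- The inverse `R` of `L` satisfies `1 = γ_ζ ‖R e_ζ‖ ≤ γ_ζ ‖R‖`. Adding `1` to `‖R‖` makes the
constant meaningful when `R = 0` and keeps it at most `1`. -/
theorem exists_pos_le_eigenvalue (h0 : (0 : 𝕜) ∉ spectrum L) (hE : E.IsDiagonal) :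
    ∃ c : ℝ, 0 < c ∧ c ≤ 1 ∧ ∀ ζ, c ≤ E.eigenvalue ζ := by
  obtain ⟨R, -, hR⟩ : (0 : 𝕜) ∈ resolventSet L := not_not.1 h0
  refine ⟨(‖R‖ + 1)⁻¹, by positivity, inv_le_one_of_one_le₀ (by linarith [norm_nonneg R]),
    fun ζ => ?_⟩
  have h1 := congrArg norm (E.resolvent_basis hR ζ)
  rw [sub_zero, norm_smul, E.norm_basis, RCLike.norm_ofReal,
    abs_of_nonneg (hE.eigenvalue_nonneg ζ)] at h1
  have h2 := R.le_opNorm (E.basis ζ)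
  rw [E.norm_basis, mul_one] at h2
  rw [inv_le_iff_one_le_mul₀ (by positivity)]
  nlinarith [hE.eigenvalue_nonneg ζ]

theorem inner_testOp_pow {E : EigenBasis L I} (hE : E.IsDiagonal) (ζ : I) (φ : testSpace L)
    (j : ℕ) :
    ⟪E.basis ζ, ((testOp L ^ j) φ : H)⟫_𝕜 =
      (E.eigenvalue ζ : 𝕜) ^ j * ⟪E.basis ζ, (φ : H)⟫_𝕜 := by
  induction j with
  | zero => simp
  | succ j ih =>
    rw [pow_succ', Module.End.mul_apply]
    have h := hE.inner_apply ζ ⟨((testOp L ^ j) φ : H),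
      testSpace_le_domain L ((testOp L ^ j) φ).2⟩
    rw [pow_succ', mul_assoc, ← ih, ← h]
    rfl

theorem inner_testOp {E : EigenBasis L I} (hE : E.IsDiagonal) (ζ : I) (φ : testSpace L) :
    ⟪E.basis ζ, (testOp L φ : H)⟫_𝕜 = (E.eigenvalue ζ : 𝕜) * ⟪E.basis ζ, (φ : H)⟫_𝕜 := by
  simpa using inner_testOp_pow hE ζ φ 1

theorem testOp_basis (ζ : I) :
    testOp L ⟨E.basis ζ, E.mem_testSpace ζ⟩ =
      (E.eigenvalue ζ : 𝕜) • ⟨E.basis ζ, E.mem_testSpace ζ⟩ :=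
  Subtype.ext (E.apply_eq ζ)

theorem testOp_pow_basis (ζ : I) (j : ℕ) :
    (testOp L ^ j) ⟨E.basis ζ, E.mem_testSpace ζ⟩ =
      (E.eigenvalue ζ : 𝕜) ^ j • ⟨E.basis ζ, E.mem_testSpace ζ⟩ := by
  induction j with
  | zero => simp
  | succ j ih =>
    rw [pow_succ', Module.End.mul_apply, ih, map_smul, E.testOp_basis, smul_smul, pow_succ]

theorem hasSum_norm_inner_sq (x : H) :
    HasSum (fun ζ => ‖⟪E.basis ζ, x⟫_𝕜‖ ^ 2) (‖x‖ ^ 2) := by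
  have h := E.basis.hasSum_inner_mul_inner x x
  have h1 : ∀ ζ, ⟪x, E.basis ζ⟫_𝕜 * ⟪E.basis ζ, x⟫_𝕜 = ((‖⟪E.basis ζ, x⟫_𝕜‖ ^ 2 : ℝ) : 𝕜) := by
    intro ζ
    rw [← inner_conj_symm, RCLike.conj_mul]
    push_cast
    rfl
  simp only [h1, inner_self_eq_norm_sq_to_K] at h
  exact_mod_cast h

end EigenBasis

/-! ### Test functions and distributions in terms of coefficients -/

theorem testSeminorm_le_sum (k : ℕ) (φ : testSpace L) :
    testSeminorm L k φ ≤ ∑ j ∈ Finset.range (k + 1), ‖((testOp L ^ j) φ : H)‖ :=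
  Finset.sup'_le _ _ fun _ hj => Finset.single_le_sum
    (f := fun j => ‖((testOp L ^ j) φ : H)‖) (fun _ _ => norm_nonneg _) hj

theorem testSeminorm_testOp_le (k : ℕ) (φ : testSpace L) :
    testSeminorm L k (testOp L φ) ≤ testSeminorm L (k + 1) φ := by
  refine Finset.sup'_le _ _ fun j hj => ?_
  have h : (testOp L ^ j) (testOp L φ) = (testOp L ^ (j + 1)) φ := by
    rw [pow_succ, Module.End.mul_apply]
  rw [h]
  exact Finset.le_sup' (fun j => ‖((testOp L ^ j) φ : H)‖)
    (Finset.mem_range.2 (Nat.succ_lt_succ (Finset.mem_range.1 hj)))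

/-- Expanding `(1 + L)^k` gives `2^k` powers of `L`, each controlled by the seminorm. This links the
seminorms to the weights `(1 + γ)^k`. -/
theorem norm_one_add_testOp_pow_le (k : ℕ) (φ : testSpace L) :
    ‖(((1 + testOp L) ^ k) φ : H)‖ ≤ 2 ^ k * testSeminorm L k φ := by
  induction k generalizing φ with
  | zero => simpa using norm_le_testSeminorm L φ
  | succ k ih =>
    have h : ((1 + testOp L) ^ (k + 1)) φ =
        ((1 + testOp L) ^ k) φ + ((1 + testOp L) ^ k) (testOp L φ) := by
      rw [pow_succ, Module.End.mul_apply, LinearMap.add_apply, map_add, Module.End.one_apply]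
    rw [h, Submodule.coe_add]
    refine (norm_add_le _ _).trans ((add_le_add (ih φ) (ih _)).trans ?_)
    have h1 := testSeminorm_mono L k.le_succ φ
    have h2 := testSeminorm_testOp_le k φ
    calc 2 ^ k * testSeminorm L k φ + 2 ^ k * testSeminorm L k (testOp L φ)
        ≤ 2 ^ k * testSeminorm L (k + 1) φ + 2 ^ k * testSeminorm L (k + 1) φ := by gcongr
      _ = 2 ^ (k + 1) * testSeminorm L (k + 1) φ := by ring

namespace EigenBasis

variable {E : EigenBasis L I}

theorem inner_one_add_testOp_pow (hE : E.IsDiagonal) (ζ : I) (φ : testSpace L) (k : ℕ) :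
    ⟪E.basis ζ, (((1 + testOp L) ^ k) φ : H)⟫_𝕜 =
      (1 + (E.eigenvalue ζ : 𝕜)) ^ k * ⟪E.basis ζ, (φ : H)⟫_𝕜 := by
  induction k generalizing φ with
  | zero => simp
  | succ k ih =>
    rw [pow_succ, Module.End.mul_apply, ih, LinearMap.add_apply, Module.End.one_apply,
      Submodule.coe_add, inner_add_right, inner_testOp hE]
    ring

theorem hasSum_weight_inner_sq (hE : E.IsDiagonal) (φ : testSpace L) (k : ℕ) :
    HasSum (fun ζ => ((1 + E.eigenvalue ζ) ^ k * ‖⟪E.basis ζ, (φ : H)⟫_𝕜‖) ^ 2)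
      (‖(((1 + testOp L) ^ k) φ : H)‖ ^ 2) := by
  have h := E.hasSum_norm_inner_sq (((1 + testOp L) ^ k) φ : H)
  have h1 : ∀ ζ, ‖(1 + (E.eigenvalue ζ : 𝕜))‖ = 1 + E.eigenvalue ζ := by
    intro ζ
    rw [← RCLike.ofReal_one, ← RCLike.ofReal_add, RCLike.norm_ofReal, abs_of_nonneg]
    linarith [hE.eigenvalue_nonneg ζ]
  simpa only [inner_one_add_testOp_pow hE, norm_mul, norm_pow, h1] using h

/-- The partial sums of the expansion of a test function. -/
noncomputable def partialSum (E : EigenBasis L I) (a : I → 𝕜) (s : Finset I) : testSpace L :=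
  ∑ ζ ∈ s, a ζ • ⟨E.basis ζ, E.mem_testSpace ζ⟩

theorem coe_testOp_pow_partialSum (a : I → 𝕜) (s : Finset I) (j : ℕ) :
    (((testOp L ^ j) (E.partialSum a s) : testSpace L) : H) =
      ∑ ζ ∈ s, (a ζ * (E.eigenvalue ζ : 𝕜) ^ j) • E.basis ζ := by
  simp only [partialSum, map_sum, map_smul, E.testOp_pow_basis, smul_smul]
  rw [Submodule.coe_sum]
  rfl

theorem pairing_partialSum (u : distributions L) (a : I → 𝕜) (s : Finset I) :
    pairing u (E.partialSum a s) = ∑ ζ ∈ s, starRingEnd 𝕜 (a ζ) * E.coeff u ζ := by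
  simp only [pairing, partialSum, map_sum, LinearMap.map_smulₛₗ, smul_eq_mul]
  rfl

/-- By diagonality, `L^j` of the partial sums are the partial sums of the expansion of `L^j φ`,
which converge in `H` for every `j`. -/
theorem tendsto_testSeminorm_partialSum (hE : E.IsDiagonal) (φ : testSpace L) (k : ℕ) :
    Tendsto (fun s => testSeminorm L k
      (φ - E.partialSum (fun ζ => ⟪E.basis ζ, (φ : H)⟫_𝕜) s)) atTop (𝓝 0) := by
  have h : Tendsto (fun s => ∑ j ∈ Finset.range (k + 1), ‖((testOp L ^ j)
      (φ - E.partialSum (fun ζ => ⟪E.basis ζ, (φ : H)⟫_𝕜) s) : H)‖) atTop (𝓝 0) := by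
    rw [← Finset.sum_const_zero (s := Finset.range (k + 1))]
    refine tendsto_finsetSum _ fun j _ => ?_
    have h0 : HasSum (fun ζ => ⟪E.basis ζ, ((testOp L ^ j) φ : H)⟫_𝕜 • E.basis ζ)
        ((testOp L ^ j) φ : H) := by
      simpa only [HilbertBasis.repr_apply_apply] using
        E.basis.hasSum_repr ((testOp L ^ j) φ : H)
    have h1 : Tendsto (fun s : Finset I => ∑ ζ ∈ s,
        ⟪E.basis ζ, ((testOp L ^ j) φ : H)⟫_𝕜 • E.basis ζ) atTop
        (𝓝 ((testOp L ^ j) φ : H)) := h0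
    have h2 := (tendsto_const_nhds (x := ((testOp L ^ j) φ : H))).sub h1
    rw [sub_self] at h2
    rw [← norm_zero (E := H)]
    refine h2.norm.congr fun s => ?_
    rw [map_sub, Submodule.coe_sub, coe_testOp_pow_partialSum]
    congr 2
    refine Finset.sum_congr rfl fun ζ _ => ?_
    rw [inner_testOp_pow hE, mul_comm]
  exact squeeze_zero (fun s => testSeminorm_nonneg L k _) (fun s => testSeminorm_le_sum k _) h

/-- The expansion of the pairing with a test function. -/
theorem hasSum_pairing (hE : E.IsDiagonal) (u : distributions L) (φ : testSpace L) :
    HasSum (fun ζ => starRingEnd 𝕜 ⟪E.basis ζ, (φ : H)⟫_𝕜 * E.coeff u ζ) (pairing u φ) := by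
  obtain ⟨k, C, hC⟩ := u.2
  have h1 := (tendsto_testSeminorm_partialSum hE φ k).const_mul C
  rw [mul_zero] at h1
  rw [HasSum, SummationFilter.unconditional_filter, tendsto_iff_norm_sub_tendsto_zero]
  refine squeeze_zero (fun s => norm_nonneg _) (fun s => ?_) h1
  rw [norm_sub_rev, ← pairing_partialSum (E := E)]
  have : pairing u φ - pairing u (E.partialSum (fun ζ => ⟪E.basis ζ, (φ : H)⟫_𝕜) s) =
      (u : testSpace L →ₗ⋆[𝕜] 𝕜) (φ - E.partialSum (fun ζ => ⟪E.basis ζ, (φ : H)⟫_𝕜) s) := by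
    simp [pairing, map_sub]
  rw [this]
  exact hC _

theorem distribution_ext (hE : E.IsDiagonal) {u v : distributions L}
    (h : ∀ ζ, E.coeff u ζ = E.coeff v ζ) : u = v := by
  refine Subtype.ext (LinearMap.ext fun φ => ?_)
  have h1 := hasSum_pairing hE u φ
  simp only [h] at h1
  exact h1.unique (hasSum_pairing hE v φ)

theorem one_le_one_add (hE : E.IsDiagonal) (ζ : I) : 1 ≤ 1 + E.eigenvalue ζ := by
  linarith [hE.eigenvalue_nonneg ζ]

/-- Distributions have polynomially bounded coefficients in the square mean. -/
theorem exists_summable_weight (hE : E.IsDiagonal) (u : distributions L) :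
    ∃ k : ℕ, Summable fun ζ => (((1 + E.eigenvalue ζ) ^ k)⁻¹ * ‖E.coeff u ζ‖) ^ 2 := by
  obtain ⟨k, C, hC⟩ := u.2
  refine ⟨k, summable_of_sum_le (c := C ^ 2) (fun ζ => sq_nonneg _) fun s => ?_⟩
  set g : I → ℝ := fun ζ => (1 + E.eigenvalue ζ) ^ k with hg
  have hg0 : ∀ ζ, 0 < g ζ := fun ζ => pow_pos (by linarith [one_le_one_add hE ζ]) k
  -- Duality: the finite combination of eigenfunctions with these coefficients pairs with `u` to
  -- exactly `S`, while its seminorm is at most `√S`. Continuity then gives `S ≤ |C| √S`, hence `S ≤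
  -- C²` uniformly in the finite set.
  set a : I → 𝕜 := fun ζ => (((g ζ)⁻¹ ^ 2 : ℝ) : 𝕜) * E.coeff u ζ with ha
  set S : ℝ := ∑ ζ ∈ s, ((g ζ)⁻¹ * ‖E.coeff u ζ‖) ^ 2 with hS
  have hS0 : 0 ≤ S := Finset.sum_nonneg fun ζ _ => sq_nonneg _
  have h1 : pairing u (E.partialSum a s) = (S : 𝕜) := by
    rw [pairing_partialSum, hS, RCLike.ofReal_sum]
    refine Finset.sum_congr rfl fun ζ _ => ?_
    rw [ha]
    simp only [map_mul, RCLike.conj_ofReal]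
    rw [mul_assoc, RCLike.conj_mul]
    push_cast
    ring
  have h2 : testSeminorm L k (E.partialSum a s) ≤ √S := by
    refine Finset.sup'_le _ _ fun j hj => Real.le_sqrt_of_sq_le ?_
    rw [coe_testOp_pow_partialSum, ← RCLike.ofReal_le_ofReal (K := 𝕜), RCLike.ofReal_pow,
      ← inner_self_eq_norm_sq_to_K, E.basis.orthonormal.inner_sum]
    simp only [RCLike.conj_mul, ← RCLike.ofReal_pow, ← RCLike.ofReal_sum]
    rw [RCLike.ofReal_le_ofReal]
    refine Finset.sum_le_sum fun ζ _ => pow_le_pow_left₀ (norm_nonneg _) ?_ 2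
    rw [ha, norm_mul, norm_mul, RCLike.norm_ofReal, RCLike.norm_ofReal,
      abs_of_nonneg (pow_nonneg (hE.eigenvalue_nonneg ζ) j), abs_of_nonneg (by positivity)]
    have h3 : E.eigenvalue ζ ^ j ≤ g ζ :=
      (pow_le_pow_left₀ (hE.eigenvalue_nonneg ζ) (by linarith) j).trans
        (pow_le_pow_right₀ (one_le_one_add hE ζ) (Nat.lt_succ_iff.1 (Finset.mem_range.1 hj)))
    calc (g ζ)⁻¹ ^ 2 * ‖E.coeff u ζ‖ * E.eigenvalue ζ ^ j
        ≤ (g ζ)⁻¹ ^ 2 * ‖E.coeff u ζ‖ * g ζ := by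
          have := hg0 ζ
          gcongr
      _ = (g ζ)⁻¹ * ‖E.coeff u ζ‖ := by
          have := (hg0 ζ).ne'
          field_simp
  have h3 := hC (E.partialSum a s)
  have h4 : ‖(u : testSpace L →ₗ⋆[𝕜] 𝕜) (E.partialSum a s)‖ = S := by
    change ‖pairing u (E.partialSum a s)‖ = S
    rw [h1, RCLike.norm_ofReal, abs_of_nonneg hS0]
  rw [h4] at h3
  have h5 : S ≤ |C| * √S := h3.trans (mul_le_mul (le_abs_self C) h2
    (testSeminorm_nonneg L k _) (abs_nonneg C))
  rcases hS0.eq_or_lt with h0 | h0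
  · rw [← h0]
    positivity
  · have h6 : √S ≤ |C| := by
      have h7 := Real.sqrt_pos.2 h0
      nlinarith [Real.mul_self_sqrt hS0]
    calc S = √S ^ 2 := (Real.sq_sqrt hS0).symm
      _ ≤ |C| ^ 2 := pow_le_pow_left₀ (Real.sqrt_nonneg _) h6 2
      _ = C ^ 2 := sq_abs C

/-- Cauchy-Schwarz, with the weight `(1 + γ)^k` on the test function and its inverse on the
coefficients. -/
theorem summable_mul_of_weight (hE : E.IsDiagonal) {c : I → ℝ} (hc0 : ∀ ζ, 0 ≤ c ζ) {k : ℕ}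
    (hc : Summable fun ζ => (((1 + E.eigenvalue ζ) ^ k)⁻¹ * c ζ) ^ 2) (φ : testSpace L) :
    (Summable fun ζ => ‖⟪E.basis ζ, (φ : H)⟫_𝕜‖ * c ζ) ∧
      ∑' ζ, ‖⟪E.basis ζ, (φ : H)⟫_𝕜‖ * c ζ ≤
        √(∑' ζ, (((1 + E.eigenvalue ζ) ^ k)⁻¹ * c ζ) ^ 2) * 2 ^ k * testSeminorm L k φ := by
  have hg0 : ∀ ζ, 0 < (1 + E.eigenvalue ζ) ^ k := fun ζ =>
    pow_pos (by linarith [one_le_one_add hE ζ]) k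
  have h1 := hasSum_weight_inner_sq hE φ k
  have h2 := Real.summable_and_inner_le_Lp_mul_Lq_tsum_of_nonneg
    (f := fun ζ => ((1 + E.eigenvalue ζ) ^ k)⁻¹ * c ζ)
    (g := fun ζ => (1 + E.eigenvalue ζ) ^ k * ‖⟪E.basis ζ, (φ : H)⟫_𝕜‖)
    Real.HolderConjugate.two_two
    (fun ζ => mul_nonneg (inv_nonneg.2 (hg0 ζ).le) (hc0 ζ))
    (fun ζ => mul_nonneg (hg0 ζ).le (norm_nonneg _))
    (by simpa using hc) (by simpa using h1.summable)
  have h3 : ∀ ζ, ((1 + E.eigenvalue ζ) ^ k)⁻¹ * c ζ *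
      ((1 + E.eigenvalue ζ) ^ k * ‖⟪E.basis ζ, (φ : H)⟫_𝕜‖) = ‖⟪E.basis ζ, (φ : H)⟫_𝕜‖ * c ζ := by
    intro ζ
    have := (hg0 ζ).ne'
    field_simp
  simp only [h3, ← Real.sqrt_eq_rpow, Real.rpow_ofNat] at h2
  rw [h1.tsum_eq, Real.sqrt_sq (norm_nonneg _)] at h2
  refine ⟨h2.1, h2.2.trans ?_⟩
  rw [mul_assoc]
  exact mul_le_mul_of_nonneg_left (norm_one_add_testOp_pow_le k φ) (Real.sqrt_nonneg _)

theorem summable_norm_pairing (hE : E.IsDiagonal) (u : distributions L) (φ : testSpace L) :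
    Summable fun ζ => ‖⟪E.basis ζ, (φ : H)⟫_𝕜‖ * ‖E.coeff u ζ‖ := by
  obtain ⟨k, hk⟩ := exists_summable_weight hE u
  exact (summable_mul_of_weight hE (fun ζ => norm_nonneg _) hk φ).1

/-- Coefficients with polynomial bounds in the square mean belong to a distribution. -/
theorem exists_distribution (hE : E.IsDiagonal) {c : I → 𝕜} {k : ℕ}
    (hc : Summable fun ζ => (((1 + E.eigenvalue ζ) ^ k)⁻¹ * ‖c ζ‖) ^ 2) :
    ∃ u : distributions L, ∀ ζ, E.coeff u ζ = c ζ := by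
  classical
  have hn : ∀ φ : testSpace L, Summable fun ζ =>
      ‖starRingEnd 𝕜 ⟪E.basis ζ, (φ : H)⟫_𝕜 * c ζ‖ := fun φ => by
    simpa only [norm_mul, RCLike.norm_conj] using
      (summable_mul_of_weight hE (fun ζ => norm_nonneg (c ζ)) hc φ).1
  refine ⟨⟨{ toFun := fun φ => ∑' ζ, starRingEnd 𝕜 ⟪E.basis ζ, (φ : H)⟫_𝕜 * c ζ
             map_add' := fun φ ψ => ?_
             map_smul' := fun a φ => ?_ }, k,
      √(∑' ζ, (((1 + E.eigenvalue ζ) ^ k)⁻¹ * ‖c ζ‖) ^ 2) * 2 ^ k, fun φ => ?_⟩, fun ζ => ?_⟩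
  · rw [← (hn φ).of_norm.tsum_add (hn ψ).of_norm]
    simp only [Submodule.coe_add, inner_add_right, map_add, add_mul]
  · rw [smul_eq_mul, ← tsum_mul_left]
    simp only [Submodule.coe_smul, inner_smul_right, map_mul, mul_assoc]
  · refine (norm_tsum_le_tsum_norm (hn φ)).trans ?_
    simpa only [norm_mul, RCLike.norm_conj] using
      (summable_mul_of_weight hE (fun ζ => norm_nonneg (c ζ)) hc φ).2
  · change ∑' ξ, starRingEnd 𝕜 ⟪E.basis ξ, E.basis ζ⟫_𝕜 * c ξ = c ζ
    rw [tsum_eq_single ζ fun ξ hξ => by rw [E.basis.orthonormal.2 hξ]; simp]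
    rw [inner_self_eq_norm_sq_to_K, E.norm_basis]
    simp

theorem coeff_sub (u v : distributions L) (ζ : I) :
    E.coeff (u - v) ζ = E.coeff u ζ - E.coeff v ζ := by
  simp [coeff, pairing]

theorem coeff_sum_smul_basis [DecidableEq I] (a : I → 𝕜) (s : Finset I) (ζ : I) :
    E.coeff (∑ ξ ∈ s, a ξ • ofHilbert L (E.basis ξ)) ζ = if ζ ∈ s then a ζ else 0 := by
  have h : E.coeff (∑ ξ ∈ s, a ξ • ofHilbert L (E.basis ξ)) ζ =
      ∑ ξ ∈ s, a ξ * ⟪E.basis ζ, E.basis ξ⟫_𝕜 := by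
    simp only [coeff, pairing, AddSubmonoidClass.coe_finsetSum, LinearMap.sum_apply]
    rfl
  rw [h]
  simp [orthonormal_iff_ite.1 E.basis.orthonormal]

end EigenBasis

end Diagonal

end SpectralWave

namespace SpectralWave

/-! ## The wave type equation -/

section Wave

variable {𝕜 H I : Type*} [RCLike 𝕜] [NormedAddCommGroup H] [InnerProductSpace 𝕜 H]
  {L : H →ₗ.[𝕜] H} {E : EigenBasis L I} {β : ℝ}

theorem fracInt_ofReal_mul (a : ℝ) (r : ℝ → ℝ) (c : 𝕜) (t : ℝ) :
    fracInt a (fun s => (r s : 𝕜) * c) t = ((fracInt a r t : ℝ) : 𝕜) * c := by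
  have h : ∀ s : ℝ, (t - s) ^ (a - 1) • ((r s : 𝕜) * c) =
      (((t - s) ^ (a - 1) • r s : ℝ) : 𝕜) * c := by
    intro s
    rw [RCLike.real_smul_eq_coe_mul, smul_eq_mul, RCLike.ofReal_mul, mul_assoc]
  simp only [fracInt, h]
  rw [intervalIntegral.integral_mul_const, RCLike.intervalIntegral_ofReal,
    RCLike.real_smul_eq_coe_mul, smul_eq_mul, RCLike.ofReal_mul, mul_assoc]

theorem fracInt_const_mul (a : ℝ) (c : 𝕜) (k : ℝ → 𝕜) (t : ℝ) :
    fracInt a (fun s => c * k s) t = c * fracInt a k t := by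
  simp only [fracInt, ← mul_smul_comm]
  rw [intervalIntegral.integral_const_mul, mul_smul_comm]

theorem intervalIntegrable_kernel_mul (hβ : 1 ≤ β) {t : ℝ} {f : ℝ → 𝕜} (hf : Continuous f) :
    IntervalIntegrable (fun s => (t - s) ^ (β - 1) • f s) volume 0 t :=
  Continuous.intervalIntegrable (((continuous_const.sub continuous_id).rpow_const
    fun _ => Or.inr (by linarith)).smul hf) _ _

namespace EigenBasis

theorem waveCoeff_eq_mlWave (w₀ w₁ : distributions L) (t : ℝ) (ζ : I) :
    E.waveCoeff β w₀ w₁ t ζ = (mlWave β 1 (E.eigenvalue ζ) t : 𝕜) * E.coeff w₀ ζ +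
      (mlWave β 2 (E.eigenvalue ζ) t : 𝕜) * E.coeff w₁ ζ := by
  rw [waveCoeff, mlWave_one, mlWave_two]
  push_cast
  ring

theorem continuous_waveCoeff (hβ : 1 ≤ β) (w₀ w₁ : distributions L) (ζ : I) :
    Continuous fun t => E.waveCoeff β w₀ w₁ t ζ := by
  simp only [waveCoeff_eq_mlWave]
  exact ((RCLike.continuous_ofReal.comp (continuous_mlWave hβ le_rfl _)).mul
    continuous_const).add ((RCLike.continuous_ofReal.comp
      (continuous_mlWave hβ one_le_two _)).mul continuous_const)

theorem waveCoeff_zero (hβ : 0 < β) (w₀ w₁ : distributions L) (ζ : I) :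
    E.waveCoeff β w₀ w₁ 0 ζ = E.coeff w₀ ζ := by
  simp [waveCoeff, Real.zero_rpow hβ.ne', mittagLeffler_zero]

/-- The Volterra equations for `ρ = 1` and `ρ = 2` have leading terms `1` and `t`, which carry the
two initial data. -/
theorem waveCoeff_volterra (hβ : 1 ≤ β) (w₀ w₁ : distributions L) (ζ : I) {t : ℝ} (ht : 0 ≤ t) :
    E.waveCoeff β w₀ w₁ t ζ = E.coeff w₀ ζ + t • E.coeff w₁ ζ -
      fracInt β (fun s => (E.eigenvalue ζ : 𝕜) * E.waveCoeff β w₀ w₁ s ζ) t := by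
  set γ := E.eigenvalue ζ
  have h1 : fracInt β (fun s => (γ : 𝕜) * E.waveCoeff β w₀ w₁ s ζ) t =
      ((fracInt β (fun s => γ * mlWave β 1 γ s) t : ℝ) : 𝕜) * E.coeff w₀ ζ +
      ((fracInt β (fun s => γ * mlWave β 2 γ s) t : ℝ) : 𝕜) * E.coeff w₁ ζ := by
    rw [← fracInt_ofReal_mul, ← fracInt_ofReal_mul]
    simp only [fracInt]
    rw [← smul_add, ← intervalIntegral.integral_add]
    · refine congrArg _ (intervalIntegral.integral_congr fun s _ => ?_)
      simp only [waveCoeff_eq_mlWave, ← smul_add]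
      push_cast
      congr 1
      ring
    · exact intervalIntegrable_kernel_mul hβ ((RCLike.continuous_ofReal.comp
        (continuous_const.mul (continuous_mlWave hβ le_rfl _))).mul continuous_const)
    · exact intervalIntegrable_kernel_mul hβ ((RCLike.continuous_ofReal.comp
        (continuous_const.mul (continuous_mlWave hβ one_le_two _))).mul continuous_const)
  have h2 := mlWave_volterra hβ le_rfl γ ht
  have h3 := mlWave_volterra hβ one_le_two γ ht
  rw [h1, waveCoeff_eq_mlWave, h2, h3, RCLike.real_smul_eq_coe_mul]
  norm_num
  ring

theorem norm_waveCoeff_le {w₀ w₁ : distributions L} {ζ : I} {t a b : ℝ} (ht : 0 ≤ t)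
    (ha : |mittagLeffler β 1 (-(E.eigenvalue ζ) * t ^ β)| ≤ a)
    (hb : t * |mittagLeffler β 2 (-(E.eigenvalue ζ) * t ^ β)| ≤ b) :
    ‖E.waveCoeff β w₀ w₁ t ζ‖ ≤ a * ‖E.coeff w₀ ζ‖ + b * ‖E.coeff w₁ ζ‖ := by
  rw [waveCoeff_eq_mlWave, mlWave_one, mlWave_two]
  refine (norm_add_le _ _).trans ?_
  rw [norm_mul, norm_mul, RCLike.norm_ofReal, RCLike.norm_ofReal, abs_mul, abs_of_nonneg ht]
  gcongr

end EigenBasis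

/-- A common bound for the Mittag-Leffler functions of the wave equation. -/
theorem exists_mittagLeffler_bound (hβ₁ : 1 < β) (hβ₂ : β < 2) :
    ∃ M : ℝ, 0 < M ∧ ∀ γ t : ℝ, 0 ≤ γ → 0 ≤ t →
      |mittagLeffler β 1 (-γ * t ^ β)| ≤ M * (1 + γ * t ^ β)⁻¹ ∧
      |mittagLeffler β 2 (-γ * t ^ β)| ≤ M * (1 + γ * t ^ β)⁻¹ := by
  obtain ⟨M, hM0, hM⟩ := exists_mittagLeffler_le hβ₁ hβ₂ (Or.inl rfl : (1 : ℝ) = 1 ∨ (1 : ℝ) = 2)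
  obtain ⟨N, hN0, hN⟩ := exists_mittagLeffler_le hβ₁ hβ₂ (Or.inr rfl : (2 : ℝ) = 1 ∨ (2 : ℝ) = 2)
  refine ⟨M + N, by positivity, fun γ t hγ ht => ?_⟩
  have h0 : 0 ≤ γ * t ^ β := by positivity
  rw [neg_mul]
  constructor
  · refine (hM _ h0).trans ?_
    gcongr
    linarith
  · refine (hN _ h0).trans ?_
    gcongr
    linarith

theorem exists_waveCoeff_bound (hE : E.IsDiagonal) (hβ₁ : 1 < β) (hβ₂ : β < 2) :
    ∃ M : ℝ, 0 < M ∧ ∀ (w₀ w₁ : distributions L) (t : ℝ), 0 ≤ t → ∀ ζ,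
      ‖E.waveCoeff β w₀ w₁ t ζ‖ ≤ M * ‖E.coeff w₀ ζ‖ + (M * t) * ‖E.coeff w₁ ζ‖ := by
  obtain ⟨M, hM0, hM⟩ := exists_mittagLeffler_bound hβ₁ hβ₂
  refine ⟨M, hM0, fun w₀ w₁ t ht ζ => ?_⟩
  obtain ⟨h1, h2⟩ := hM (E.eigenvalue ζ) t (hE.eigenvalue_nonneg ζ) ht
  have h3 : (1 + E.eigenvalue ζ * t ^ β)⁻¹ ≤ 1 := by
    have := mul_nonneg (hE.eigenvalue_nonneg ζ) (Real.rpow_nonneg ht β)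
    exact inv_le_one_of_one_le₀ (by linarith)
  have h4 : M * (1 + E.eigenvalue ζ * t ^ β)⁻¹ ≤ M := mul_le_of_le_one_right hM0.le h3
  refine EigenBasis.norm_waveCoeff_le ht (h1.trans h4) ?_
  rw [mul_comm M]
  exact mul_le_mul_of_nonneg_left (h2.trans h4) ht

/-- At fixed `t` the multipliers are bounded in `ζ`, so the weight exponents of the two data, added
together, serve for the solution. -/
theorem exists_wave (hE : E.IsDiagonal) (hβ₁ : 1 < β) (hβ₂ : β < 2) (w₀ w₁ : distributions L) :
    ∃ w : ℝ → distributions L, ∀ t, 0 ≤ t → ∀ ζ, E.coeff (w t) ζ = E.waveCoeff β w₀ w₁ t ζ := by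
  obtain ⟨M, hM0, hM⟩ := exists_waveCoeff_bound hE hβ₁ hβ₂
  obtain ⟨k, hk⟩ := EigenBasis.exists_summable_weight hE w₀
  obtain ⟨l, hl⟩ := EigenBasis.exists_summable_weight hE w₁
  have key : ∀ t, ∃ u : distributions L, 0 ≤ t → ∀ ζ, E.coeff u ζ = E.waveCoeff β w₀ w₁ t ζ := by
    intro t
    rcases lt_or_ge t 0 with ht | ht
    -- Negative times carry no requirement; `0` is an arbitrary value there.
    · exact ⟨0, fun h => absurd h (not_le.2 ht)⟩
    have hs : Summable fun ζ => (((1 + E.eigenvalue ζ) ^ (k + l))⁻¹ *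
        ‖E.waveCoeff β w₀ w₁ t ζ‖) ^ 2 := by
      refine Summable.of_nonneg_of_le (fun ζ => sq_nonneg _) (fun ζ => ?_)
        ((hk.mul_left (2 * M ^ 2)).add (hl.mul_left (2 * (M * t) ^ 2)))
      have h1 := EigenBasis.one_le_one_add hE ζ
      have hg : ∀ m n : ℕ, m ≤ n →
          ((1 + E.eigenvalue ζ) ^ n)⁻¹ ≤ ((1 + E.eigenvalue ζ) ^ m)⁻¹ := fun m n hmn =>
        inv_anti₀ (pow_pos (by linarith) m) (pow_le_pow_right₀ h1 hmn)
      have hg0 : 0 ≤ ((1 + E.eigenvalue ζ) ^ (k + l))⁻¹ := inv_nonneg.2 (pow_nonneg (by linarith) _)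
      have h2 : ((1 + E.eigenvalue ζ) ^ (k + l))⁻¹ * ‖E.waveCoeff β w₀ w₁ t ζ‖ ≤
          M * (((1 + E.eigenvalue ζ) ^ k)⁻¹ * ‖E.coeff w₀ ζ‖) +
          M * t * (((1 + E.eigenvalue ζ) ^ l)⁻¹ * ‖E.coeff w₁ ζ‖) := by
        calc ((1 + E.eigenvalue ζ) ^ (k + l))⁻¹ * ‖E.waveCoeff β w₀ w₁ t ζ‖
            ≤ ((1 + E.eigenvalue ζ) ^ (k + l))⁻¹ *
              (M * ‖E.coeff w₀ ζ‖ + (M * t) * ‖E.coeff w₁ ζ‖) :=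
              mul_le_mul_of_nonneg_left (hM w₀ w₁ t ht ζ) hg0
          _ = ((1 + E.eigenvalue ζ) ^ (k + l))⁻¹ * (M * ‖E.coeff w₀ ζ‖) +
              ((1 + E.eigenvalue ζ) ^ (k + l))⁻¹ * ((M * t) * ‖E.coeff w₁ ζ‖) := by ring
          _ ≤ ((1 + E.eigenvalue ζ) ^ k)⁻¹ * (M * ‖E.coeff w₀ ζ‖) +
              ((1 + E.eigenvalue ζ) ^ l)⁻¹ * ((M * t) * ‖E.coeff w₁ ζ‖) := by
              have e1 := hg k (k + l) (Nat.le_add_right k l)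
              have e2 := hg l (k + l) (Nat.le_add_left l k)
              gcongr
          _ = _ := by ring
      refine (pow_le_pow_left₀ (mul_nonneg hg0 (norm_nonneg _)) h2 2).trans ?_
      refine (add_sq_le).trans (le_of_eq ?_)
      ring
    obtain ⟨u, hu⟩ := EigenBasis.exists_distribution hE hs
    exact ⟨u, fun _ => hu⟩
  choose w hw using key
  exact ⟨w, fun t ht => hw t ht⟩

/-! ### Existence and uniqueness of the solution -/

section Solution

variable {w₀ w₁ : distributions L} {w : ℝ → distributions L}

/-- Weierstrass' test on each `[0, T]`, with the multiplier bounds frozen at `T`. -/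
theorem continuousOn_pairing_wave (hE : E.IsDiagonal) (hβ₁ : 1 < β) (hβ₂ : β < 2)
    (hw : ∀ t, 0 ≤ t → ∀ ζ, E.coeff (w t) ζ = E.waveCoeff β w₀ w₁ t ζ) (φ : testSpace L) :
    ContinuousOn (fun t => pairing (w t) φ) (Ici 0) := by
  obtain ⟨M, hM0, hM⟩ := exists_waveCoeff_bound hE hβ₁ hβ₂
  have key : ∀ T : ℝ, ContinuousOn (fun t => pairing (w t) φ) (Icc 0 T) := by
    intro T
    have h1 : ContinuousOn (fun t => ∑' ζ, starRingEnd 𝕜 ⟪E.basis ζ, (φ : H)⟫_𝕜 *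
        E.waveCoeff β w₀ w₁ t ζ) (Icc 0 T) := by
      refine continuousOn_tsum (fun ζ => (continuous_const.mul
        (EigenBasis.continuous_waveCoeff hβ₁.le w₀ w₁ ζ)).continuousOn)
        (((EigenBasis.summable_norm_pairing hE w₀ φ).mul_left M).add
          ((EigenBasis.summable_norm_pairing hE w₁ φ).mul_left (M * T))) fun ζ t ht => ?_
      rw [norm_mul, RCLike.norm_conj]
      calc ‖⟪E.basis ζ, (φ : H)⟫_𝕜‖ * ‖E.waveCoeff β w₀ w₁ t ζ‖
          ≤ ‖⟪E.basis ζ, (φ : H)⟫_𝕜‖ * (M * ‖E.coeff w₀ ζ‖ + (M * T) * ‖E.coeff w₁ ζ‖) := by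
            refine mul_le_mul_of_nonneg_left ((hM w₀ w₁ t ht.1 ζ).trans ?_) (norm_nonneg _)
            have := ht.2
            gcongr
        _ = _ := by ring
    refine h1.congr fun t ht => ?_
    have h2 := (EigenBasis.hasSum_pairing hE (w t) φ).tsum_eq
    simp only [hw t ht.1] at h2
    exact h2.symm
  intro t ht
  refine (key (t + 1) t ⟨ht, by linarith⟩).mono_of_mem_nhdsWithin ?_
  filter_upwards [self_mem_nhdsWithin, mem_nhdsWithin_of_mem_nhds (Iio_mem_nhds (lt_add_one t))]
    with s hs hs'
  exact ⟨hs, (mem_Iio.1 hs').le⟩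

/-- The scalar Volterra equations are summed against the coefficients of `φ`. The unbounded factor
`γ_ζ` is absorbed by the test function, as the coefficient of `Lφ`, so the termwise integration has
a summable majorant. -/
theorem pairing_wave_volterra [Countable I] (hE : E.IsDiagonal) (hβ₁ : 1 < β) (hβ₂ : β < 2)
    (hw : ∀ t, 0 ≤ t → ∀ ζ, E.coeff (w t) ζ = E.waveCoeff β w₀ w₁ t ζ) (φ : testSpace L) {t : ℝ}
    (ht : 0 ≤ t) :
    pairing (w t) φ = pairing w₀ φ + t • pairing w₁ φ -
      fracInt β (fun s => pairing (w s) (testOp L φ)) t := by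
  obtain ⟨M, hM0, hM⟩ := exists_waveCoeff_bound hE hβ₁ hβ₂
  set p : I → 𝕜 := fun ζ => starRingEnd 𝕜 ⟪E.basis ζ, (φ : H)⟫_𝕜 with hp
  set q : I → 𝕜 := fun ζ => starRingEnd 𝕜 ⟪E.basis ζ, (testOp L φ : H)⟫_𝕜 with hq
  have hqp : ∀ ζ, q ζ = (E.eigenvalue ζ : 𝕜) * p ζ := by
    intro ζ
    simp only [hq, hp, EigenBasis.inner_testOp hE, map_mul, RCLike.conj_ofReal]
  have h1 : HasSum (fun ζ => fracInt β (fun s => q ζ * E.waveCoeff β w₀ w₁ s ζ) t)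
      (fracInt β (fun s => pairing (w s) (testOp L φ)) t) := by
    refine hasSum_fracInt hβ₁.le ht (fun ζ => (continuous_const.mul
      (EigenBasis.continuous_waveCoeff hβ₁.le w₀ w₁ ζ)).continuousOn)
      (((EigenBasis.summable_norm_pairing hE w₀ (testOp L φ)).mul_left M).add
        ((EigenBasis.summable_norm_pairing hE w₁ (testOp L φ)).mul_left (M * t)))
      (fun ζ s hs => ?_) fun s hs => ?_
    · rw [norm_mul, hq, RCLike.norm_conj]
      calc ‖⟪E.basis ζ, (testOp L φ : H)⟫_𝕜‖ * ‖E.waveCoeff β w₀ w₁ s ζ‖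
          ≤ ‖⟪E.basis ζ, (testOp L φ : H)⟫_𝕜‖ *
            (M * ‖E.coeff w₀ ζ‖ + (M * t) * ‖E.coeff w₁ ζ‖) := by
            refine mul_le_mul_of_nonneg_left ((hM w₀ w₁ s hs.1 ζ).trans ?_) (norm_nonneg _)
            have := hs.2
            gcongr
        _ = _ := by ring
    · have h2 := EigenBasis.hasSum_pairing hE (w s) (testOp L φ)
      simpa only [hw s hs.1] using h2
  have h2 := ((EigenBasis.hasSum_pairing hE w₀ φ).add
    ((EigenBasis.hasSum_pairing hE w₁ φ).const_smul t)).sub h1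
  refine (EigenBasis.hasSum_pairing hE (w t) φ).unique ?_
  convert! h2 using 1
  funext ζ
  have h3 : fracInt β (fun s => q ζ * E.waveCoeff β w₀ w₁ s ζ) t =
      p ζ * fracInt β (fun s => (E.eigenvalue ζ : 𝕜) * E.waveCoeff β w₀ w₁ s ζ) t := by
    rw [← fracInt_const_mul]
    simp only [hqp, mul_assoc, mul_left_comm]
  rw [h3, hw t ht, EigenBasis.waveCoeff_volterra hβ₁.le w₀ w₁ ζ ht, mul_sub, mul_add,
    mul_smul_comm]

/-- The scalar theorem is applied to `(w, φ)`, `(w, Lφ)` and `(w, L²φ)`; all three are covered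
because `L` preserves the test space. -/
theorem isWaveSolution_wave [Countable I] (hE : E.IsDiagonal) (hβ₁ : 1 < β) (hβ₂ : β < 2)
    (hw : ∀ t, 0 ≤ t → ∀ ζ, E.coeff (w t) ζ = E.waveCoeff β w₀ w₁ t ζ) :
    IsWaveSolution L β w₀ w₁ w := by
  have hmain := fun φ : testSpace L => caputo_of_volterra hβ₁ hβ₂
    (continuousOn_pairing_wave hE hβ₁ hβ₂ hw (testOp L φ))
    (continuousOn_pairing_wave hE hβ₁ hβ₂ hw (testOp L (testOp L φ)))
    (fun t ht => pairing_wave_volterra hE hβ₁ hβ₂ hw φ ht)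
    (fun t ht => pairing_wave_volterra hE hβ₁ hβ₂ hw (testOp L φ) ht)
  refine ⟨fun φ => ?_, ?_, fun φ => (hmain φ).2.1, fun t ht φ => (hmain φ).2.2 t ht⟩
  · rw [natFloor_eq_one hβ₁ hβ₂]
    exact (hmain φ).1
  · exact EigenBasis.distribution_ext hE fun ζ => by
      rw [hw 0 le_rfl, EigenBasis.waveCoeff_zero (by linarith)]

theorem IsWaveSolution.coeff_volterra (hβ₁ : 1 < β) (hβ₂ : β < 2)
    (h : IsWaveSolution L β w₀ w₁ w) (ζ : I) :
    ContinuousOn (fun t => E.coeff (w t) ζ) (Ici 0) ∧ ∀ t, 0 ≤ t →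
      E.coeff (w t) ζ = E.coeff w₀ ζ + t • E.coeff w₁ ζ -
        fracInt β (fun s => (E.eigenvalue ζ : 𝕜) * E.coeff (w s) ζ) t := by
  have hreg := h.regular ⟨E.basis ζ, E.mem_testSpace ζ⟩
  rw [natFloor_eq_one hβ₁ hβ₂] at hreg
  have hc : ContinuousOn (fun t => E.coeff (w t) ζ) (Ici 0) := hreg.1.continuousOn
  refine ⟨hc, fun t ht => ?_⟩
  have h1 := volterra_of_caputo hβ₁ hβ₂ hreg (g := fun s => (E.eigenvalue ζ : 𝕜) * E.coeff (w s) ζ)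
    (continuousOn_const.mul hc) (fun t ht => by
      have h2 := h.equation t ht ⟨E.basis ζ, E.mem_testSpace ζ⟩
      have h3 : pairing (w t) (testOp L ⟨E.basis ζ, E.mem_testSpace ζ⟩) =
          (E.eigenvalue ζ : 𝕜) * E.coeff (w t) ζ := by
        rw [E.testOp_basis, pairing, LinearMap.map_smulₛₗ, RCLike.conj_ofReal]
        rfl
      rwa [h3] at h2) ht
  rw [h.initial_deriv, h.initial] at h1
  exact h1

theorem IsWaveSolution.eqOn (hE : E.IsDiagonal) (hβ₁ : 1 < β) (hβ₂ : β < 2)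
    {v : ℝ → distributions L} (hv : IsWaveSolution L β w₀ w₁ v)
    (hw : IsWaveSolution L β w₀ w₁ w) : EqOn v w (Ici 0) := by
  intro t ht
  refine EigenBasis.distribution_ext hE fun ζ => ?_
  obtain ⟨c1, h1⟩ := hv.coeff_volterra (E := E) hβ₁ hβ₂ ζ
  obtain ⟨c2, h2⟩ := hw.coeff_volterra (E := E) hβ₁ hβ₂ ζ
  exact volterra_unique hβ₁ c1 c2 h1 h2 ht

end Solution

end Wave

end SpectralWave

namespace SpectralWave

/-! ## Estimates in Sobolev spaces -/

section Sobolev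

variable {𝕜 H I : Type*} [RCLike 𝕜] [NormedAddCommGroup H] [InnerProductSpace 𝕜 H]
  {L : H →ₗ.[𝕜] H} {E : EigenBasis L I} {β δ δ' : ℝ} {w₀ w₁ : distributions L}
  {w : ℝ → distributions L} {a b : ℝ → ℝ}

/-- The multipliers of the wave equation are bounded by `a` and, relative to the loss of
derivatives `δ - δ'`, by `b`. -/
structure EigenBasis.HasWaveBound (E : EigenBasis L I) (β δ δ' : ℝ) (a b : ℝ → ℝ) : Prop where
  nonneg_left : ∀ t, 0 ≤ t → 0 ≤ a t
  nonneg_right : ∀ t, 0 ≤ t → 0 ≤ b t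
  bound_left : ∀ t, 0 ≤ t → ∀ ζ, |mittagLeffler β 1 (-(E.eigenvalue ζ) * t ^ β)| ≤ a t
  bound_right : ∀ t, 0 ≤ t → ∀ ζ, (1 + E.eigenvalue ζ) ^ ((δ - δ') / 2) *
    (t * |mittagLeffler β 2 (-(E.eigenvalue ζ) * t ^ β)|) ≤ b t

/-- The weight of order `δ` is written as the square of `(1 + γ)^((δ-δ')/2)`, absorbed by the
multiplier of `w₁`, times the weight of order `δ'`. -/
theorem EigenBasis.weight_waveCoeff_le (hE : E.IsDiagonal) (hb : E.HasWaveBound β δ δ' a b)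
    {t : ℝ} (ht : 0 ≤ t) (ζ : I) :
    (1 + E.eigenvalue ζ) ^ δ * ‖E.waveCoeff β w₀ w₁ t ζ‖ ^ 2 ≤
      2 * (a t ^ 2 * ((1 + E.eigenvalue ζ) ^ δ * ‖E.coeff w₀ ζ‖ ^ 2) +
        b t ^ 2 * ((1 + E.eigenvalue ζ) ^ δ' * ‖E.coeff w₁ ζ‖ ^ 2)) := by
  have hg : 0 < 1 + E.eigenvalue ζ := by linarith [EigenBasis.one_le_one_add hE ζ]
  set g := 1 + E.eigenvalue ζ
  set m := |mittagLeffler β 2 (-(E.eigenvalue ζ) * t ^ β)| with hm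
  have h1 : ‖E.waveCoeff β w₀ w₁ t ζ‖ ≤ a t * ‖E.coeff w₀ ζ‖ + t * m * ‖E.coeff w₁ ζ‖ :=
    norm_waveCoeff_le ht (hb.bound_left t ht ζ) le_rfl
  have h2 : g ^ δ = (g ^ ((δ - δ') / 2)) ^ 2 * g ^ δ' := by
    rw [← Real.rpow_mul_natCast hg.le, ← Real.rpow_add hg]
    congr 1
    push_cast
    ring
  have h3 : (g ^ ((δ - δ') / 2) * (t * m)) ^ 2 ≤ b t ^ 2 :=
    pow_le_pow_left₀ (by positivity) (hb.bound_right t ht ζ) 2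
  have hgδ := Real.rpow_pos_of_pos hg δ
  have hgδ' := Real.rpow_pos_of_pos hg δ'
  calc g ^ δ * ‖E.waveCoeff β w₀ w₁ t ζ‖ ^ 2
      ≤ g ^ δ * (2 * ((a t * ‖E.coeff w₀ ζ‖) ^ 2 + (t * m * ‖E.coeff w₁ ζ‖) ^ 2)) := by
        refine mul_le_mul_of_nonneg_left ?_ hgδ.le
        exact (pow_le_pow_left₀ (norm_nonneg _) h1 2).trans add_sq_le
    _ = 2 * (a t ^ 2 * (g ^ δ * ‖E.coeff w₀ ζ‖ ^ 2) +
          (t * m * ‖E.coeff w₁ ζ‖) ^ 2 * g ^ δ) := by ring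
    _ = 2 * (a t ^ 2 * (g ^ δ * ‖E.coeff w₀ ζ‖ ^ 2) +
          (g ^ ((δ - δ') / 2) * (t * m)) ^ 2 * (g ^ δ' * ‖E.coeff w₁ ζ‖ ^ 2)) := by
        rw [h2]
        ring
    _ ≤ _ := by gcongr

theorem EigenBasis.weight_nonneg (hE : E.IsDiagonal) (δ : ℝ) (c : 𝕜) (ζ : I) :
    0 ≤ (1 + E.eigenvalue ζ) ^ δ * ‖c‖ ^ 2 :=
  mul_nonneg (Real.rpow_nonneg (by linarith [EigenBasis.one_le_one_add hE ζ]) _) (sq_nonneg _)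

theorem memSobolev_wave (hE : E.IsDiagonal) (hb : E.HasWaveBound β δ δ' a b)
    (hw : ∀ t, 0 ≤ t → ∀ ζ, E.coeff (w t) ζ = E.waveCoeff β w₀ w₁ t ζ)
    (h₀ : E.MemSobolev δ w₀) (h₁ : E.MemSobolev δ' w₁) {t : ℝ} (ht : 0 ≤ t) :
    E.MemSobolev δ (w t) ∧ E.sobolevNorm δ (w t) ≤
      2 * (a t * E.sobolevNorm δ w₀ + b t * E.sobolevNorm δ' w₁) := by
  have hs := (((h₀ : Summable _).mul_left (a t ^ 2)).add
    ((h₁ : Summable _).mul_left (b t ^ 2))).mul_left 2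
  have hle := fun ζ => EigenBasis.weight_waveCoeff_le (w₀ := w₀) (w₁ := w₁) hE hb ht ζ
  have hmem : E.MemSobolev δ (w t) := by
    unfold EigenBasis.MemSobolev
    simp only [hw t ht]
    exact Summable.of_nonneg_of_le (fun ζ => EigenBasis.weight_nonneg hE _ _ ζ) hle hs
  refine ⟨hmem, ?_⟩
  have ha := hb.nonneg_left t ht
  have hb' := hb.nonneg_right t ht
  set X := E.sobolevNorm δ w₀ with hX
  set Y := E.sobolevNorm δ' w₁ with hY
  have hX0 : 0 ≤ X := Real.sqrt_nonneg _
  have hY0 : 0 ≤ Y := Real.sqrt_nonneg _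
  have hX2 : ∑' ζ, (1 + E.eigenvalue ζ) ^ δ * ‖E.coeff w₀ ζ‖ ^ 2 = X ^ 2 :=
    (Real.sq_sqrt (tsum_nonneg fun ζ => EigenBasis.weight_nonneg hE _ _ ζ)).symm
  have hY2 : ∑' ζ, (1 + E.eigenvalue ζ) ^ δ' * ‖E.coeff w₁ ζ‖ ^ 2 = Y ^ 2 :=
    (Real.sq_sqrt (tsum_nonneg fun ζ => EigenBasis.weight_nonneg hE _ _ ζ)).symm
  refine Real.sqrt_le_iff.2 ⟨by positivity, ?_⟩
  have h1 : ∑' ζ, (1 + E.eigenvalue ζ) ^ δ * ‖E.coeff (w t) ζ‖ ^ 2 ≤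
      2 * (a t ^ 2 * X ^ 2 + b t ^ 2 * Y ^ 2) := by
    rw [← hX2, ← hY2, ← tsum_mul_left, ← tsum_mul_left,
      ← ((h₀ : Summable _).mul_left _).tsum_add ((h₁ : Summable _).mul_left _), ← tsum_mul_left]
    refine hmem.tsum_le_tsum (fun ζ => ?_) hs
    rw [hw t ht]
    exact hle ζ
  refine h1.trans ?_
  have := mul_nonneg (mul_nonneg ha hX0) (mul_nonneg hb' hY0)
  -- It remains that `2 (A² + B²) ≤ (2 (A + B))²` for nonnegative `A` and `B`; the constant `2` is
  -- not meant to be sharp.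
  nlinarith [mul_nonneg ha hX0, mul_nonneg hb' hY0]

theorem isWaveSeries_wave (hE : E.IsDiagonal) (hb : E.HasWaveBound β δ δ' a b)
    (hw : ∀ t, 0 ≤ t → ∀ ζ, E.coeff (w t) ζ = E.waveCoeff β w₀ w₁ t ζ)
    (h₀ : E.MemSobolev δ w₀) (h₁ : E.MemSobolev δ' w₁) :
    E.IsWaveSeries β δ w₀ w₁ w := by
  classical
  intro t ht
  have hmem := (memSobolev_wave hE hb hw h₀ h₁ ht).1
  refine ⟨hmem, ?_⟩
  rw [← Real.sqrt_zero]
  refine (Real.continuous_sqrt.tendsto 0).comp ?_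
  rw [← tsum_zero (β := I)]
  refine tendsto_tsum_of_dominated_convergence hmem (fun ζ => ?_)
    (Eventually.of_forall fun s ζ => ?_)
  · refine tendsto_const_nhds.congr' ?_
    filter_upwards [eventually_ge_atTop {ζ}] with s hs
    have hζ : ζ ∈ s := hs (Finset.mem_singleton_self ζ)
    rw [EigenBasis.coeff_sub, EigenBasis.coeff_sum_smul_basis, if_pos hζ, hw t ht]
    simp
  · rw [Real.norm_of_nonneg (EigenBasis.weight_nonneg hE _ _ ζ), EigenBasis.coeff_sub,
      EigenBasis.coeff_sum_smul_basis, hw t ht]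
    have := EigenBasis.weight_nonneg hE δ (E.waveCoeff β w₀ w₁ t ζ) ζ
    split_ifs <;> simp [this]

/-- Each coefficient is continuous in time, and near `t` the bounds `a`, `b` stay below `a t + 1`,
`b t + 1`; dominated convergence over `ζ` does the rest. Only here is continuity of the bounds
needed, hence the set `S`. -/
theorem sobolevContinuousOn_wave (hE : E.IsDiagonal) (hβ₁ : 1 < β)
    (hb : E.HasWaveBound β δ δ' a b)
    (hw : ∀ t, 0 ≤ t → ∀ ζ, E.coeff (w t) ζ = E.waveCoeff β w₀ w₁ t ζ)
    (h₀ : E.MemSobolev δ w₀) (h₁ : E.MemSobolev δ' w₁) {S : Set ℝ} (hS : S ⊆ Ici 0)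
    (ha' : ContinuousOn a S) (hb' : ContinuousOn b S) :
    E.SobolevContinuousOn δ w S := by
  refine ⟨fun t ht => (memSobolev_wave hE hb hw h₀ h₁ (hS ht)).1, fun t ht => ?_⟩
  set A := a t + 1
  set B := b t + 1
  set c : I → ℝ := fun ζ => 2 * (A ^ 2 * ((1 + E.eigenvalue ζ) ^ δ * ‖E.coeff w₀ ζ‖ ^ 2) +
        B ^ 2 * ((1 + E.eigenvalue ζ) ^ δ' * ‖E.coeff w₁ ζ‖ ^ 2)) with hc
  have hs : Summable c := (((h₀ : Summable _).mul_left (A ^ 2)).add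
    ((h₁ : Summable _).mul_left (B ^ 2))).mul_left 2
  have hle : ∀ s, 0 ≤ s → a s ≤ A → b s ≤ B → ∀ ζ,
      (1 + E.eigenvalue ζ) ^ δ * ‖E.waveCoeff β w₀ w₁ s ζ‖ ^ 2 ≤ c ζ := by
    intro s hs0 h2 h3 ζ
    refine (EigenBasis.weight_waveCoeff_le hE hb hs0 ζ).trans ?_
    have e1 := hb.nonneg_left s hs0
    have e2 := hb.nonneg_right s hs0
    have e3 := EigenBasis.weight_nonneg hE δ (E.coeff w₀ ζ) ζ
    have e4 := EigenBasis.weight_nonneg hE δ' (E.coeff w₁ ζ) ζ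
    simp only [hc]
    gcongr
  rw [← Real.sqrt_zero]
  refine (Real.continuous_sqrt.tendsto 0).comp ?_
  rw [← tsum_zero (β := I)]
  -- The factor `4` comes from `‖x - y‖² ≤ 2 (‖x‖² + ‖y‖²)` with both weighted squares at most `c
  -- ζ`.
  refine tendsto_tsum_of_dominated_convergence (bound := fun ζ => 4 * c ζ) (hs.mul_left 4)
    (fun ζ => ?_) ?_
  · have h4 : Tendsto (fun s => (1 + E.eigenvalue ζ) ^ δ *
        ‖E.waveCoeff β w₀ w₁ s ζ - E.waveCoeff β w₀ w₁ t ζ‖ ^ 2) (𝓝[S] t) (𝓝 0) := by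
      have h5 := (((EigenBasis.continuous_waveCoeff (E := E) hβ₁.le w₀ w₁ ζ).sub
        (continuous_const (y := E.waveCoeff β w₀ w₁ t ζ))).norm.pow 2).const_mul
          ((1 + E.eigenvalue ζ) ^ δ)
      simpa using (h5.tendsto t).mono_left nhdsWithin_le_nhds
    refine h4.congr' ?_
    filter_upwards [self_mem_nhdsWithin] with s hs
    rw [EigenBasis.coeff_sub, hw s (hS hs), hw t (hS ht)]
  · have ea : ∀ᶠ s in 𝓝[S] t, a s ≤ A := (ha' t ht).eventually_le_const (lt_add_one _)
    have eb : ∀ᶠ s in 𝓝[S] t, b s ≤ B := (hb' t ht).eventually_le_const (lt_add_one _)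
    filter_upwards [self_mem_nhdsWithin, ea, eb] with s hs h2 h3 ζ
    rw [Real.norm_of_nonneg (EigenBasis.weight_nonneg hE _ _ ζ), EigenBasis.coeff_sub,
      hw s (hS hs), hw t (hS ht)]
    have e1 := hle s (hS hs) h2 h3 ζ
    have e2 := hle t (hS ht) (lt_add_one _).le (lt_add_one _).le ζ
    have hg : 0 ≤ (1 + E.eigenvalue ζ) ^ δ :=
      Real.rpow_nonneg (by linarith [EigenBasis.one_le_one_add hE ζ]) _
    have e3 : ‖E.waveCoeff β w₀ w₁ s ζ - E.waveCoeff β w₀ w₁ t ζ‖ ^ 2 ≤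
        2 * (‖E.waveCoeff β w₀ w₁ s ζ‖ ^ 2 + ‖E.waveCoeff β w₀ w₁ t ζ‖ ^ 2) :=
      (pow_le_pow_left₀ (norm_nonneg _) (norm_sub_le _ _) 2).trans add_sq_le
    have e4 := mul_le_mul_of_nonneg_left e3 hg
    linarith

/-- Solution, uniqueness, series and estimate from bounds of the multipliers. -/
theorem wave_of_hasWaveBound [Countable I] (hE : E.IsDiagonal) (hβ₁ : 1 < β) (hβ₂ : β < 2)
    (hb : E.HasWaveBound β δ δ' a b) {S : Set ℝ} (hS : S ⊆ Ici 0)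
    (ha' : ContinuousOn a S) (hb' : ContinuousOn b S)
    (h₀ : E.MemSobolev δ w₀) (h₁ : E.MemSobolev δ' w₁) :
    ∃ w : ℝ → distributions L, IsWaveSolution L β w₀ w₁ w ∧ E.SobolevContinuousOn δ w S ∧
      (∀ v, IsWaveSolution L β w₀ w₁ v → EqOn v w (Ici 0)) ∧ E.IsWaveSeries β δ w₀ w₁ w ∧
      ∀ t, 0 ≤ t → E.sobolevNorm δ (w t) ≤
        2 * (a t * E.sobolevNorm δ w₀ + b t * E.sobolevNorm δ' w₁) := by
  obtain ⟨w, hw⟩ := exists_wave hE hβ₁ hβ₂ w₀ w₁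
  have hsol := isWaveSolution_wave hE hβ₁ hβ₂ hw
  exact ⟨w, hsol, sobolevContinuousOn_wave hE hβ₁ hb hw h₀ h₁ hS ha' hb',
    fun v hv => hv.eqOn hE hβ₁ hβ₂ hsol, isWaveSeries_wave hE hb hw h₀ h₁,
    fun t ht => (memSobolev_wave hE hb hw h₀ h₁ ht).2⟩

theorem hasWaveBound_of_le {M : ℝ} (hM0 : 0 < M)
    (hM : ∀ γ t : ℝ, 0 ≤ γ → 0 ≤ t →
      |mittagLeffler β 1 (-γ * t ^ β)| ≤ M * (1 + γ * t ^ β)⁻¹ ∧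
      |mittagLeffler β 2 (-γ * t ^ β)| ≤ M * (1 + γ * t ^ β)⁻¹)
    (hE : E.IsDiagonal) {p q : ℝ → ℝ} (hp : ∀ t, 0 ≤ t → 0 ≤ p t) (hq : ∀ t, 0 ≤ t → 0 ≤ q t)
    (h1 : ∀ t, 0 ≤ t → ∀ ζ, (1 + E.eigenvalue ζ * t ^ β)⁻¹ ≤ p t)
    (h2 : ∀ t, 0 ≤ t → ∀ ζ, (1 + E.eigenvalue ζ) ^ ((δ - δ') / 2) *
      (t * (1 + E.eigenvalue ζ * t ^ β)⁻¹) ≤ q t) :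
    E.HasWaveBound β δ δ' (fun t => M * p t) (fun t => M * q t) where
  nonneg_left t ht := mul_nonneg hM0.le (hp t ht)
  nonneg_right t ht := mul_nonneg hM0.le (hq t ht)
  bound_left t ht ζ := (hM _ t (hE.eigenvalue_nonneg ζ) ht).1.trans
    (mul_le_mul_of_nonneg_left (h1 t ht ζ) hM0.le)
  bound_right t ht ζ := by
    have hg : 0 ≤ (1 + E.eigenvalue ζ) ^ ((δ - δ') / 2) :=
      Real.rpow_nonneg (by linarith [EigenBasis.one_le_one_add hE ζ]) _
    calc (1 + E.eigenvalue ζ) ^ ((δ - δ') / 2) *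
          (t * |mittagLeffler β 2 (-(E.eigenvalue ζ) * t ^ β)|)
        ≤ (1 + E.eigenvalue ζ) ^ ((δ - δ') / 2) *
          (t * (M * (1 + E.eigenvalue ζ * t ^ β)⁻¹)) := by
          have := (hM _ t (hE.eigenvalue_nonneg ζ) ht).2
          gcongr
      _ = M * ((1 + E.eigenvalue ζ) ^ ((δ - δ') / 2) *
          (t * (1 + E.eigenvalue ζ * t ^ β)⁻¹)) := by ring
      _ ≤ M * q t := mul_le_mul_of_nonneg_left (h2 t ht ζ) hM0.le

end Sobolev

/-! ## Elementary inequalities for the multipliers -/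

theorem inv_one_add_mul_le {c γ y : ℝ} (hc0 : 0 < c) (hc1 : c ≤ 1) (hγ : c ≤ γ) (hy : 0 ≤ y) :
    (1 + γ * y)⁻¹ ≤ c⁻¹ * (1 + y)⁻¹ := by
  rw [← mul_inv]
  refine inv_anti₀ (by positivity) ?_
  nlinarith [mul_le_mul_of_nonneg_right hγ hy]

/-- With `y = γ^(1/β) t` the denominator is `1 + y^β`, which dominates both `1` and `y`;
subadditivity of the power `1/β ≤ 1` splits the numerator into at most `t + y`. -/
theorem rpow_inv_mul_le {β γ t : ℝ} (hβ : 1 < β) (hγ : 0 ≤ γ) (ht : 0 ≤ t) :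
    (1 + γ) ^ (1 / β) * (t * (1 + γ * t ^ β)⁻¹) ≤ 1 + t := by
  have hβ0 : 0 < β := by linarith
  have hD : 1 ≤ 1 + γ * t ^ β := by
    have := mul_nonneg hγ (Real.rpow_nonneg ht β)
    linarith
  have h1 : (1 + γ) ^ (1 / β) ≤ 1 + γ ^ (1 / β) := by
    have := Real.rpow_add_le_add_rpow zero_le_one hγ (p := 1 / β) (by positivity)
      ((div_le_one hβ0).2 hβ.le)
    simpa using this
  set y := γ ^ (1 / β) * t with hy
  have hy0 : 0 ≤ y := by positivity
  have h2 : y ^ β = γ * t ^ β := by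
    rw [hy, Real.mul_rpow (by positivity) ht, ← Real.rpow_mul hγ, one_div_mul_cancel hβ0.ne',
      Real.rpow_one]
  have h3 : y ≤ 1 + y ^ β := by
    rcases le_total y 1 with h | h
    · linarith [Real.rpow_nonneg hy0 β]
    · have := Real.rpow_le_rpow_of_exponent_le h hβ.le
      rw [Real.rpow_one] at this
      linarith
  rw [← mul_assoc, ← div_eq_mul_inv, div_le_iff₀ (by linarith)]
  have h4 : (1 + γ) ^ (1 / β) * t ≤ t + y := by
    calc (1 + γ) ^ (1 / β) * t ≤ (1 + γ ^ (1 / β)) * t := by gcongr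
      _ = t + y := by rw [hy]; ring
  rw [h2] at h3
  nlinarith

theorem one_add_mul_le {β γ t : ℝ} (hγ : 0 ≤ γ) (ht : 0 ≤ t) :
    (1 + γ) * (t * (1 + γ * t ^ β)⁻¹) ≤ t * (1 + t ^ (-β)) := by
  rcases ht.eq_or_lt with rfl | h0
  -- At `t = 0` both sides vanish because of the factor `t`, whatever value `0 ^ (-β)` has.
  · simp
  have hz : 0 < t ^ β := Real.rpow_pos_of_pos h0 β
  have hD : 0 < 1 + γ * t ^ β := by positivity
  rw [Real.rpow_neg ht, mul_left_comm]
  refine mul_le_mul_of_nonneg_left ?_ ht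
  rw [← div_eq_mul_inv, div_le_iff₀ hD]
  have : (1 + (t ^ β)⁻¹) * (1 + γ * t ^ β) = 1 + γ + γ * t ^ β + (t ^ β)⁻¹ := by
    field_simp
    ring
  rw [this]
  have : 0 ≤ γ * t ^ β := by positivity
  have : 0 ≤ (t ^ β)⁻¹ := by positivity
  linarith

end SpectralWave

/-! ### The four cases -/

theorem mainTheorem2 {𝕜 H I : Type*} [RCLike 𝕜] [NormedAddCommGroup H] [InnerProductSpace 𝕜 H]
    [CompleteSpace H] [TopologicalSpace.SeparableSpace H] [Countable I]
    (L : H →ₗ.[𝕜] H) (hdense : Dense (L.domain : Set H)) (hpos : SpectralWave.IsPositive L)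
    (E : SpectralWave.EigenBasis L I)
    (hspec : SpectralWave.spectrum L = Set.range fun ζ => (E.eigenvalue ζ : 𝕜))
    (β δ : ℝ) (hβ₁ : 1 < β) (hβ₂ : β < 2) :
    (∃ C : ℝ, 0 < C ∧ ∀ w₀ w₁ : SpectralWave.distributions L,
      E.MemSobolev δ w₀ → E.MemSobolev δ w₁ →
      ∃ w : ℝ → SpectralWave.distributions L,
        SpectralWave.IsWaveSolution L β w₀ w₁ w ∧
        E.SobolevContinuousOn δ w (Set.Ici 0) ∧
        (∀ v, SpectralWave.IsWaveSolution L β w₀ w₁ v → Set.EqOn v w (Set.Ici 0)) ∧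
        E.IsWaveSeries β δ w₀ w₁ w ∧
        ∀ t : ℝ, 0 ≤ t → E.sobolevNorm δ (w t) ≤
          C * (E.sobolevNorm δ w₀ + t * E.sobolevNorm δ w₁)) ∧
    ((0 : 𝕜) ∉ SpectralWave.spectrum L →
      ∃ C : ℝ, 0 < C ∧ ∀ w₀ w₁ : SpectralWave.distributions L,
      E.MemSobolev δ w₀ → E.MemSobolev δ w₁ →
      ∃ w : ℝ → SpectralWave.distributions L,
        SpectralWave.IsWaveSolution L β w₀ w₁ w ∧
        E.SobolevContinuousOn δ w (Set.Ici 0) ∧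
        (∀ v, SpectralWave.IsWaveSolution L β w₀ w₁ v → Set.EqOn v w (Set.Ici 0)) ∧
        E.IsWaveSeries β δ w₀ w₁ w ∧
        ∀ t : ℝ, 0 ≤ t → E.sobolevNorm δ (w t) ≤
          C * ((1 + t ^ β)⁻¹ * E.sobolevNorm δ w₀ +
            t * (1 + t ^ β)⁻¹ * E.sobolevNorm δ w₁)) ∧
    (∃ C : ℝ, 0 < C ∧ ∀ w₀ w₁ : SpectralWave.distributions L,
      E.MemSobolev δ w₀ → E.MemSobolev (δ - 2 / β) w₁ →
      ∃ w : ℝ → SpectralWave.distributions L,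
        SpectralWave.IsWaveSolution L β w₀ w₁ w ∧
        E.SobolevContinuousOn δ w (Set.Ici 0) ∧
        (∀ v, SpectralWave.IsWaveSolution L β w₀ w₁ v → Set.EqOn v w (Set.Ici 0)) ∧
        E.IsWaveSeries β δ w₀ w₁ w ∧
        ∀ t : ℝ, 0 ≤ t → E.sobolevNorm δ (w t) ≤
          C * (E.sobolevNorm δ w₀ + (1 + t) * E.sobolevNorm (δ - 2 / β) w₁)) ∧
    (∃ C : ℝ, 0 < C ∧ ∀ w₀ w₁ : SpectralWave.distributions L,
      E.MemSobolev δ w₀ → E.MemSobolev (δ - 2) w₁ →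
      ∃ w : ℝ → SpectralWave.distributions L,
        SpectralWave.IsWaveSolution L β w₀ w₁ w ∧
        E.SobolevContinuousOn δ w (Set.Ioi 0) ∧
        (∀ v, SpectralWave.IsWaveSolution L β w₀ w₁ v → Set.EqOn v w (Set.Ici 0)) ∧
        E.IsWaveSeries β δ w₀ w₁ w ∧
        ∀ t : ℝ, 0 < t → E.sobolevNorm δ (w t) ≤
          C * (E.sobolevNorm δ w₀ +
            t * (1 + t ^ (-β)) * E.sobolevNorm (δ - 2) w₁)) := by
  have hE := E.isDiagonal hpos hspec
  obtain ⟨M, hM0, hM⟩ := SpectralWave.exists_mittagLeffler_bound hβ₁ hβ₂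
  have hβ0 : 0 < β := by linarith
  have hD : ∀ t : ℝ, 0 ≤ t → ∀ ζ, 0 ≤ E.eigenvalue ζ * t ^ β := fun t ht ζ =>
    mul_nonneg (hE.eigenvalue_nonneg ζ) (Real.rpow_nonneg ht β)
  have hinv : ∀ t : ℝ, 0 ≤ t → ∀ ζ, (1 + E.eigenvalue ζ * t ^ β)⁻¹ ≤ 1 := fun t ht ζ =>
    inv_le_one_of_one_le₀ (by linarith [hD t ht ζ])
  refine ⟨?_, fun h0 => ?_, ?_, ?_⟩
  · have hb := SpectralWave.hasWaveBound_of_le (E := E) (δ := δ) (δ' := δ) (p := fun _ => 1)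
      (q := fun t => t) hM0 hM hE (fun _ _ => zero_le_one) (fun t ht => ht) hinv
      (fun t ht ζ => by
        rw [sub_self, zero_div, Real.rpow_zero, one_mul]
        exact mul_le_of_le_one_right ht (hinv t ht ζ))
    -- `M` comes from the Mittag-Leffler bound and `2` from combining the contributions of the two
    -- data in the Sobolev norm.
    refine ⟨2 * M, by positivity, fun w₀ w₁ h₀ h₁ => ?_⟩
    obtain ⟨w, H1, H2, H3, H4, H5⟩ := SpectralWave.wave_of_hasWaveBound hE hβ₁ hβ₂ hb
      (S := Set.Ici 0) subset_rfl (by fun_prop) (by fun_prop) h₀ h₁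
    refine ⟨w, H1, H2, H3, H4, fun t ht => (H5 t ht).trans (le_of_eq ?_)⟩
    ring
  · obtain ⟨c, hc0, hc1, hc⟩ := E.exists_pos_le_eigenvalue h0 hE
    have hpow : ∀ t : ℝ, 0 ≤ t → 0 < 1 + t ^ β := fun t ht => by
      linarith [Real.rpow_nonneg ht β]
    have hp0 : ∀ t : ℝ, 0 ≤ t → 0 ≤ c⁻¹ * (1 + t ^ β)⁻¹ := fun t ht =>
      mul_nonneg (inv_nonneg.2 hc0.le) (inv_nonneg.2 (hpow t ht).le)
    have hle : ∀ t : ℝ, 0 ≤ t → ∀ ζ, (1 + E.eigenvalue ζ * t ^ β)⁻¹ ≤ c⁻¹ * (1 + t ^ β)⁻¹ :=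
      fun t ht ζ => SpectralWave.inv_one_add_mul_le hc0 hc1 (hc ζ) (Real.rpow_nonneg ht β)
    have hb := SpectralWave.hasWaveBound_of_le (E := E) (δ := δ) (δ' := δ)
      (p := fun t => c⁻¹ * (1 + t ^ β)⁻¹) (q := fun t => t * (c⁻¹ * (1 + t ^ β)⁻¹)) hM0 hM hE
      hp0 (fun t ht => mul_nonneg ht (hp0 t ht)) hle
      (fun t ht ζ => by
        rw [sub_self, zero_div, Real.rpow_zero, one_mul]
        exact mul_le_mul_of_nonneg_left (hle t ht ζ) ht)
    have hcont : ContinuousOn (fun t : ℝ => c⁻¹ * (1 + t ^ β)⁻¹) (Set.Ici 0) :=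
      continuousOn_const.mul (ContinuousOn.inv₀
        (continuous_const.add (Real.continuous_rpow_const hβ0.le)).continuousOn
        fun t ht => (hpow t ht).ne')
    refine ⟨2 * M * c⁻¹, by positivity, fun w₀ w₁ h₀ h₁ => ?_⟩
    obtain ⟨w, H1, H2, H3, H4, H5⟩ := SpectralWave.wave_of_hasWaveBound hE hβ₁ hβ₂ hb
      (S := Set.Ici 0) subset_rfl (continuousOn_const.mul hcont)
      (continuousOn_const.mul (continuousOn_id.mul hcont)) h₀ h₁
    refine ⟨w, H1, H2, H3, H4, fun t ht => (H5 t ht).trans (le_of_eq ?_)⟩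
    ring
  · have hb := SpectralWave.hasWaveBound_of_le (E := E) (δ := δ) (δ' := δ - 2 / β)
      (p := fun _ => 1) (q := fun t => 1 + t) hM0 hM hE (fun _ _ => zero_le_one)
      (fun t ht => by linarith) hinv
      (fun t ht ζ => by
        rw [show (δ - (δ - 2 / β)) / 2 = 1 / β by ring]
        exact SpectralWave.rpow_inv_mul_le hβ₁ (hE.eigenvalue_nonneg ζ) ht)
    refine ⟨2 * M, by positivity, fun w₀ w₁ h₀ h₁ => ?_⟩
    obtain ⟨w, H1, H2, H3, H4, H5⟩ := SpectralWave.wave_of_hasWaveBound hE hβ₁ hβ₂ hb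
      (S := Set.Ici 0) subset_rfl (by fun_prop) (by fun_prop) h₀ h₁
    refine ⟨w, H1, H2, H3, H4, fun t ht => (H5 t ht).trans (le_of_eq ?_)⟩
    ring
  -- The bound `t (1 + t^(-β))` is unbounded as `t → 0`, so continuity is claimed on the open
  -- half-line only. At `t = 0` itself the bound is valid, since both sides carry the factor `t`,
  -- and so the series statement includes `t = 0`.
  · have hb := SpectralWave.hasWaveBound_of_le (E := E) (δ := δ) (δ' := δ - 2)
      (p := fun _ => 1) (q := fun t => t * (1 + t ^ (-β))) hM0 hM hE (fun _ _ => zero_le_one)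
      (fun t ht => mul_nonneg ht (by linarith [Real.rpow_nonneg ht (-β)])) hinv
      (fun t ht ζ => by
        rw [show (δ - (δ - 2)) / 2 = 1 by ring, Real.rpow_one]
        exact SpectralWave.one_add_mul_le (hE.eigenvalue_nonneg ζ) ht)
    have hcont : ContinuousOn (fun t : ℝ => M * (t * (1 + t ^ (-β)))) (Set.Ioi 0) :=
      continuousOn_const.mul (continuousOn_id.mul (continuousOn_const.add
        (continuousOn_id.rpow_const fun t ht => Or.inl (ne_of_gt ht))))
    refine ⟨2 * M, by positivity, fun w₀ w₁ h₀ h₁ => ?_⟩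
    obtain ⟨w, H1, H2, H3, H4, H5⟩ := SpectralWave.wave_of_hasWaveBound hE hβ₁ hβ₂ hb
      (S := Set.Ioi 0) Set.Ioi_subset_Ici_self continuousOn_const hcont h₀ h₁
    refine ⟨w, H1, H2, H3, H4, fun t ht => (H5 t ht.le).trans (le_of_eq ?_)⟩
    ring
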